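/- **Setting.** Let $n\in\mathbb N$ and $V:[0,1]^n\to\mathbb R^n$ be differentiable on the closed cube, with Jacobian $J$, such that $\|V(x)-V(y)\|_2\le\Lambda\|x-y\|_2$ and $\|J(x)-J(y)\|_F\le L\|x-y\|_2$ for all $x,y\in[0,1]^n$. A point $x\in[0,1]^n$ *solves* $\mathrm{VI}(V,[0,1]^n)$ if $V(x)^\top(x-y)\ge 0$ for all $y\in[0,1]^n$. Coordinate $j$ is *zero-satisfied* at $x$ if $V_j(x)=0$, *boundary-satisfied* if ($V_j(x)\le0$ and $x_j=0$) or ($V_j(x)\ge0$ and $x_j=1$), and *satisfied* if one of the two holds. **Assumptions.** Let $0<\sigma_{\min}<\sigma_{\max}$. 1. For all $x\in[0,1]^n$ and $S\subseteq[n]$ with $V_\ell(x)=0$ for all $\ell\in S$, the singular values of $\big(\partial V_s(x)/\partial x_t\big)_{s,t\in S}$ are greater than $\sigma_{\min}$ and less than $\sigma_{\max}$. 2. For all $x\in[0,1]^n$, $S\subseteq[n]$ and $i\notin S$: if $V_\ell(x)=0$ for all $\ell\in S$ and $x_\ell\in\{0,1\}$ for all $\ell\notin S\cup\{i\}$, then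 at most one $j\in S\cup\{i\}$ has $x_j\in\{0,1\}$. 3. For all $x,S,i$ as in 2 (satisfying its two hypotheses) and every nonzero vector $d$ indexed by $S\cup\{i\}$ with $\sum_{k\in S\cup\{i\}}\frac{\partial V_j(x)}{\partial x_k}d_k=0$ for all $j\in S$: $d_j\ne0$ for every $j\in S\cup\{i\}$ with $x_j\in\{0,1\}$. **The dynamics (STay-ON-the-Ridge).** For $i\in[n]$ and $S=\{s_1<\dots<s_m\}\subseteq[i-1]$, $D^i_S(x)$ is the unique unit vector $d$, if there is exactly one, such that $d_j=0$ for $j\notin S\cup\{i\}$, $\nabla V_j(x)^\top d=0$ for $j\in S$, and the determinant of the matrix with rows $r=s_1,\dots,s_m,i$, the $r$-th row being $\big(\frac{\partial V_{s_1}(x)}{\partial x_r},\dots,\frac{\partial V_{s_m}(x)}{\partial x_r},d_r\big)$, has the sign of $(-1)^{|S|}$. The dynamics starts at time $0$ at the origin with $(i,S)=(1,\emptyset)$. As long as the current point $x$ does not solve $\mathrm{VI}(V,[0,1]^n)$, epoch $(i,S)$ follows $\dot z=D^i_S(z)$ in $[0,1]^n$ from $z(0)=x$ until the first time $\tau\ge0$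 at which an exit event occurs. Exit events at $z$ are defined at points where the coordinates in $S$ are zero-satisfied and those in $[i-1]\setminus S$ are boundary-satisfied: * *good*: coordinate $i$ is satisfied at $z$; but in an epoch that was started by a bad event triggered by the coordinate then under examination (first case of "bad" below), the time $\tau=0$ does not count for this; * *bad*, triggered by $j\in S\cup\{i\}$: ($D^i_S(z)_j>0$ and $z_j=1$) or ($D^i_S(z)_j<0$ and $z_j=0$); * *middling*, triggered by $j\in[i-1]\setminus S$: $V_j(z)=0$, and ($\nabla V_j(z)^\top D^i_S(z)>0$ and $z_j=0$) or ($\nabla V_j(z)^\top D^i_S(z)<0$ and $z_j=1$). The next epoch starts at $z(\tau)$, by the first of these rules that applies: after a good event $i$ is added to $S$ if it is zero-satisfied, and then $i\leftarrow i+1$; after a bad event triggered by $j=i$, $(i,S)\leftarrow(i-1,S\setminus\{i-1\})$; after a bad event triggered by $j\ne i$, $S\leftarrow S\setminus\{j\}$; after a middling event triggered by $j$, $S\leftarrow S\cup\{j\}$. **Theorem.** There is $\bar T=\bar T(\sigma_{\min},\sigma_{\max},n,L,\Lambda)>0$ such that for every such $V$ satisfying Assumptions 1–3 the dynamics, which never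 gets stuck and is uniquely determined, stops after finitely many epochs, at some time $T\le\bar T$, at a point $x(T)\in[0,1]^n$ that solves $\mathrm{VI}(V,[0,1]^n)$. Consequently $x(T)$ is a local min-max equilibrium: if $f$ is differentiable on $[0,1]^n$, $A\subseteq[n]$ is a set of minimizing coordinates, and $V_j=-\partial f/\partial x_j$ for $j\in A$, $V_j=\partial f/\partial x_j$ for $j\notin A$, then for all $\varepsilon,\delta>0$ with $\Lambda\delta^2<2\varepsilon$ the point $x=x(T)$ satisfies $f(x)<f(y)+\varepsilon$ for all $y\in[0,1]^n$ with $\|y-x\|_2\le\delta$ that differ from $x$ only in coordinates of $A$, and $f(x)>f(y)-\varepsilon$ for all $y\in[0,1]^n$ with $\|y-x\|_2\le\delta$ that differ from $x$ only in coordinates outside $A$. -/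

import Mathlib

namespace Stonr

open Set

/-- `ℝⁿ` with the Euclidean norm. Coordinates are numbered from `0` to `n - 1`. -/
abbrev Vec (n : ℕ) : Type := EuclideanSpace ℝ (Fin n)

/-- The unit cube `[0, 1]ⁿ`. -/
def cube (n : ℕ) : Set (Vec n) := {x | ∀ j, x j ∈ Icc (0 : ℝ) 1}

/-- Solutions of the variational inequality `VI(V, K)`. -/
def IsVISolution {n : ℕ} (V : Vec n → Vec n) (K : Set (Vec n)) (x : Vec n) : Prop :=
  x ∈ K ∧ ∀ y ∈ K, 0 ≤ inner ℝ (V x) (x - y)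

/-- The Jacobian of `V` on the cube: the entry at `(a, b)` is `∂V_a / ∂x_b`
(derivatives are taken within the cube, so that they make sense on its boundary). -/
noncomputable def jac {n : ℕ} (V : Vec n → Vec n) (x : Vec n) : Matrix (Fin n) (Fin n) ℝ :=
  Matrix.of fun a b => fderivWithin ℝ V (cube n) x (EuclideanSpace.single b 1) a

/-- The Frobenius norm of a matrix. -/
noncomputable def frobenius {n : ℕ} (A : Matrix (Fin n) (Fin n) ℝ) : ℝ :=
  √(∑ a, ∑ b, A a b ^ 2)

/-- `V` is `Λ`-Lipschitz on the cube. -/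
def LipschitzField {n : ℕ} (Λ : ℝ) (V : Vec n → Vec n) : Prop :=
  ∀ x ∈ cube n, ∀ y ∈ cube n, ‖V x - V y‖ ≤ Λ * ‖x - y‖

/-- `V` is differentiable on the cube and its Jacobian is `L`-Lipschitz there,
in Frobenius norm. -/
def SmoothField {n : ℕ} (L : ℝ) (V : Vec n → Vec n) : Prop :=
  DifferentiableOn ℝ V (cube n) ∧
    ∀ x ∈ cube n, ∀ y ∈ cube n, frobenius (jac V x - jac V y) ≤ L * ‖x - y‖

/-- Coordinate `j` of `x` is `0` or `1`. -/
def OnBoundary {n : ℕ} (x : Vec n) (j : Fin n) : Prop := x j = 0 ∨ x j = 1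

/-! ### The three assumptions -/

/-- The square matrix `(∂V_s / ∂x_t)` with `s, t ∈ S`. -/
noncomputable def subJac {n : ℕ} (V : Vec n → Vec n) (S : Finset (Fin n)) (x : Vec n) :
    Matrix S S ℝ :=
  Matrix.of fun s t => jac V x s t

/-- Wherever `V` vanishes on the coordinates `S`, all `|S|` singular values of `subJac V S x`
lie strictly between `σmin` and `σmax`. -/
def Assumption1 {n : ℕ} (σmin σmax : ℝ) (V : Vec n → Vec n) : Prop :=
  ∀ x ∈ cube n, ∀ S : Finset (Fin n), (∀ l ∈ S, V x l = 0) →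
    ∀ k < S.card,
      σmin < (Matrix.toEuclideanLin (subJac V S x)).singularValues k ∧
      (Matrix.toEuclideanLin (subJac V S x)).singularValues k < σmax

def Assumption2 {n : ℕ} (V : Vec n → Vec n) : Prop :=
  ∀ x ∈ cube n, ∀ (S : Finset (Fin n)) (i : Fin n), i ∉ S →
    (∀ l ∈ S, V x l = 0) → (∀ l, l ∉ insert i S → OnBoundary x l) →
    ∀ j ∈ insert i S, ∀ k ∈ insert i S, OnBoundary x j → OnBoundary x k → j = k

/-- A vector indexed by `S ∪ {i}` is given as a vector `d` that vanishes off `S ∪ {i}`. -/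
def Assumption3 {n : ℕ} (V : Vec n → Vec n) : Prop :=
  ∀ (S : Finset (Fin n)) (i : Fin n), i ∉ S → ∀ x ∈ cube n,
    (∀ l ∈ S, V x l = 0) → (∀ l, l ∉ insert i S → OnBoundary x l) →
    ∀ d : Vec n, d ≠ 0 → (∀ l, l ∉ insert i S → d l = 0) →
      (∀ j ∈ S, ∑ k ∈ insert i S, jac V x j k * d k = 0) →
      ∀ j ∈ insert i S, OnBoundary x j → d j ≠ 0

/-! ### Satisfied coordinates -/

def ZeroSat {n : ℕ} (V : Vec n → Vec n) (x : Vec n) (j : Fin n) : Prop := V x j = 0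

def BoundarySat {n : ℕ} (V : Vec n → Vec n) (x : Vec n) (j : Fin n) : Prop :=
  (V x j ≤ 0 ∧ x j = 0) ∨ (0 ≤ V x j ∧ x j = 1)

def Satisfied {n : ℕ} (V : Vec n → Vec n) (x : Vec n) (j : Fin n) : Prop :=
  ZeroSat V x j ∨ BoundarySat V x j

/-! ### The direction of an epoch -/

/-- The bordered matrix with rows `r ∈ S ∪ {i}` and columns `(∂V_s / ∂x_r)_r` for `s ∈ S`,
followed by the column `(d_r)_r`. The index `Sum.inr ()` stands for the row `i` and for the
last column. -/
noncomputable def dirMatrix {n : ℕ} (V : Vec n → Vec n) (i : Fin n) (S : Finset (Fin n))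
    (x d : Vec n) : Matrix (S ⊕ Unit) (S ⊕ Unit) ℝ :=
  Matrix.of fun r c =>
    let row : Fin n := Sum.elim (fun s : S => (s : Fin n)) (fun _ => i) r
    Sum.elim (fun s : S => jac V x s row) (fun _ => d row) c

/-- Admissible unit vectors for `(i, S)` at `x`. -/
def Admissible {n : ℕ} (V : Vec n → Vec n) (i : Fin n) (S : Finset (Fin n))
    (x d : Vec n) : Prop :=
  ‖d‖ = 1 ∧
  (∀ j, j ∉ insert i S → d j = 0) ∧
  (∀ j ∈ S, ∑ k, jac V x j k * d k = 0) ∧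
  SignType.sign (dirMatrix V i S x d).det = SignType.sign ((-1 : ℝ) ^ S.card)

/-- `d` is the direction `D^i_S(x)`: the one and only admissible unit vector. -/
def IsDirection {n : ℕ} (V : Vec n → Vec n) (i : Fin n) (S : Finset (Fin n))
    (x d : Vec n) : Prop :=
  Admissible V i S x d ∧ ∀ d', Admissible V i S x d' → d' = d

/-! ### Exit points of an epoch -/

/-- `x` is a point of the cube where the coordinates in `S` are zero-satisfied and the other
coordinates below `i` are boundary-satisfied. -/
def EpochPoint {n : ℕ} (V : Vec n → Vec n) (i : Fin n) (S : Finset (Fin n))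
    (x : Vec n) : Prop :=
  x ∈ cube n ∧ (∀ j ∈ S, ZeroSat V x j) ∧ ∀ j < i, j ∉ S → BoundarySat V x j

def GoodExit {n : ℕ} (V : Vec n → Vec n) (i : Fin n) (S : Finset (Fin n))
    (x : Vec n) : Prop :=
  EpochPoint V i S x ∧ Satisfied V x i

/-- `x` is a bad exit point, triggered by coordinate `j`. -/
def BadExit {n : ℕ} (V : Vec n → Vec n) (i : Fin n) (S : Finset (Fin n))
    (x : Vec n) (j : Fin n) : Prop :=
  EpochPoint V i S x ∧ j ∈ insert i S ∧ ∃ d, IsDirection V i S x d ∧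
    ((0 < d j ∧ x j = 1) ∨ (d j < 0 ∧ x j = 0))

/-- `x` is a middling exit point, triggered by coordinate `j`. -/
def MiddlingExit {n : ℕ} (V : Vec n → Vec n) (i : Fin n) (S : Finset (Fin n))
    (x : Vec n) (j : Fin n) : Prop :=
  EpochPoint V i S x ∧ j < i ∧ j ∉ S ∧ V x j = 0 ∧ ∃ d, IsDirection V i S x d ∧
    ((0 < ∑ k, jac V x j k * d k ∧ x j = 0) ∨ (∑ k, jac V x j k * d k < 0 ∧ x j = 1))

/-! ### The dynamics -/

/-- The data with which an epoch starts: the index of the coordinate under examination (it can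
grow to `n`, when no coordinate is left to examine), the set `S`, the starting point, and whether
the epoch was started by a bad event triggered by the coordinate under examination. -/
structure State (n : ℕ) where
  idx : ℕ
  S : Finset (Fin n)
  pt : Vec n
  back : Bool

/-- The dynamics starts at the origin, with the first coordinate and `S = ∅`. -/
def start (n : ℕ) : State n := ⟨0, ∅, 0, false⟩

/-- `z` solves `ż(t) = D^i_S(z(t))`, `z(0) = x`, in the cube, on the time interval `[0, τ]`. -/
def IsTrajectory {n : ℕ} (V : Vec n → Vec n) (i : Fin n) (S : Finset (Fin n)) (x : Vec n)
    (τ : ℝ) (z : ℝ → Vec n) : Prop :=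
  0 ≤ τ ∧ z 0 = x ∧ ∀ t ∈ Icc (0 : ℝ) τ, z t ∈ cube n ∧
    ∃ d, IsDirection V i S (z t) d ∧ HasDerivWithinAt z d (Icc (0 : ℝ) τ) t

/-- A good event at the point `y`, reached after time `t` in the epoch that started with `s`.
An epoch that goes back to an earlier coordinate starts where this coordinate is satisfied, and
looks for another point where it is satisfied: there `t = 0` does not count. -/
def GoodEvent {n : ℕ} (V : Vec n → Vec n) (s : State n) (i : Fin n) (t : ℝ) (y : Vec n) : Prop :=
  GoodExit V i s.S y ∧ (s.back = true → 0 < t)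

/-- Some event that ends the epoch occurs at the point `y`, reached after time `t`. -/
def ExitEvent {n : ℕ} (V : Vec n → Vec n) (s : State n) (i : Fin n) (t : ℝ) (y : Vec n) : Prop :=
  GoodEvent V s i t y ∨ (∃ j, BadExit V i s.S y j) ∨ (∃ j, MiddlingExit V i s.S y j)

/-- The epoch that starts with `s` is executed along `z` during the time interval `[0, τ]`,
without any exit event before time `τ`. -/
def Executes {n : ℕ} (V : Vec n → Vec n) (s : State n) (i : Fin n) (τ : ℝ)
    (z : ℝ → Vec n) : Prop :=
  ¬ IsVISolution V (cube n) s.pt ∧ s.idx = (i : ℕ) ∧ IsTrajectory V i s.S s.pt τ z ∧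
    ∀ t ∈ Ico (0 : ℝ) τ, ¬ ExitEvent V s i t (z t)

/-- The data of the next epoch, when the epoch started with `s` ends after time `τ` at `y`. -/
inductive Update {n : ℕ} (V : Vec n → Vec n) (s : State n) (i : Fin n) (τ : ℝ) (y : Vec n) :
    State n → Prop
  | good_zero : GoodEvent V s i τ y → ZeroSat V y i →
      Update V s i τ y ⟨(i : ℕ) + 1, insert i s.S, y, false⟩
  | good_boundary : GoodEvent V s i τ y → ¬ ZeroSat V y i →
      Update V s i τ y ⟨(i : ℕ) + 1, s.S, y, false⟩
  | bad_self (p : Fin n) : (p : ℕ) + 1 = (i : ℕ) →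
      ¬ GoodEvent V s i τ y → BadExit V i s.S y i →
      Update V s i τ y ⟨(p : ℕ), s.S.erase p, y, true⟩
  | bad_other (j : Fin n) : ¬ GoodEvent V s i τ y → ¬ BadExit V i s.S y i →
      j ≠ i → BadExit V i s.S y j →
      Update V s i τ y ⟨(i : ℕ), s.S.erase j, y, false⟩
  | middling (j : Fin n) : ¬ GoodEvent V s i τ y → (¬ ∃ k, BadExit V i s.S y k) →
      MiddlingExit V i s.S y j →
      Update V s i τ y ⟨(i : ℕ), insert j s.S, y, false⟩

/-- The epoch that starts with `s` lasts for time `τ` and is followed by the epoch that starts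
with `s'`. No epoch is executed from a solution of the variational inequality. -/
def EpochStep {n : ℕ} (V : Vec n → Vec n) (s : State n) (τ : ℝ) (s' : State n) : Prop :=
  ∃ (i : Fin n) (z : ℝ → Vec n), Executes V s i τ z ∧ Update V s i τ (z τ) s'

/-- `Run V s m T s'`: from `s` the dynamics can execute `m` epochs, of total duration `T`,
which lead to `s'`. -/
inductive Run {n : ℕ} (V : Vec n → Vec n) (s : State n) : ℕ → ℝ → State n → Prop
  | refl : Run V s 0 0 s
  | step {m : ℕ} {T τ : ℝ} {u v : State n} :
      Run V s m T u → EpochStep V u τ v → Run V s (m + 1) (T + τ) v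

/-- The dynamics stops at time `T` at the point `x`, a solution of the variational inequality.
Some sequence of epochs from the start leads there, and the dynamics can do nothing else: every
sequence of epochs from the start can be continued to this one, and no epoch, even if it has not
come to an exit, lasts beyond time `T`. -/
def StopsAt {n : ℕ} (V : Vec n → Vec n) (T : ℝ) (x : Vec n) : Prop :=
  ∃ (m : ℕ) (s : State n), Run V (start n) m T s ∧ s.pt = x ∧ IsVISolution V (cube n) x ∧
    ∀ (m' : ℕ) (T' : ℝ) (s' : State n), Run V (start n) m' T' s' →
      (∃ (k : ℕ) (R : ℝ), m' + k = m ∧ T' + R = T ∧ Run V s' k R s) ∧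
      ∀ (i : Fin n) (τ : ℝ) (z : ℝ → Vec n), Executes V s' i τ z → T' + τ ≤ T

/-! ### Local min-max equilibria -/

/-- `V` is the field of the min-max problem for `f`, with minimizing coordinates `A`. -/
def IsMinMaxField {n : ℕ} (f : Vec n → ℝ) (A : Finset (Fin n)) (V : Vec n → Vec n) : Prop :=
  DifferentiableOn ℝ f (cube n) ∧
    (∀ x ∈ cube n, ∀ j ∈ A,
      V x j = -(fderivWithin ℝ f (cube n) x (EuclideanSpace.single j 1))) ∧
    (∀ x ∈ cube n, ∀ j, j ∉ A →
      V x j = fderivWithin ℝ f (cube n) x (EuclideanSpace.single j 1))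

/-- `(ε, δ)`-local min-max equilibria of `f` on the cube, with minimizing coordinates `A`. -/
def IsLocalMinMax {n : ℕ} (f : Vec n → ℝ) (A : Finset (Fin n)) (ε δ : ℝ) (x : Vec n) : Prop :=
  x ∈ cube n ∧
    (∀ y ∈ cube n, (∀ j, j ∉ A → y j = x j) → ‖y - x‖ ≤ δ → f x < f y + ε) ∧
    (∀ y ∈ cube n, (∀ j ∈ A, y j = x j) → ‖y - x‖ ≤ δ → f y - ε < f x)

end Stonr

namespace Stonr

open Set Filter Topology

/-! ### Singular values -/

/-! The dynamics is a path-following argument in the manner of Lemke and Howson. By Assumption 1,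
the equations `V = 0` on `S`, with the coordinates outside `S ∪ {i}` fixed on the boundary, define
curves with tangent `D^i_S`, along which `x_i` moves at speed at least `1 / (1 + |Λ| / σmin)`
(`le_abs_dir`). By Assumption 3, and by Assumption 1 for the constraint `V_i ≥ 0`, such a curve
crosses every active constraint transversally (`slope_ne_zero`). Assumption 2 rules out the
coincidences of events that would make the next state ambiguous. An epoch of positive duration is
thus an arc that starts inward at an active constraint and ends outward at another point
(`exists_epoch`, `slope_neg`).

Orientation makes the arcs fit together. Let `o(S)` be the sign of `(-1)^|S| det J_S`. Cofactor
expansion shows that the direction `d` of `(i, S)` satisfies `sign d_i = o(S)` and `sign (∇V_i · d)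
= -o(S ∪ {i})`. When `j` enters or leaves `S`, `sign_DV_dir` turns the outward motion of the old
epoch into inward motion of the new one. A new coordinate always comes with orientation `1` and a
retreat with `-1`; this is the invariant `Inv`, and it shows that the dynamics never gets stuck.

Termination comes from reversibility: a state can be recovered from its successor
(`step_injective`), and the initial state has no predecessor (`not_step_start`), so no state recurs.
There are finitely many states (`finite_states`), hence a solution is reached.

For the time bound, epochs with the same `(i, S)` are compared. They never meet (`eq_of_meet`), and
at a given level `x_i = c` their points are uniformly separated (`separated`), so at most `N` of
them cross that level, with `N` depending on `n`, `σmin` and `L` only. Hence the intervals between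
their initial and final values of `x_i` have total length at most `N`, and the speed bound converts
this into time; there are `n * 2 ^ n` pairs `(i, S)`. The min-max statement follows by integrating
the gradient along a segment (`le_add_of_solution`). -/

lemma le_norm_apply_of_le_singularValues {E F : Type*} [NormedAddCommGroup E]
    [InnerProductSpace ℝ E] [FiniteDimensional ℝ E] [NormedAddCommGroup F]
    [InnerProductSpace ℝ F] [FiniteDimensional ℝ F] (T : E →ₗ[ℝ] F) {c : ℝ} (hc : 0 ≤ c)
    (h : ∀ k < Module.finrank ℝ E, c ≤ T.singularValues k) (u : E) : c * ‖u‖ ≤ ‖T u‖ := by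
  have hs := T.isSymmetric_adjoint_comp_self
  let b := hs.eigenvectorBasis rfl
  -- In an eigenbasis of `T* T`, whose eigenvalues are the squared singular values, both squared
  -- norms are sums that compare term by term.
  have h1 : ‖T u‖ ^ 2 = ∑ i, hs.eigenvalues rfl i * (inner ℝ (b i) u) ^ 2 := by
    rw [← real_inner_self_eq_norm_sq, ← LinearMap.adjoint_inner_left, ← LinearMap.comp_apply,
      ← b.sum_inner_mul_inner]
    refine Finset.sum_congr rfl fun i _ => ?_
    rw [hs u (b i), hs.apply_eigenvectorBasis rfl i]
    simp only [RCLike.ofReal_real_eq_id, id, inner_smul_right, real_inner_comm u (b i)]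
    ring
  have h2 : ‖u‖ ^ 2 = ∑ i, (inner ℝ (b i) u) ^ 2 := by
    rw [← real_inner_self_eq_norm_sq, ← b.sum_inner_mul_inner]
    refine Finset.sum_congr rfl fun i _ => ?_
    rw [real_inner_comm u (b i)]; ring
  have h3 : (c * ‖u‖) ^ 2 ≤ ‖T u‖ ^ 2 := by
    rw [mul_pow, h1, h2, Finset.mul_sum]
    refine Finset.sum_le_sum fun i _ => ?_
    have := T.sq_singularValues_fin rfl i
    rw [← this]
    have := h i i.2
    gcongr
  exact (abs_le_of_sq_le_sq' h3 (norm_nonneg _)).2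

/-! ### The derivative of the field -/

section Derivative

variable {n : ℕ}

/-- The derivative of `V` within the cube. -/
noncomputable abbrev DV (V : Vec n → Vec n) (x : Vec n) : Vec n →L[ℝ] Vec n :=
  fderivWithin ℝ V (cube n) x

lemma sum_single (d : Vec n) : d = ∑ k, d k • EuclideanSpace.single k (1 : ℝ) := by
  ext j
  simp [Pi.single_apply]

lemma sum_jac_mul (V : Vec n → Vec n) (x d : Vec n) (j : Fin n) :
    ∑ k, jac V x j k * d k = DV V x d j := by
  conv_rhs => rw [sum_single d]
  simp [jac, map_sum, mul_comm]

lemma sum_insert_jac_mul (V : Vec n → Vec n) (x d : Vec n) (j i : Fin n) (S : Finset (Fin n))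
    (hd : ∀ l, l ∉ insert i S → d l = 0) :
    ∑ k ∈ insert i S, jac V x j k * d k = DV V x d j := by
  rw [← sum_jac_mul]
  refine Finset.sum_subset (Finset.subset_univ _) fun k _ hk => ?_
  rw [hd k hk, mul_zero]

/-- The restriction of a vector to the coordinates in `S`. -/
noncomputable def restr (S : Finset (Fin n)) (v : Vec n) : EuclideanSpace ℝ S :=
  WithLp.toLp 2 fun s => v s

lemma norm_restr_le (S : Finset (Fin n)) (v : Vec n) : ‖restr S v‖ ≤ ‖v‖ := by
  rw [EuclideanSpace.norm_eq, EuclideanSpace.norm_eq]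
  refine Real.sqrt_le_sqrt ?_
  have : ∑ s : S, ‖restr S v s‖ ^ 2 = ∑ s ∈ S, ‖v s‖ ^ 2 :=
    Finset.sum_coe_sort S fun s => ‖v s‖ ^ 2
  rw [this]
  exact Finset.sum_le_sum_of_subset_of_nonneg (Finset.subset_univ _) fun _ _ _ => by positivity

lemma norm_restr_of_support {S : Finset (Fin n)} {v : Vec n} (hv : ∀ l, l ∉ S → v l = 0) :
    ‖restr S v‖ = ‖v‖ := by
  rw [EuclideanSpace.norm_eq, EuclideanSpace.norm_eq]
  congr 1
  have : ∑ s : S, ‖restr S v s‖ ^ 2 = ∑ s ∈ S, ‖v s‖ ^ 2 :=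
    Finset.sum_coe_sort S fun s => ‖v s‖ ^ 2
  rw [this]
  exact Finset.sum_subset (Finset.subset_univ _) fun k _ hk => by simp [hv k hk]

lemma subJac_mulVec {V : Vec n → Vec n} {S : Finset (Fin n)} {x v : Vec n}
    (hv : ∀ l, l ∉ S → v l = 0) (s : S) :
    (subJac V S x).mulVec (fun t => v t) s = DV V x v s := by
  rw [← sum_jac_mul]
  simp only [Matrix.mulVec, dotProduct, subJac, Matrix.of_apply]
  rw [Finset.sum_coe_sort S fun t => jac V x s t * v t]
  exact Finset.sum_subset (Finset.subset_univ _) fun k _ hk => by simp [hv k hk]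

variable {σmin σmax : ℝ} {V : Vec n → Vec n} {S : Finset (Fin n)} {x : Vec n}

/-- The form in which Assumption 1 enters all later arguments. -/
lemma mul_norm_le_norm_restr (hσ : 0 < σmin) (h1 : Assumption1 σmin σmax V) (hx : x ∈ cube n)
    (hS : ∀ l ∈ S, V x l = 0) {u : Vec n} (hu : ∀ l, l ∉ S → u l = 0) :
    σmin * ‖u‖ ≤ ‖restr S (DV V x u)‖ := by
  have := le_norm_apply_of_le_singularValues (Matrix.toEuclideanLin (subJac V S x)) hσ.le
    (fun k hk => (h1 x hx S hS k (by simpa using hk)).1.le) (restr S u)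
  have h2 : Matrix.toEuclideanLin (subJac V S x) (restr S u) = restr S (DV V x u) := by
    ext s
    exact subJac_mulVec hu s
  rwa [norm_restr_of_support hu, h2] at this

lemma eq_zero_of_restr_eq_zero (hσ : 0 < σmin) (h1 : Assumption1 σmin σmax V) (hx : x ∈ cube n)
    (hS : ∀ l ∈ S, V x l = 0) {u : Vec n} (hu : ∀ l, l ∉ S → u l = 0)
    (h0 : ∀ s ∈ S, DV V x u s = 0) : u = 0 := by
  have h := mul_norm_le_norm_restr hσ h1 hx hS hu
  have : restr S (DV V x u) = 0 := by ext s; exact h0 s s.2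
  rw [this, norm_zero] at h
  exact norm_le_zero_iff.1 (nonpos_of_mul_nonpos_right h hσ)

lemma det_subJac_ne_zero (hσ : 0 < σmin) (h1 : Assumption1 σmin σmax V) (hx : x ∈ cube n)
    (hS : ∀ l ∈ S, V x l = 0) : (subJac V S x).det ≠ 0 := by
  classical
  intro h
  obtain ⟨v, hv, hv0⟩ := Matrix.exists_mulVec_eq_zero_iff.2 h
  let u : Vec n := WithLp.toLp 2 fun k => if h : k ∈ S then v ⟨k, h⟩ else 0
  have hu : ∀ l, l ∉ S → u l = 0 := fun l hl => by simp [u, hl]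
  have huv : (fun t : S => u t) = v := by ext t; simp [u]
  have h0 : u = 0 := eq_zero_of_restr_eq_zero hσ h1 hx hS hu fun s hs => by
    rw [← subJac_mulVec hu ⟨s, hs⟩, huv, hv0]; rfl
  apply hv
  rw [← huv, h0]; rfl

end Derivative

/-! ### The direction -/

section Direction

variable {n : ℕ} (V : Vec n → Vec n) (i : Fin n) (S : Finset (Fin n)) (x : Vec n)

/-- The vector of cofactors of the last column of the bordered matrix. -/
noncomputable def cofVec : Vec n :=
  WithLp.toLp 2 fun k => if k ∈ insert i S then
    (dirMatrix V i S x (EuclideanSpace.single k 1)).det else 0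

/-- The orientation of `(S, x)`. -/
noncomputable def orient : SignType :=
  SignType.sign ((-1 : ℝ) ^ S.card * (subJac V S x).det)

variable {V i S x}

lemma cofVec_support {l : Fin n} (hl : l ∉ insert i S) : cofVec V i S x l = 0 := by
  simp only [cofVec, if_neg hl]

lemma dirMatrix_eq_updateCol (d : Vec n) :
    dirMatrix V i S x d = (dirMatrix V i S x 0).updateCol (Sum.inr ())
      (fun r => d (Sum.elim (fun s : S => (s : Fin n)) (fun _ => i) r)) := by
  ext r c
  rcases c with c | c <;> simp [dirMatrix]

/-- A determinant is linear in its last column. The sign condition on `d` therefore selects a side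
of the hyperplane orthogonal to the cofactor vector. -/
lemma det_dirMatrix (d : Vec n) :
    (dirMatrix V i S x d).det = inner ℝ (cofVec V i S x) d := by
  let φ : Vec n →ₗ[ℝ] ℝ := (LinearMap.proj (Sum.inr ())) ∘ₗ
    (Matrix.cramer (dirMatrix V i S x 0)) ∘ₗ
    { toFun := fun d r => d (Sum.elim (fun s : S => (s : Fin n)) (fun _ => i) r)
      map_add' := fun _ _ => rfl
      map_smul' := fun _ _ => rfl }
  have hφ : ∀ d, (dirMatrix V i S x d).det = φ d := fun d => by
    rw [dirMatrix_eq_updateCol]; rfl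
  have h1 : φ d = ∑ k, d k * φ (EuclideanSpace.single k 1) := by
    conv_lhs => rw [sum_single d]
    simp [map_sum]
  rw [hφ, h1, PiLp.inner_apply]
  refine Finset.sum_congr rfl fun k _ => ?_
  by_cases hk : k ∈ insert i S
  · simp only [cofVec, if_pos hk, ← hφ]
    simp
  · have : φ (EuclideanSpace.single k 1) = 0 := by
      rw [← hφ]
      refine Matrix.det_eq_zero_of_column_eq_zero (Sum.inr ()) fun r => ?_
      rcases r with r | r
      · have : (r : Fin n) ≠ k := fun h => hk (h ▸ Finset.mem_insert_of_mem r.2)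
        simp [dirMatrix, this]
      · have : i ≠ k := fun h => hk (h ▸ Finset.mem_insert_self _ _)
        simp [dirMatrix, this]
    rw [this, cofVec_support hk]
    simp

lemma DV_cofVec (j : Fin n) : DV V x (cofVec V i S x) j =
    (dirMatrix V i S x (WithLp.toLp 2 (jac V x j))).det := by
  rw [det_dirMatrix, ← sum_jac_mul, PiLp.inner_apply]
  rfl

/-- Pairing the cofactors with `∇V_j`, `j ∈ S`, produces a matrix with two equal columns. -/
lemma DV_cofVec_eq_zero {j : Fin n} (hj : j ∈ S) : DV V x (cofVec V i S x) j = 0 := by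
  rw [DV_cofVec]
  refine Matrix.det_zero_of_column_eq (i := Sum.inl ⟨j, hj⟩) (j := Sum.inr ()) (by simp) ?_
  intro k
  rcases k with k | k <;> simp [dirMatrix]

lemma cofVec_apply_self (hi : i ∉ S) : cofVec V i S x i = (subJac V S x).det := by
  have : dirMatrix V i S x (EuclideanSpace.single i 1) =
      Matrix.fromBlocks (subJac V S x).transpose 0 (Matrix.of fun _ c => jac V x c i) 1 := by
    ext r c
    rcases r with r | r <;> rcases c with c | c
    · simp [dirMatrix, subJac]
    · have : (r : Fin n) ≠ i := fun h => hi (h ▸ r.2)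
      simp [dirMatrix, this]
    · simp [dirMatrix]
    · simp [dirMatrix]
  simp only [cofVec, Finset.mem_insert_self, if_true, this]
  rw [Matrix.det_fromBlocks_zero₁₂, Matrix.det_transpose, Matrix.det_one, mul_one]

/-- With last column `∇V_i` the bordered matrix is the transposed Jacobian block of `S ∪ {i}`, up to
reindexing. -/
lemma DV_cofVec_self (hi : i ∉ S) :
    DV V x (cofVec V i S x) i = (subJac V (insert i S) x).det := by
  rw [DV_cofVec]
  let e : (insert i S : Finset (Fin n)) ≃ S ⊕ Unit :=
    (Finset.subtypeInsertEquivOption hi).trans (Equiv.optionEquivSumPUnit _)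
  rw [← Matrix.det_transpose (subJac V (insert i S) x), ← Matrix.det_submatrix_equiv_self e]
  congr 1
  have he : ∀ r, Sum.elim (fun s : S => (s : Fin n)) (fun _ => i) (e r) = r := by
    rintro ⟨r, hr⟩
    by_cases h : r = i
    · simp [e, Finset.subtypeInsertEquivOption, h]
    · simp [e, Finset.subtypeInsertEquivOption, h]
  have he' : ∀ (r : Fin n) c, Sum.elim (fun s : S => jac V x s r)
      (fun _ => (WithLp.toLp 2 (jac V x i) : Vec n) r) (e c) = jac V x c r := by
    rintro r ⟨c, hc⟩
    by_cases h : c = i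
    · simp [e, Finset.subtypeInsertEquivOption, h]
    · simp [e, Finset.subtypeInsertEquivOption, h]
  ext r c
  simp only [Matrix.submatrix_apply, dirMatrix, Matrix.of_apply, he, Matrix.transpose_apply,
    subJac]
  exact he' r c

end Direction

/-- The hypotheses on the field. -/
structure Regular {n : ℕ} (σmin σmax L Λ : ℝ) (V : Vec n → Vec n) : Prop where
  pos : 0 < σmin
  lip : LipschitzField Λ V
  smooth : SmoothField L V
  sing : Assumption1 σmin σmax V
  corner : Assumption2 V
  transversal : Assumption3 V

section Direction

variable {n : ℕ} {σmin σmax L Λ : ℝ} {V : Vec n → Vec n} {i : Fin n} {S : Finset (Fin n)}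
  {x d : Vec n}

lemma Regular.hasFDerivWithinAt (hV : Regular σmin σmax L Λ V) (hx : x ∈ cube n) :
    HasFDerivWithinAt V (DV V x) (cube n) x :=
  (hV.smooth.1 x hx).hasFDerivWithinAt

lemma Regular.continuousOn (hV : Regular σmin σmax L Λ V) : ContinuousOn V (cube n) :=
  hV.smooth.1.continuousOn

lemma Admissible.DV_eq_zero (hd : Admissible V i S x d) {j : Fin n} (hj : j ∈ S) :
    DV V x d j = 0 := by
  rw [← sum_jac_mul]
  exact hd.2.2.1 j hj

variable (V i S x) in
/-- The unit vector in the direction of the epoch `(i, S)` at `x`. -/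
noncomputable def dir : Vec n := ((-1 : ℝ) ^ S.card / ‖cofVec V i S x‖) • cofVec V i S x

lemma Regular.cofVec_apply_ne_zero (hV : Regular σmin σmax L Λ V) (hi : i ∉ S) (hx : x ∈ cube n)
    (hS : ∀ l ∈ S, V x l = 0) : cofVec V i S x i ≠ 0 := by
  rw [cofVec_apply_self hi]
  exact det_subJac_ne_zero hV.pos hV.sing hx hS

lemma Regular.norm_cofVec_pos (hV : Regular σmin σmax L Λ V) (hi : i ∉ S) (hx : x ∈ cube n)
    (hS : ∀ l ∈ S, V x l = 0) : 0 < ‖cofVec V i S x‖ := by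
  rw [norm_pos_iff]
  intro h
  apply hV.cofVec_apply_ne_zero hi hx hS
  rw [h]; rfl

/-- The kernel is a line: once coordinate `i` has been cancelled, the difference is supported in `S`
and killed by an invertible block. -/
lemma Regular.eq_smul_of_kernel (hV : Regular σmin σmax L Λ V) (hx : x ∈ cube n)
    (hS : ∀ l ∈ S, V x l = 0) {c e : Vec n} (hc : ∀ l, l ∉ insert i S → c l = 0)
    (he : ∀ l, l ∉ insert i S → e l = 0) (hc0 : ∀ s ∈ S, DV V x c s = 0)
    (he0 : ∀ s ∈ S, DV V x e s = 0) (hci : c i ≠ 0) : e = (e i / c i) • c := by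
  rw [← sub_eq_zero]
  refine eq_zero_of_restr_eq_zero hV.pos hV.sing hx hS (fun l hl => ?_) fun s hs => ?_
  · by_cases hli : l = i
    · subst hli
      simp [hci]
    · have : l ∉ insert i S := by simp [hli, hl]
      simp [hc l this, he l this]
  · simp [hc0 s hs, he0 s hs]

/-- Admissible vectors are unit multiples of the cofactor vector, so only two opposite ones compete.
The determinant of a multiple `t` is `t` times a positive square, and its prescribed sign decides.
-/
lemma Regular.isDirection_dir (hV : Regular σmin σmax L Λ V) (hi : i ∉ S) (hx : x ∈ cube n)
    (hS : ∀ l ∈ S, V x l = 0) : IsDirection V i S x (dir V i S x) := by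
  have hc := hV.norm_cofVec_pos hi hx hS
  refine ⟨⟨?_, fun j hj => ?_, fun j hj => ?_, ?_⟩, fun e he => ?_⟩
  · rw [dir, norm_smul, norm_div, norm_pow]
    simp [hc.ne']
  · simp [dir, cofVec_support hj]
  · rw [sum_jac_mul]
    simp [dir, DV_cofVec_eq_zero hj]
  · rw [det_dirMatrix, dir, inner_smul_right, real_inner_self_eq_norm_sq, div_mul_eq_mul_div,
      mul_div_assoc, sign_mul, sign_pos (a := ‖cofVec V i S x‖ ^ 2 / ‖cofVec V i S x‖)
      (by rw [sq, mul_self_div_self]; exact hc), mul_one]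
  · have h1 := hV.eq_smul_of_kernel hx hS (fun l hl => cofVec_support hl) he.2.1
      (fun s hs => DV_cofVec_eq_zero hs) (fun s hs => he.DV_eq_zero hs)
      (hV.cofVec_apply_ne_zero hi hx hS)
    set t := e i / cofVec V i S x i
    have h2 : |t| * ‖cofVec V i S x‖ = 1 := by
      rw [← Real.norm_eq_abs, ← norm_smul, ← h1]; exact he.1
    have h3 := he.2.2.2
    rw [det_dirMatrix, h1, inner_smul_right, real_inner_self_eq_norm_sq, sign_mul,
      sign_pos (by positivity : 0 < ‖cofVec V i S x‖ ^ 2), mul_one] at h3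
    rw [h1, dir]
    congr 1
    rw [eq_div_iff hc.ne']
    rcases neg_one_pow_eq_or ℝ S.card with h | h
    · rw [h] at h3 ⊢
      rw [sign_pos one_pos, sign_eq_one_iff] at h3
      rwa [abs_of_pos h3] at h2
    · rw [h] at h3 ⊢
      rw [sign_neg (by norm_num : (-1 : ℝ) < 0), sign_eq_neg_one_iff] at h3
      rw [abs_of_neg h3] at h2
      linarith

lemma Regular.eq_dir (hV : Regular σmin σmax L Λ V) (hi : i ∉ S) (hx : x ∈ cube n)
    (hS : ∀ l ∈ S, V x l = 0) (hd : IsDirection V i S x d) : d = dir V i S x :=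
  ((hV.isDirection_dir hi hx hS).2 d hd.1)

/-- The right-hand side does not involve `i`; this is how information passes from one coordinate
under examination to the next. -/
lemma Regular.sign_dir_apply_self (hV : Regular σmin σmax L Λ V) (hi : i ∉ S) (hx : x ∈ cube n)
    (hS : ∀ l ∈ S, V x l = 0) : SignType.sign (dir V i S x i) = orient V S x := by
  have hc := hV.norm_cofVec_pos hi hx hS
  simp only [dir, PiLp.smul_apply, smul_eq_mul, cofVec_apply_self hi, orient]
  rw [div_mul_eq_mul_div, div_eq_mul_inv, sign_mul, sign_pos (inv_pos.2 hc), mul_one]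

/-- The minus sign appears because `S ∪ {i}` has one element more than `S`. -/
lemma Regular.sign_DV_dir_self (hV : Regular σmin σmax L Λ V) (hi : i ∉ S) (hx : x ∈ cube n)
    (hS : ∀ l ∈ S, V x l = 0) :
    SignType.sign (DV V x (dir V i S x) i) = -orient V (insert i S) x := by
  have hc := hV.norm_cofVec_pos hi hx hS
  simp only [dir, map_smul, PiLp.smul_apply, smul_eq_mul, DV_cofVec_self hi, orient,
    Finset.card_insert_of_notMem hi, pow_succ]
  rw [div_mul_eq_mul_div, div_eq_mul_inv, sign_mul, sign_pos (inv_pos.2 hc), mul_one,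
    ← Left.sign_neg]
  congr 1
  ring

lemma Regular.orient_ne_zero (hV : Regular σmin σmax L Λ V) (hx : x ∈ cube n)
    (hS : ∀ l ∈ S, V x l = 0) : orient V S x ≠ 0 := by
  rw [orient, Ne, sign_eq_zero_iff]
  exact mul_ne_zero (by simp) (det_subJac_ne_zero hV.pos hV.sing hx hS)

/-- The direction with `j` in `S` and the derivative of `V_j` in the direction without it. -/
lemma Regular.sign_DV_dir (hV : Regular σmin σmax L Λ V) {j : Fin n} (hi : i ∉ S) (hj : j ∉ S)
    (hij : j ≠ i) (hx : x ∈ cube n) (hS : ∀ l ∈ insert j S, V x l = 0) :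
    SignType.sign (DV V x (dir V i S x) j) = SignType.sign (dir V i (insert j S) x j) := by
  have hS' : ∀ l ∈ S, V x l = 0 := fun l hl => hS l (Finset.mem_insert_of_mem hl)
  have hi' : i ∉ insert j S := by simp [hij.symm, hi]
  have hd := (hV.isDirection_dir hi hx hS').1
  have hd' := (hV.isDirection_dir hi' hx hS).1
  have he := (hV.isDirection_dir hj hx hS').1
  have sd := hV.sign_dir_apply_self hi hx hS'
  have sd' := hV.sign_dir_apply_self hi' hx hS
  have se := hV.sign_dir_apply_self hj hx hS'
  have sv := hV.sign_DV_dir_self hj hx hS'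
  have o := hV.orient_ne_zero hx hS'
  have o' := hV.orient_ne_zero hx hS
  set d := dir V i S x
  set d' := dir V i (insert j S) x
  set e := dir V j S x
  have hdi : d i ≠ 0 := fun h => by rw [h, sign_zero] at sd; exact o sd.symm
  have hej : e j ≠ 0 := fun h => by rw [h, sign_zero] at se; exact o se.symm
  have hei : e i = 0 := he.2.1 i (by simp [hij.symm, hi])
  -- Removing the `j`-th coordinate of `d'` by means of `e` leaves a kernel vector supported in `S ∪
  -- {i}`, hence a multiple of `d`. Applying `∇V_j` then relates `d' j` to the derivative of `V_j`
  -- along `d`.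
  have key := hV.eq_smul_of_kernel (i := i) (c := d) (e := d' - (d' j / e j) • e) hx hS'
    (fun l hl => hd.2.1 l hl)
    (fun l hl => by
      by_cases hlj : l = j
      · subst hlj; simp [hej]
      · have h1 : l ∉ insert i (insert j S) := by
          simp only [Finset.mem_insert, not_or] at hl ⊢; exact ⟨hl.1, hlj, hl.2⟩
        have h2 : l ∉ insert j S := fun h => h1 (Finset.mem_insert_of_mem h)
        simp [hd'.2.1 l h1, he.2.1 l h2])
    (fun s hs => hd.DV_eq_zero hs)
    (fun s hs => by
      simp [hd'.DV_eq_zero (Finset.mem_insert_of_mem hs), he.DV_eq_zero hs]) hdi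
  have k1 := congrArg (fun v => DV V x v j) key
  have k2 : DV V x d' j = 0 := hd'.DV_eq_zero (Finset.mem_insert_self _ _)
  simp only [map_sub, map_smul, PiLp.sub_apply, PiLp.smul_apply, smul_eq_mul, hei, k2] at k1
  -- Without denominators the identity can be read in signs: `d i` and `e j` carry the orientation
  -- of `S`, `d' i` that of `S ∪ {j}`, and the derivative of `V_j` along `e` the opposite of the
  -- latter.
  have k3 : d i * e j * d' j * DV V x e j = - (d' i * (e j * e j) * DV V x d j) := by
    field_simp at k1
    linear_combination (-(e j)) * k1
  have k4 := congrArg SignType.sign k3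
  rw [Left.sign_neg] at k4
  simp only [sign_mul, sd, sd', se, sv] at k4
  revert k4
  generalize SignType.sign (d' j) = a
  generalize SignType.sign (DV V x d j) = b
  revert o o'
  generalize orient V S x = p
  generalize orient V (insert j S) x = q
  revert a b p q
  decide

/-! ### Uniform bounds -/

lemma convex_cube : Convex ℝ (cube n) := by
  intro x hx y hy a b ha hb hab j
  have h := convex_Icc (0 : ℝ) 1 (hx j) (hy j) ha hb hab
  simpa using h

lemma isCompact_cube : IsCompact (cube n) := by
  have : cube n = (EuclideanSpace.equiv (Fin n) ℝ) ⁻¹' (Set.univ.pi fun _ => Icc (0 : ℝ) 1) := by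
    ext x; simp only [mem_preimage, mem_univ_pi]; rfl
  rw [this]
  exact (EuclideanSpace.equiv (Fin n) ℝ).toHomeomorph.isCompact_preimage.2
    (isCompact_univ_pi fun _ => isCompact_Icc)

lemma norm_le_of_hasDerivWithinAt {E : Type*} [NormedAddCommGroup E] [NormedSpace ℝ E]
    {f : ℝ → E} {f' : E} {δ C : ℝ} (hδ : 0 < δ) (hf : HasDerivWithinAt f f' (Ioc 0 δ) 0)
    (hC : ∀ t ∈ Ioc (0 : ℝ) δ, ‖f t - f 0‖ ≤ C * t) : ‖f'‖ ≤ C := by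
  have h := (hasDerivWithinAt_iff_tendsto_slope' (by simp)).1 hf
  have : (𝓝[Ioc (0 : ℝ) δ] 0).NeBot := by
    rw [nhdsWithin_Ioc_eq_nhdsGT hδ]; infer_instance
  refine le_of_tendsto h.norm ?_
  filter_upwards [self_mem_nhdsWithin] with t ht
  rw [slope_def_module, norm_smul, sub_zero, norm_inv, Real.norm_of_nonneg ht.1.le,
    inv_mul_le_iff₀ ht.1, mul_comm]
  exact hC t ht

/-- The Lipschitz bound controls difference quotients inside the cube only. Along a coordinate axis
there is room of length `1 / 2` on at least one side. -/
lemma Regular.norm_DV_single_le (hV : Regular σmin σmax L Λ V) (hx : x ∈ cube n) (i : Fin n) :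
    ‖DV V x (EuclideanSpace.single i 1)‖ ≤ |Λ| := by
  have aux : ∀ s : ℝ, |s| = 1 →
      (∀ t ∈ Ioc (0 : ℝ) (1 / 2), x + (t * s) • EuclideanSpace.single i 1 ∈ cube n) →
      ‖DV V x (EuclideanSpace.single i 1)‖ ≤ |Λ| := by
    intro s hs hmem
    have h1 : HasDerivWithinAt (fun t : ℝ => x + (t * s) • EuclideanSpace.single i (1 : ℝ))
        (s • EuclideanSpace.single i (1 : ℝ)) (Ioc 0 (1 / 2)) 0 := by
      have : HasDerivAt (fun t : ℝ => x + (t * s) • EuclideanSpace.single i (1 : ℝ))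
        ((1 * s) • EuclideanSpace.single i (1 : ℝ)) 0 :=
        (((hasDerivAt_id (0 : ℝ)).mul_const s).smul_const _).const_add x
      rw [one_mul] at this
      exact this.hasDerivWithinAt
    have h2 : HasFDerivWithinAt V (DV V x) (cube n)
        (x + ((0 : ℝ) * s) • EuclideanSpace.single i (1 : ℝ)) := by
      simpa using hV.hasFDerivWithinAt hx
    have h3 := h2.comp_hasDerivWithinAt (0 : ℝ) h1 hmem
    have h4 := norm_le_of_hasDerivWithinAt (by norm_num) h3 (C := |Λ|) (fun t ht => by
      have h5 := hV.lip _ (hmem t ht) x hx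
      simp only [Function.comp, zero_mul, zero_smul, add_zero]
      refine h5.trans ?_
      have h6 : ‖x + (t * s) • EuclideanSpace.single i (1 : ℝ) - x‖ = t := by
        rw [add_sub_cancel_left, norm_smul, norm_mul, Real.norm_eq_abs s, hs]
        simp [abs_of_pos ht.1]
      rw [h6]
      exact mul_le_mul_of_nonneg_right (le_abs_self _) ht.1.le)
    rw [map_smul, norm_smul, Real.norm_eq_abs, hs, one_mul] at h4
    exact h4
  rcases le_total (x i) (1 / 2) with h | h
  · refine aux 1 (by simp) fun t ht j => ?_
    have := hx j
    by_cases hj : j = i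
    · subst hj
      simp only [mem_Icc, mem_Ioc, PiLp.add_apply, PiLp.smul_apply, PiLp.single_apply,
        if_true, smul_eq_mul, mul_one] at *
      constructor <;> linarith
    · simpa [hj] using this
  · refine aux (-1) (by simp) fun t ht j => ?_
    have := hx j
    by_cases hj : j = i
    · subst hj
      simp only [mem_Icc, mem_Ioc, PiLp.add_apply, PiLp.smul_apply, PiLp.single_apply,
        if_true, smul_eq_mul, mul_one] at *
      constructor <;> linarith
    · simpa [hj] using this

/-- A lower bound for the speed of the coordinate under examination. -/
lemma Regular.le_abs_dir (hV : Regular σmin σmax L Λ V) (hi : i ∉ S) (hx : x ∈ cube n)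
    (hS : ∀ l ∈ S, V x l = 0) : (1 + |Λ| / σmin)⁻¹ ≤ |dir V i S x i| := by
  have hd := (hV.isDirection_dir hi hx hS).1
  set d := dir V i S x
  set u := d - d i • EuclideanSpace.single i (1 : ℝ) with hu
  have hus : ∀ l, l ∉ S → u l = 0 := fun l hl => by
    by_cases hli : l = i
    · subst hli; simp [hu]
    · simp [hu, hli, hd.2.1 l (by simp [hli, hl])]
  have h1 := mul_norm_le_norm_restr hV.pos hV.sing hx hS hus
  -- The part `u` of `d` in `S` must compensate the effect of `d i` on `V_S`, so it is bounded by a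
  -- multiple of `|d i|`; since `d` is a unit vector, `d i` cannot be small.
  have h2 : restr S (DV V x u) = -(d i) • restr S (DV V x (EuclideanSpace.single i 1)) := by
    ext s
    have : DV V x d s = 0 := hd.DV_eq_zero s.2
    simp [restr, hu, this]
  have h3 : ‖restr S (DV V x u)‖ ≤ |d i| * |Λ| := by
    rw [h2, norm_smul, norm_neg, Real.norm_eq_abs]
    exact mul_le_mul_of_nonneg_left ((norm_restr_le _ _).trans (hV.norm_DV_single_le hx i))
      (abs_nonneg _)
  have h4 : ‖u‖ ≤ |d i| * |Λ| / σmin := by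
    rw [le_div_iff₀ hV.pos]; linarith
  have h5 : (1 : ℝ) ≤ ‖u‖ + |d i| := by
    have : d = u + d i • EuclideanSpace.single i (1 : ℝ) := by rw [hu]; abel
    have h6 := norm_add_le u (d i • EuclideanSpace.single i (1 : ℝ))
    rw [← this, hd.1, norm_smul] at h6
    simpa using h6
  have h0 : 0 < 1 + |Λ| / σmin := by have := hV.pos; positivity
  rw [inv_le_iff_one_le_mul₀ h0]
  calc (1 : ℝ) ≤ |d i| * |Λ| / σmin + |d i| := by linarith
    _ = _ := by ring

lemma norm_le_frobenius {A : Matrix (Fin n) (Fin n) ℝ} {u v : Vec n}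
    (h : ∀ a, v a = ∑ b, A a b * u b) : ‖v‖ ≤ frobenius A * ‖u‖ := by
  rw [EuclideanSpace.norm_eq, EuclideanSpace.norm_eq, frobenius, ← Real.sqrt_mul (by positivity),
    Finset.sum_mul]
  refine Real.sqrt_le_sqrt (Finset.sum_le_sum fun a _ => ?_)
  rw [Real.norm_eq_abs, sq_abs, h]
  simpa using Finset.sum_mul_sq_le_sq_mul_sq Finset.univ (A a) u

lemma Regular.norm_DV_sub_le (hV : Regular σmin σmax L Λ V) {y : Vec n} (hx : x ∈ cube n)
    (hy : y ∈ cube n) : ‖DV V y - DV V x‖ ≤ |L| * ‖y - x‖ := by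
  refine ContinuousLinearMap.opNorm_le_bound _ (by positivity) fun u => ?_
  have h1 : ‖(DV V y - DV V x) u‖ ≤ frobenius (jac V y - jac V x) * ‖u‖ :=
    norm_le_frobenius fun a => by
      simp only [sub_apply, PiLp.sub_apply, Matrix.sub_apply, sub_mul,
        Finset.sum_sub_distrib, sum_jac_mul]
  refine h1.trans (mul_le_mul_of_nonneg_right ((hV.smooth.2 y hy x hx).trans ?_) (norm_nonneg _))
  exact mul_le_mul_of_nonneg_right (le_abs_self _) (norm_nonneg _)

/-- Zeros of `V_S` that agree off `S` are separated. -/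
lemma Regular.le_norm_sub_of_zeros (hV : Regular σmin σmax L Λ V) {y : Vec n} (hx : x ∈ cube n)
    (hy : y ∈ cube n) (hSx : ∀ l ∈ S, V x l = 0) (hSy : ∀ l ∈ S, V y l = 0)
    (hxy : ∀ l, l ∉ S → x l = y l) (hne : x ≠ y) : σmin / (|L| + 1) ≤ ‖y - x‖ := by
  have hseg : segment ℝ x y ⊆ cube n := convex_cube.segment_subset hx hy
  -- The Taylor remainder is at most `|L| ‖y - x‖²`. As `V_S` vanishes at both ends, the linear
  -- part, of size at least `σmin ‖y - x‖`, equals the remainder up to sign. The `+ 1` in the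
  -- statement keeps the denominator positive.
  have h1 := Convex.norm_image_sub_le_of_norm_hasFDerivWithin_le' (𝕜 := ℝ) (f := V)
    (f' := DV V) (φ := DV V x) (C := |L| * ‖y - x‖) (s := segment ℝ x y)
    (fun z hz => (hV.hasFDerivWithinAt (hseg hz)).mono hseg)
    (fun z hz => (hV.norm_DV_sub_le hx (hseg hz)).trans (mul_le_mul_of_nonneg_left (by
      obtain ⟨a, b, ha, hb, hab, rfl⟩ := hz
      have : a • x + b • y - x = b • (y - x) := by
        rw [← eq_sub_iff_add_eq] at hab; subst hab; module
      rw [this, norm_smul, Real.norm_of_nonneg hb]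
      nlinarith [norm_nonneg (y - x)]) (abs_nonneg _)))
    (convex_segment x y) (left_mem_segment ℝ x y) (right_mem_segment ℝ x y)
  have h2 := mul_norm_le_norm_restr hV.pos hV.sing hx hSx (u := y - x)
    (fun l hl => by simp [hxy l hl])
  have h3 : restr S (DV V x (y - x)) = -restr S (V y - V x - DV V x (y - x)) := by
    ext s
    simp [restr, hSx s s.2, hSy s s.2]
  rw [h3, norm_neg] at h2
  have h4 : σmin * ‖y - x‖ ≤ |L| * ‖y - x‖ * ‖y - x‖ := h2.trans ((norm_restr_le _ _).trans h1)
  have h5 : 0 < ‖y - x‖ := norm_pos_iff.2 (sub_ne_zero.2 hne.symm)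
  have h6 : σmin ≤ |L| * ‖y - x‖ := le_of_mul_le_mul_right h4 h5
  rw [div_le_iff₀ (by positivity)]
  nlinarith

/-! ### Vertices -/

variable (V i S) in
/-- The points where an epoch `(i, S)` can meet a face of the cube. -/
def vertices : Set (Vec n) :=
  {x | x ∈ cube n ∧ (∀ l ∈ S, V x l = 0) ∧ (∀ l, l ∉ insert i S → OnBoundary x l) ∧
    ∃ k ∈ insert i S, OnBoundary x k}

lemma isClosed_onBoundary (l : Fin n) : IsClosed {x : Vec n | OnBoundary x l} := by
  have h : Continuous fun x : Vec n => x l := by fun_prop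
  exact (isClosed_eq h continuous_const).union (isClosed_eq h continuous_const)

lemma Regular.isCompact_vertices (hV : Regular σmin σmax L Λ V) : IsCompact (vertices V i S) := by
  have h1 : IsClosed (cube n ∩ {x | ∀ l ∈ S, V x l = 0}) := by
    have : cube n ∩ {x | ∀ l ∈ S, V x l = 0} = cube n ∩ V ⁻¹' {v | ∀ l ∈ S, v l = 0} := rfl
    rw [this]
    refine hV.continuousOn.preimage_isClosed_of_isClosed isCompact_cube.isClosed ?_
    simp only [ofPred_forall]
    exact isClosed_biInter fun l _ => isClosed_eq (by fun_prop) continuous_const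
  have h2 : IsClosed {x : Vec n | ∀ l, l ∉ insert i S → OnBoundary x l} := by
    simp only [ofPred_forall]
    exact isClosed_iInter fun l => isClosed_iInter fun _ => isClosed_onBoundary l
  have h3 : IsClosed {x : Vec n | ∃ k ∈ insert i S, OnBoundary x k} := by
    have : {x : Vec n | ∃ k ∈ insert i S, OnBoundary x k} =
      ⋃ k ∈ insert i S, {x : Vec n | OnBoundary x k} := by ext; simp
    rw [this]
    exact isClosed_biUnion_finset fun k _ => isClosed_onBoundary k
  have : vertices V i S = cube n ∩ ((cube n ∩ {x | ∀ l ∈ S, V x l = 0}) ∩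
    ({x : Vec n | ∀ l, l ∉ insert i S → OnBoundary x l} ∩
      {x : Vec n | ∃ k ∈ insert i S, OnBoundary x k})) := by
    ext x; simp only [vertices, mem_ofPred_eq, mem_inter_iff]; tauto
  rw [this]
  exact isCompact_cube.inter_right (h1.inter (h2.inter h3))

lemma eventually_eq_of_onBoundary {l : Fin n} (hx : OnBoundary x l) :
    ∀ᶠ y in 𝓝 x, OnBoundary y l → y l = x l := by
  have hc : Tendsto (fun y : Vec n => y l) (𝓝 x) (𝓝 (x l)) :=
    (by fun_prop : Continuous fun y : Vec n => y l).tendsto x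
  have := hc.eventually (Metric.ball_mem_nhds (x l) one_pos)
  filter_upwards [this] with y hy hyl
  rw [Real.dist_eq, abs_lt] at hy
  rcases hx with h | h <;> rcases hyl with h' | h' <;> rw [h, h'] at hy ⊢ <;> norm_num at hy

lemma eventually_not_onBoundary {l : Fin n} (hx : ¬ OnBoundary x l) :
    ∀ᶠ y in 𝓝 x, ¬ OnBoundary y l :=
  (isClosed_onBoundary l).isOpen_compl.mem_nhds hx

/-- By compactness it suffices that vertices are isolated. Let `k` be the boundary coordinate in `S
∪ {i}`. The map recording `V_S`, the coordinates off `S ∪ {i}` and coordinate `k` has injective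
derivative by Assumption 3, so it separates `x` from nearby points; yet nearby vertices have the
same image. -/
lemma Regular.finite_vertices (hV : Regular σmin σmax L Λ V) (hi : i ∉ S) :
    (vertices V i S).Finite := by
  by_contra hinf
  obtain ⟨x, hx, hacc⟩ := Set.Infinite.exists_accPt_of_subset_isCompact hinf
    hV.isCompact_vertices subset_rfl
  obtain ⟨hxc, hxS, hxb, k, hk, hkb⟩ := hx
  rw [accPt_iff_frequently] at hacc
  let G : Vec n →L[ℝ] (Fin n → ℝ) × (Fin n → ℝ) :=
    ContinuousLinearMap.prod
      (ContinuousLinearMap.pi fun l => if l ∈ S then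
        (EuclideanSpace.proj l : Vec n →L[ℝ] ℝ).comp (DV V x) else 0)
      (ContinuousLinearMap.pi fun l => if l ∉ insert i S ∨ l = k then
        (EuclideanSpace.proj l : Vec n →L[ℝ] ℝ) else 0)
  let g : Vec n → (Fin n → ℝ) × (Fin n → ℝ) := fun y =>
    (fun l => if l ∈ S then V y l else 0, fun l => if l ∉ insert i S ∨ l = k then y l else 0)
  have hg : HasFDerivWithinAt g G (cube n) x := by
    refine HasFDerivWithinAt.prodMk (hasFDerivWithinAt_pi.2 fun l => ?_)
      (hasFDerivWithinAt_pi.2 fun l => ?_)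
    · by_cases h : l ∈ S
      · simp only [h, if_true]
        exact (EuclideanSpace.proj l : Vec n →L[ℝ] ℝ).hasFDerivAt.comp_hasFDerivWithinAt x
          (hV.hasFDerivWithinAt hxc)
      · simp only [h, if_false]
        exact hasFDerivWithinAt_const _ _ _
    · by_cases h : l ∉ insert i S ∨ l = k
      · simp only [h, if_true]
        exact (EuclideanSpace.proj l : Vec n →L[ℝ] ℝ).hasFDerivWithinAt
      · simp only [h, if_false]
        exact hasFDerivWithinAt_const _ _ _
  have hG : Function.Injective G := by
    rw [injective_iff_map_eq_zero]
    intro u hu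
    by_contra hne
    have h1 : ∀ l ∈ S, DV V x u l = 0 := fun l hl => by
      simpa [G, hl] using congrFun (congrArg Prod.fst hu) l
    have h2 : ∀ l, l ∉ insert i S ∨ l = k → u l = 0 := fun l hl => by
      have := congrFun (congrArg Prod.snd hu) l
      simp only [G, ContinuousLinearMap.prod_apply, ContinuousLinearMap.coe_pi', if_pos hl] at this
      simpa using this
    have h3 : ∀ l, l ∉ insert i S → u l = 0 := fun l hl => h2 l (Or.inl hl)
    exact hV.transversal S i hi x hxc hxS hxb u hne h3
      (fun j hj => by rw [sum_insert_jac_mul V x u j i S h3]; exact h1 j hj) k hk hkb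
      (h2 k (Or.inr rfl))
  have hanti : ∃ C, AntilipschitzWith C G := by
    obtain ⟨K, -, hK⟩ := LinearMap.exists_antilipschitzWith G.toLinearMap
      (LinearMap.ker_eq_bot.2 hG)
    exact ⟨K, hK⟩
  have hne := hg.eventually_ne (c := g x) hanti
  rw [eventually_nhdsWithin_iff] at hne
  have e1 : ∀ᶠ y in 𝓝 x, ∀ l, OnBoundary x l → OnBoundary y l → y l = x l := by
    rw [eventually_all]
    intro l
    by_cases h : OnBoundary x l
    · filter_upwards [eventually_eq_of_onBoundary h] with y hy _ using hy
    · exact Eventually.of_forall fun _ h' => absurd h' h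
  have e2 : ∀ᶠ y in 𝓝 x, ∀ l, ¬ OnBoundary x l → ¬ OnBoundary y l := by
    rw [eventually_all]
    intro l
    by_cases h : OnBoundary x l
    · exact Eventually.of_forall fun _ h' => absurd h h'
    · filter_upwards [eventually_not_onBoundary h] with y hy _ using hy
  obtain ⟨y, ⟨hyx, hyv⟩, hy1, hy2, hy3⟩ := (hacc.and_eventually (hne.and (e1.and e2))).exists
  obtain ⟨hyc, hyS, hyb, k', hk', hkb'⟩ := hyv
  apply hy1 ⟨hyc, hyx⟩
  -- Near `x` no new coordinate reaches the boundary, so `k'` is on the boundary at `x` too, where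
  -- Assumption 2 allows only one.
  have hkk : k' = k := hV.corner x hxc S i hi hxS hxb k' hk' k hk
    (by by_contra h; exact hy3 k' h hkb') hkb
  subst hkk
  refine Prod.ext (funext fun l => ?_) (funext fun l => ?_)
  · by_cases h : l ∈ S
    · simp [g, h, hyS l h, hxS l h]
    · simp [g, h]
  · by_cases h : l ∉ insert i S ∨ l = k'
    · simp only [g, if_pos h]
      rcases h with h | rfl
      · exact hy2 l (hxb l h) (hyb l h)
      · exact hy2 l hkb hkb'
    · simp only [g, if_neg h]

end Direction

/-! ### Lipschitz functions on compact sets -/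

section Lipschitz

variable {X : Type*} [PseudoMetricSpace X] {s : Set X}

lemma exists_lipschitzOnWith_mul (hs : IsCompact s) {f g : X → ℝ}
    (hf : ∃ K, LipschitzOnWith K f s) (hg : ∃ K, LipschitzOnWith K g s) :
    ∃ K, LipschitzOnWith K (fun x => f x * g x) s := by
  obtain ⟨Kf, hf⟩ := hf
  obtain ⟨Kg, hg⟩ := hg
  obtain ⟨Mf, hMf⟩ := hs.exists_bound_of_continuousOn hf.continuousOn
  obtain ⟨Mg, hMg⟩ := hs.exists_bound_of_continuousOn hg.continuousOn
  refine ⟨_, LipschitzOnWith.of_dist_le' (K := Mf * Kg + Mg * Kf) fun x hx y hy => ?_⟩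
  have h1 := hf.dist_le_mul x hx y hy
  have h2 := hg.dist_le_mul x hx y hy
  have h3 := hMf x hx
  have h4 := hMg y hy
  rw [Real.dist_eq] at h1 h2 ⊢
  rw [Real.norm_eq_abs] at h3 h4
  calc |f x * g x - f y * g y| = |f x * (g x - g y) + g y * (f x - f y)| := by congr 1; ring
    _ ≤ |f x| * |g x - g y| + |g y| * |f x - f y| := by
        rw [← abs_mul, ← abs_mul]; exact abs_add_le _ _
    _ ≤ Mf * (Kg * dist x y) + Mg * (Kf * dist x y) :=
        add_le_add (mul_le_mul h3 h2 (abs_nonneg _) ((abs_nonneg _).trans h3))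
          (mul_le_mul h4 h1 (abs_nonneg _) ((abs_nonneg _).trans h4))
    _ = _ := by ring

lemma exists_lipschitzOnWith_sum {ι : Type*} (t : Finset ι) {f : ι → X → ℝ}
    (hf : ∀ k ∈ t, ∃ K, LipschitzOnWith K (f k) s) :
    ∃ K, LipschitzOnWith K (fun x => ∑ k ∈ t, f k x) s := by
  classical
  induction t using Finset.induction_on with
  | empty => exact ⟨0, by simp⟩
  | insert a t ha ih =>
    obtain ⟨K1, h1⟩ := hf a (Finset.mem_insert_self _ _)
    obtain ⟨K2, h2⟩ := ih fun k hk => hf k (Finset.mem_insert_of_mem hk)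
    simp only [Finset.sum_insert ha]
    exact ⟨_, h1.add h2⟩

lemma exists_lipschitzOnWith_prod (hs : IsCompact s) {ι : Type*} (t : Finset ι) {f : ι → X → ℝ}
    (hf : ∀ k ∈ t, ∃ K, LipschitzOnWith K (f k) s) :
    ∃ K, LipschitzOnWith K (fun x => ∏ k ∈ t, f k x) s := by
  classical
  induction t using Finset.induction_on with
  | empty => exact ⟨0, by simp⟩
  | insert a t ha ih =>
    simp only [Finset.prod_insert ha]
    exact exists_lipschitzOnWith_mul hs (hf a (Finset.mem_insert_self _ _))
      (ih fun k hk => hf k (Finset.mem_insert_of_mem hk))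

lemma exists_lipschitzOnWith_det (hs : IsCompact s) {ι : Type*} [Fintype ι] [DecidableEq ι]
    {M : X → Matrix ι ι ℝ} (hM : ∀ a b, ∃ K, LipschitzOnWith K (fun x => M x a b) s) :
    ∃ K, LipschitzOnWith K (fun x => (M x).det) s := by
  simp only [Matrix.det_apply']
  refine exists_lipschitzOnWith_sum _ fun σ _ => exists_lipschitzOnWith_mul hs
    ⟨0, (LipschitzWith.const _).lipschitzOnWith⟩ (exists_lipschitzOnWith_prod hs _ fun k _ => ?_)
  exact hM _ _

/-- The retraction to the unit ball. -/
noncomputable def truncate {E : Type*} [NormedAddCommGroup E] [NormedSpace ℝ E] (a : E) : E :=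
  (max 1 ‖a‖)⁻¹ • a

lemma norm_truncate_le {E : Type*} [NormedAddCommGroup E] [NormedSpace ℝ E] (a : E) :
    ‖truncate a‖ ≤ 1 := by
  have h : 0 < max 1 ‖a‖ := lt_max_of_lt_left one_pos
  rw [truncate, norm_smul, norm_inv, Real.norm_of_nonneg h.le, inv_mul_le_iff₀ h, mul_one]
  exact le_max_right _ _

lemma lipschitzWith_truncate {E : Type*} [NormedAddCommGroup E] [NormedSpace ℝ E] :
    LipschitzWith 2 (truncate : E → E) := by
  refine LipschitzWith.of_dist_le_mul fun a b => ?_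
  rw [dist_eq_norm, dist_eq_norm]
  set p := max 1 ‖a‖ with hp
  set q := max 1 ‖b‖ with hq
  have hp1 : 1 ≤ p := le_max_left _ _
  have hq1 : 1 ≤ q := le_max_left _ _
  have hp0 : 0 < p := by linarith
  have hq0 : 0 < q := by linarith
  have h1 : |p - q| ≤ ‖a - b‖ := (abs_max_sub_max_le_abs _ _ _).trans' (by
    rw [hp, hq, max_comm 1, max_comm 1]) |>.trans (abs_norm_sub_norm_le a b)
  -- The displacement and the change of the scaling factor contribute at most `‖a - b‖` each.
  have h2 : truncate a - truncate b = p⁻¹ • (a - b) + (p⁻¹ - q⁻¹) • b := by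
    simp only [truncate, ← hp, ← hq]; module
  have h3 : ‖p⁻¹ • (a - b)‖ ≤ ‖a - b‖ := by
    rw [norm_smul, norm_inv, Real.norm_of_nonneg hp0.le]
    exact mul_le_of_le_one_left (norm_nonneg _) (inv_le_one_of_one_le₀ hp1)
  have h4 : ‖(p⁻¹ - q⁻¹) • b‖ ≤ ‖a - b‖ := by
    rw [norm_smul, Real.norm_eq_abs, inv_sub_inv hp0.ne' hq0.ne', abs_div, abs_mul,
      abs_of_pos hp0, abs_of_pos hq0, abs_sub_comm]
    have hb : ‖b‖ ≤ q := le_max_right _ _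
    rw [div_mul_eq_mul_div, div_le_iff₀ (by positivity)]
    have : ‖b‖ ≤ p * q := hb.trans (le_mul_of_one_le_left hq0.le hp1)
    exact mul_le_mul h1 this (norm_nonneg _) (norm_nonneg _)
  rw [h2]
  refine (norm_add_le _ _).trans ?_
  push_cast
  linarith

end Lipschitz

/-! ### Ordinary differential equations with a bounded Lipschitz field -/

section ODE

variable {E : Type*} [NormedAddCommGroup E] [NormedSpace ℝ E] {F : E → E} {K : NNReal}

lemma exists_solution [CompleteSpace E] (hF : LipschitzWith K F) (hb : ∀ x, ‖F x‖ ≤ 1) (x : E)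
    {T : ℝ} (hT : 0 ≤ T) :
    ∃ z : ℝ → E, z 0 = x ∧ ∀ t ∈ Icc 0 T, HasDerivWithinAt z (F (z t)) (Icc 0 T) t := by
  -- A field bounded by `1` cannot leave the ball of radius `T` before time `T`, so any time horizon
  -- is allowed.
  have hp : IsPicardLindelof (fun _ => F) (tmin := 0) (tmax := T) ⟨0, le_rfl, hT⟩ x
      ⟨T, hT⟩ 0 1 K := by
    refine IsPicardLindelof.of_time_independent (fun y _ => by simpa using hb y)
      hF.lipschitzOnWith ?_
    simp only [NNReal.coe_one, sub_zero, sub_self, NNReal.coe_zero, one_mul]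
    exact (max_eq_left hT).le
  exact hp.exists_eq_forall_mem_Icc_hasDerivWithinAt₀

lemma solution_unique (hF : LipschitzWith K F) {y z : ℝ → E} {T : ℝ}
    (hy : ∀ t ∈ Icc 0 T, HasDerivWithinAt y (F (y t)) (Icc 0 T) t)
    (hz : ∀ t ∈ Icc 0 T, HasDerivWithinAt z (F (z t)) (Icc 0 T) t) (h0 : y 0 = z 0) :
    EqOn y z (Icc 0 T) := by
  have aux : ∀ w : ℝ → E, (∀ t ∈ Icc 0 T, HasDerivWithinAt w (F (w t)) (Icc 0 T) t) →
      ∀ t ∈ Ico 0 T, HasDerivWithinAt w (F (w t)) (Ici t) t := fun w hw t ht =>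
    (hw t ⟨ht.1, ht.2.le⟩).mono_of_mem_nhdsWithin
      (mem_of_superset (Icc_mem_nhdsGE ht.2) (Icc_subset_Icc_left ht.1))
  exact ODE_solution_unique_of_mem_Icc_right (v := fun _ => F) (s := fun _ => univ)
    (fun _ _ => hF.lipschitzOnWith) (fun t ht => (hy t ht).continuousWithinAt) (aux y hy)
    (fun _ _ => mem_univ _) (fun t ht => (hz t ht).continuousWithinAt) (aux z hz)
    (fun _ _ => mem_univ _) h0

lemma solution_mono {z : ℝ → E} {T τ : ℝ} (hτ : τ ≤ T)
    (hz : ∀ t ∈ Icc 0 T, HasDerivWithinAt z (F (z t)) (Icc 0 T) t) :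
    ∀ t ∈ Icc 0 τ, HasDerivWithinAt z (F (z t)) (Icc 0 τ) t := fun t ht =>
  (hz t ⟨ht.1, ht.2.trans hτ⟩).mono (Icc_subset_Icc_right hτ)

/-- Two solutions that meet agree before. -/
lemma solution_unique_backward (hF : LipschitzWith K F) {y z : ℝ → E} {a b : ℝ} (ha : 0 ≤ a)
    (hab : a ≤ b) (hy : ∀ t ∈ Icc 0 a, HasDerivWithinAt y (F (y t)) (Icc 0 a) t)
    (hz : ∀ t ∈ Icc 0 b, HasDerivWithinAt z (F (z t)) (Icc 0 b) t) (h0 : y a = z b) :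
    y 0 = z (b - a) := by
  have aux : ∀ (w : ℝ → E) (c : ℝ), a ≤ c →
      (∀ t ∈ Icc 0 c, HasDerivWithinAt w (F (w t)) (Icc 0 c) t) →
      ∀ t ∈ Icc 0 a, HasDerivWithinAt (fun s => w (c - s)) ((-F) (w (c - t))) (Icc 0 a) t := by
    intro w c hc hw t ht
    have h1 : HasDerivWithinAt (fun s : ℝ => c - s) (-1) (Icc 0 a) t :=
      ((hasDerivAt_id t).const_sub c).hasDerivWithinAt
    have h2 := (hw (c - t) ⟨by linarith [ht.2], by linarith [ht.1]⟩).scomp t h1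
      (fun s hs => ⟨by linarith [hs.2], by linarith [hs.1]⟩)
    rw [neg_one_smul] at h2
    exact h2
  -- Run backwards from the meeting point, both curves solve the equation of `-F`.
  have := solution_unique (F := -F) (K := K) hF.neg (aux y a le_rfl hy) (aux z b hab hz)
    (by simpa using h0) (right_mem_Icc.2 ha)
  simpa using this

end ODE

/-! ### The field of an epoch -/

section Field

variable {n : ℕ} {σmin σmax L Λ : ℝ} {V : Vec n → Vec n} {i : Fin n} {S : Finset (Fin n)}

/-- The nearest point in the cube. -/
noncomputable def clamp (x : Vec n) : Vec n := WithLp.toLp 2 fun j => max 0 (min 1 (x j))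

lemma clamp_mem (x : Vec n) : clamp x ∈ cube n := fun _ =>
  ⟨le_max_left _ _, max_le zero_le_one (min_le_left _ _)⟩

lemma clamp_eq {x : Vec n} (hx : x ∈ cube n) : clamp x = x := by
  ext j
  have := hx j
  simp [clamp, this.1, this.2]

lemma lipschitzWith_clamp : LipschitzWith 1 (clamp : Vec n → Vec n) := by
  refine LipschitzWith.of_dist_le_mul fun x y => ?_
  rw [NNReal.coe_one, one_mul, EuclideanSpace.dist_eq, EuclideanSpace.dist_eq]
  refine Real.sqrt_le_sqrt (Finset.sum_le_sum fun j _ => ?_)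
  refine pow_le_pow_left₀ dist_nonneg ?_ 2
  rw [Real.dist_eq, Real.dist_eq]
  simp only [clamp, max_comm (0 : ℝ), min_comm (1 : ℝ)]
  exact (abs_max_sub_max_le_abs _ _ _).trans (by
    have := abs_inf_sub_inf_le_abs (x j) (y j) (1 : ℝ)
    exact this)

lemma Regular.exists_lipschitzOnWith_jac (hV : Regular σmin σmax L Λ V) (a b : Fin n) :
    ∃ K, LipschitzOnWith K (fun x => jac V x a b) (cube n) := by
  refine ⟨_, LipschitzOnWith.of_dist_le' (K := |L|) fun x hx y hy => ?_⟩
  rw [dist_eq_norm, dist_eq_norm]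
  have h1 := hV.norm_DV_sub_le hy hx
  have h2 : jac V x a b - jac V y a b = ((DV V x - DV V y) (EuclideanSpace.single b 1)) a := rfl
  rw [h2]
  refine (PiLp.norm_apply_le _ a).trans (((DV V x - DV V y).le_opNorm _).trans ?_)
  simpa using h1

lemma Regular.exists_lipschitzOnWith_cofVec (hV : Regular σmin σmax L Λ V) :
    ∃ K, LipschitzOnWith K (fun x => cofVec V i S x) (cube n) := by
  have h1 : ∀ k, ∃ K, LipschitzOnWith K (fun x => cofVec V i S x k) (cube n) := by
    intro k
    by_cases hk : k ∈ insert i S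
    · simp only [cofVec, if_pos hk]
      refine exists_lipschitzOnWith_det isCompact_cube fun r c => ?_
      rcases c with c | c
      · exact hV.exists_lipschitzOnWith_jac _ _
      · exact ⟨0, (LipschitzWith.const _).lipschitzOnWith⟩
    · simp only [cofVec_support hk]
      exact ⟨0, (LipschitzWith.const _).lipschitzOnWith⟩
  choose K hK using h1
  have h2 : LipschitzOnWith (Finset.univ.sup K) (fun x k => cofVec V i S x k) (cube n) :=
    LipschitzOnWith.of_dist_le_mul fun x hx y hy => by
      rw [dist_pi_le_iff (by positivity)]
      intro k
      refine ((hK k).dist_le_mul x hx y hy).trans (mul_le_mul_of_nonneg_right ?_ dist_nonneg)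
      exact_mod_cast Finset.le_sup (Finset.mem_univ k)
  have h3 := (PiLp.lipschitzWith_toLp 2 (fun _ : Fin n => ℝ)).comp_lipschitzOnWith h2
  exact ⟨_, h3⟩

/-- `F` extends the direction of the epoch `(i, S)` to the whole space. -/
structure IsField (V : Vec n → Vec n) (i : Fin n) (S : Finset (Fin n)) (F : Vec n → Vec n)
    (K : NNReal) : Prop where
  lipschitz : LipschitzWith K F
  norm_le : ∀ x, ‖F x‖ ≤ 1
  support : ∀ x l, l ∉ insert i S → F x l = 0
  kernel : ∀ x ∈ cube n, ∀ j ∈ S, DV V x (F x) j = 0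
  eq_dir : ∀ x ∈ cube n, (∀ l ∈ S, V x l = 0) → F x = dir V i S x

/-- The cofactor vector is evaluated at the nearest point of the cube, scaled by the inverse of a
lower bound `c` for its norm on the zeros of `V_S`, and truncated to the unit ball. On those zeros
its norm is at least `1` before truncation, so truncation normalizes it. -/
lemma Regular.exists_isField (hV : Regular σmin σmax L Λ V) (hi : i ∉ S) :
    ∃ F K, IsField V i S F K := by
  obtain ⟨K, hK⟩ := hV.exists_lipschitzOnWith_cofVec (i := i) (S := S)
  have hc : IsCompact (cube n ∩ {x | ∀ l ∈ S, V x l = 0}) := by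
    have : cube n ∩ {x | ∀ l ∈ S, V x l = 0} =
      cube n ∩ (cube n ∩ V ⁻¹' {v | ∀ l ∈ S, v l = 0}) := by
      rw [← inter_assoc, inter_self]; rfl
    rw [this]
    refine isCompact_cube.inter_right
      (hV.continuousOn.preimage_isClosed_of_isClosed isCompact_cube.isClosed ?_)
    simp only [ofPred_forall]
    exact isClosed_biInter fun l _ => isClosed_eq (by fun_prop) continuous_const
  obtain ⟨c, hc0, hcle⟩ : ∃ c : ℝ, 0 < c ∧ ∀ x ∈ cube n, (∀ l ∈ S, V x l = 0) →
      c ≤ ‖cofVec V i S x‖ := by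
    rcases (cube n ∩ {x | ∀ l ∈ S, V x l = 0}).eq_empty_or_nonempty with h | h
    · refine ⟨1, one_pos, fun x hx hS => ?_⟩
      have : x ∈ cube n ∩ {x | ∀ l ∈ S, V x l = 0} := ⟨hx, hS⟩
      rw [h] at this
      exact this.elim
    · obtain ⟨x, hx, hmin⟩ := hc.exists_isMinOn h
        ((hK.continuousOn.mono inter_subset_left).norm)
      exact ⟨_, hV.norm_cofVec_pos hi hx.1 hx.2, fun y hy hS => hmin ⟨hy, hS⟩⟩
  let G : Vec n → Vec n := fun x => ((-1 : ℝ) ^ S.card / c) • cofVec V i S (clamp x)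
  have hG : LipschitzWith (‖(-1 : ℝ) ^ S.card / c‖₊ * (K * 1)) G := by
    have h1 : LipschitzWith (K * 1) fun x : Vec n => cofVec V i S (clamp x) := by
      rw [← lipschitzOnWith_univ]
      exact hK.comp lipschitzWith_clamp.lipschitzOnWith fun x _ => clamp_mem x
    exact (lipschitzWith_smul _).comp h1
  refine ⟨fun x => truncate (G x), _, lipschitzWith_truncate.comp hG, fun x => norm_truncate_le _,
    fun x l hl => ?_, fun x hx j hj => ?_, fun x hx hS => ?_⟩
  · simp [truncate, G, cofVec_support hl]
  · simp [truncate, G, clamp_eq hx, DV_cofVec_eq_zero hj]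
  · have h1 := hcle x hx hS
    have h0 : 0 < ‖cofVec V i S x‖ := hc0.trans_le h1
    have h2 : ‖G x‖ = ‖cofVec V i S x‖ / c := by
      simp only [G, clamp_eq hx, norm_smul, norm_div, norm_pow, norm_neg, norm_one, one_pow,
        Real.norm_of_nonneg hc0.le]
      ring
    have h3 : 1 ≤ ‖G x‖ := by rw [h2, le_div_iff₀ hc0]; linarith
    rw [truncate, max_eq_right h3, h2, dir]
    simp only [G, clamp_eq hx, smul_smul]
    congr 1
    field_simp

/-! ### Trajectories -/

lemma Regular.hasDerivWithinAt_comp (hV : Regular σmin σmax L Λ V) {z : ℝ → Vec n} {d : Vec n}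
    {s : Set ℝ} {t : ℝ} (hz : HasDerivWithinAt z d s t) (hs : ∀ u ∈ s, z u ∈ cube n)
    (ht : t ∈ s) (j : Fin n) :
    HasDerivWithinAt (fun u => V (z u) j) (DV V (z t) d j) s t := by
  have h1 := (hV.hasFDerivWithinAt (hs t ht)).comp_hasDerivWithinAt t hz hs
  exact (EuclideanSpace.proj j : Vec n →L[ℝ] ℝ).hasFDerivAt.comp_hasDerivWithinAt t h1

lemma hasDerivWithinAt_apply {z : ℝ → Vec n} {d : Vec n} {s : Set ℝ} {t : ℝ}
    (hz : HasDerivWithinAt z d s t) (j : Fin n) :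
    HasDerivWithinAt (fun u => z u j) (d j) s t :=
  (EuclideanSpace.proj j : Vec n →L[ℝ] ℝ).hasFDerivAt.comp_hasDerivWithinAt t hz

lemma eq_of_hasDerivWithinAt_zero {f : ℝ → ℝ} {a b : ℝ}
    (hf : ∀ t ∈ Icc a b, HasDerivWithinAt f 0 (Icc a b) t) : ∀ t ∈ Icc a b, f t = f a := by
  refine constant_of_has_deriv_right_zero (fun t ht => (hf t ht).continuousWithinAt)
    fun t ht => ?_
  exact (hf t ⟨ht.1, ht.2.le⟩).mono_of_mem_nhdsWithin
    (mem_of_superset (Icc_mem_nhdsGE ht.2) (Icc_subset_Icc_left ht.1))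

variable {x : Vec n} {τ : ℝ} {z : ℝ → Vec n}

lemma Regular.zero_of_trajectory (hV : Regular σmin σmax L Λ V) (hz : IsTrajectory V i S x τ z)
    (hS : ∀ l ∈ S, V x l = 0) : ∀ t ∈ Icc 0 τ, ∀ l ∈ S, V (z t) l = 0 := by
  intro t ht l hl
  rw [eq_of_hasDerivWithinAt_zero (f := fun u => V (z u) l) (a := 0) (b := τ) ?_ t ht, hz.2.1]
  · exact hS l hl
  intro u hu
  obtain ⟨d, hd, hzd⟩ := (hz.2.2 u hu).2
  have := hV.hasDerivWithinAt_comp hzd (fun u hu => (hz.2.2 u hu).1) hu l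
  rwa [hd.1.DV_eq_zero hl] at this

lemma Regular.hasDerivWithinAt_dir (hV : Regular σmin σmax L Λ V) (hi : i ∉ S)
    (hz : IsTrajectory V i S x τ z) (hS : ∀ l ∈ S, V x l = 0) :
    ∀ t ∈ Icc 0 τ, HasDerivWithinAt z (dir V i S (z t)) (Icc 0 τ) t := by
  intro t ht
  obtain ⟨hc, d, hd, hzd⟩ := hz.2.2 t ht
  rwa [hV.eq_dir hi hc (hV.zero_of_trajectory hz hS t ht) hd] at hzd

lemma Regular.solution_of_trajectory (hV : Regular σmin σmax L Λ V) (hi : i ∉ S)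
    {F : Vec n → Vec n} {K : NNReal} (hF : IsField V i S F K)
    (hz : IsTrajectory V i S x τ z) (hS : ∀ l ∈ S, V x l = 0) :
    ∀ t ∈ Icc 0 τ, HasDerivWithinAt z (F (z t)) (Icc 0 τ) t := by
  intro t ht
  rw [hF.eq_dir _ (hz.2.2 t ht).1 (hV.zero_of_trajectory hz hS t ht)]
  exact hV.hasDerivWithinAt_dir hi hz hS t ht

/-- The field is in the kernel at every point of the cube and not only at zeros of `V_S`; otherwise
the argument would be circular. -/
lemma Regular.zero_of_solution (hV : Regular σmin σmax L Λ V)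
    {F : Vec n → Vec n} {K : NNReal} (hF : IsField V i S F K) {a : ℝ}
    (hz : ∀ t ∈ Icc a τ, HasDerivWithinAt z (F (z t)) (Icc a τ) t)
    (hc : ∀ t ∈ Icc a τ, z t ∈ cube n) (hS : ∀ l ∈ S, V (z a) l = 0) :
    ∀ t ∈ Icc a τ, ∀ l ∈ S, V (z t) l = 0 := by
  intro t ht l hl
  rw [eq_of_hasDerivWithinAt_zero (f := fun u => V (z u) l) (a := a) (b := τ) ?_ t ht]
  · exact hS l hl
  intro u hu
  have := hV.hasDerivWithinAt_comp (hz u hu) hc hu l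
  rwa [hF.kernel _ (hc u hu) l hl] at this

lemma Regular.trajectory_of_solution (hV : Regular σmin σmax L Λ V) (hi : i ∉ S)
    {F : Vec n → Vec n} {K : NNReal} (hF : IsField V i S F K) (hτ : 0 ≤ τ)
    (hz : ∀ t ∈ Icc 0 τ, HasDerivWithinAt z (F (z t)) (Icc 0 τ) t)
    (hc : ∀ t ∈ Icc 0 τ, z t ∈ cube n) (hS : ∀ l ∈ S, V (z 0) l = 0) :
    IsTrajectory V i S (z 0) τ z := by
  refine ⟨hτ, rfl, fun t ht => ⟨hc t ht, F (z t), ?_, hz t ht⟩⟩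
  have h := hV.zero_of_solution hF hz hc hS t ht
  rw [hF.eq_dir _ (hc t ht) h]
  exact hV.isDirection_dir hi (hc t ht) h

/-- Trajectories from the same point agree. -/
lemma Regular.trajectory_eqOn (hV : Regular σmin σmax L Λ V) (hi : i ∉ S) {τ' : ℝ}
    {z' : ℝ → Vec n} (hz : IsTrajectory V i S x τ z) (hz' : IsTrajectory V i S x τ' z')
    (hS : ∀ l ∈ S, V x l = 0) (hτ : τ ≤ τ') : EqOn z z' (Icc 0 τ) := by
  obtain ⟨F, K, hF⟩ := hV.exists_isField (i := i) (S := S) hi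
  exact solution_unique hF.lipschitz (hV.solution_of_trajectory hi hF hz hS)
    (solution_mono hτ (hV.solution_of_trajectory hi hF hz' hS)) (hz.2.1.trans hz'.2.1.symm)

/-- When trajectories meet, one starts on the other. -/
lemma Regular.trajectory_meet (hV : Regular σmin σmax L Λ V) (hi : i ∉ S) {x' : Vec n} {τ' : ℝ}
    {z' : ℝ → Vec n} (hz : IsTrajectory V i S x τ z) (hz' : IsTrajectory V i S x' τ' z')
    (hS : ∀ l ∈ S, V x l = 0) (hS' : ∀ l ∈ S, V x' l = 0) {t t' : ℝ} (ht : t ∈ Icc 0 τ)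
    (ht' : t' ∈ Icc 0 τ') (htt : t ≤ t') (h : z t = z' t') : x = z' (t' - t) := by
  obtain ⟨F, K, hF⟩ := hV.exists_isField (i := i) (S := S) hi
  rw [← hz.2.1]
  exact solution_unique_backward hF.lipschitz ht.1 htt
    (solution_mono ht.2 (hV.solution_of_trajectory hi hF hz hS))
    (solution_mono ht'.2 (hV.solution_of_trajectory hi hF hz' hS')) h

/-- The coordinate under examination moves at a positive speed. -/
lemma Regular.mul_le_abs_sub (hV : Regular σmin σmax L Λ V) (hi : i ∉ S)
    (hz : IsTrajectory V i S x τ z) (hS : ∀ l ∈ S, V x l = 0) :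
    (1 + |Λ| / σmin)⁻¹ * τ ≤ |z τ i - z 0 i| := by
  rcases hz.1.eq_or_lt with h0 | h0
  · subst h0; simp
  have hd : ∀ t ∈ Icc 0 τ, HasDerivWithinAt (fun u => z u i) (dir V i S (z t) i) (Icc 0 τ) t :=
    fun t ht => hasDerivWithinAt_apply (hV.hasDerivWithinAt_dir hi hz hS t ht) i
  -- By the mean value theorem the average speed is attained at some time, where `le_abs_dir`
  -- applies.
  obtain ⟨c, hc, hc'⟩ := exists_hasDerivAt_eq_slope (fun u => z u i)
    (fun t => dir V i S (z t) i) h0 (fun t ht => (hd t ht).continuousWithinAt)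
    (fun t ht => (hd t ⟨ht.1.le, ht.2.le⟩).hasDerivAt (Icc_mem_nhds ht.1 ht.2))
  have hc'' : c ∈ Icc 0 τ := ⟨hc.1.le, hc.2.le⟩
  have h1 := hV.le_abs_dir hi (hz.2.2 c hc'').1 (hV.zero_of_trajectory hz hS c hc'')
  rw [hc', abs_div, sub_zero, abs_of_pos h0, le_div_iff₀ h0] at h1
  exact h1

end Field

/-! ### Constraints, transversality, and epochs as arcs -/

section Constraints

variable {n : ℕ} {σmin σmax L Λ : ℝ} {V : Vec n → Vec n} {i : Fin n} {S : Finset (Fin n)}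
  {x : Vec n}

/-- The points through which an epoch `(i, S)` may pass, before the sign of `V_i` is considered. -/
structure Face (V : Vec n → Vec n) (i : Fin n) (S : Finset (Fin n)) (x : Vec n) : Prop where
  mem : x ∈ cube n
  lt : ∀ j ∈ S, j < i
  zero : ∀ j ∈ S, V x j = 0
  bsat : ∀ j < i, j ∉ S → BoundarySat V x j
  tail : ∀ l, i < l → x l = 0

/-- The points through which an epoch `(i, S)` of positive duration passes. -/
structure Region (V : Vec n → Vec n) (i : Fin n) (S : Finset (Fin n)) (x : Vec n) : Prop
    extends Face V i S x where
  nonneg : 0 ≤ V x i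

lemma BoundarySat.onBoundary {j : Fin n} (h : BoundarySat V x j) : OnBoundary x j :=
  h.imp And.right And.right

lemma Face.notMem (h : Face V i S x) : i ∉ S := fun hi => lt_irrefl _ (h.lt i hi)

lemma Face.onBoundary (h : Face V i S x) {l : Fin n} (hl : l ∉ insert i S) : OnBoundary x l := by
  simp only [Finset.mem_insert, not_or] at hl
  rcases lt_or_gt_of_ne hl.1 with h' | h'
  · exact (h.bsat l h' hl.2).onBoundary
  · exact Or.inl (h.tail l h')

lemma Face.epochPoint (h : Face V i S x) : EpochPoint V i S x := ⟨h.mem, h.zero, h.bsat⟩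

lemma Regular.isDirection_of_face (hV : Regular σmin σmax L Λ V) (h : Face V i S x) :
    IsDirection V i S x (dir V i S x) := hV.isDirection_dir h.notMem h.mem h.zero

/-- The inequalities that confine an epoch. -/
inductive Con (n : ℕ) where
  | lo (k : Fin n)
  | hi (k : Fin n)
  | pos (j : Fin n)
  | neg (j : Fin n)

/-- The quantity that a constraint requires to be nonnegative. -/
def Con.val (V : Vec n → Vec n) (x : Vec n) : Con n → ℝ
  | .lo k => x k
  | .hi k => 1 - x k
  | .pos j => V x j
  | .neg j => -V x j

/-- The derivative of `Con.val` in the direction `d`. -/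
noncomputable def Con.slope (V : Vec n → Vec n) (x d : Vec n) : Con n → ℝ
  | .lo k => d k
  | .hi k => -d k
  | .pos j => DV V x d j
  | .neg j => -DV V x d j

/-- The constraints that apply to the epoch `(i, S)` on the face of the cube that contains `x`. -/
def Con.Valid (i : Fin n) (S : Finset (Fin n)) (x : Vec n) : Con n → Prop
  | .lo k => k ∈ insert i S
  | .hi k => k ∈ insert i S
  | .pos j => j = i ∨ (j < i ∧ j ∉ S ∧ x j = 1)
  | .neg j => j < i ∧ j ∉ S ∧ x j = 0

lemma Con.Valid.congr {c : Con n} {y : Vec n} (hc : c.Valid i S x)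
    (h : ∀ l, l ∉ insert i S → y l = x l) : c.Valid i S y := by
  cases c with
  | lo k => exact hc
  | hi k => exact hc
  | pos j =>
    rcases hc with hc | ⟨h1, h2, h3⟩
    · exact Or.inl hc
    · exact Or.inr ⟨h1, h2, by rw [h j (by simp [h1.ne, h2]), h3]⟩
  | neg j =>
    obtain ⟨h1, h2, h3⟩ := hc
    exact ⟨h1, h2, by rw [h j (by simp [h1.ne, h2]), h3]⟩

lemma Region.val_nonneg (h : Region V i S x) {c : Con n} (hc : c.Valid i S x) : 0 ≤ c.val V x := by
  cases c with
  | lo k => exact (h.mem k).1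
  | hi k => exact sub_nonneg.2 (h.mem k).2
  | pos j =>
    rcases hc with rfl | ⟨h1, h2, h3⟩
    · exact h.nonneg
    · rcases h.bsat j h1 h2 with h4 | h4
      · rw [h3] at h4; exact absurd h4.2 one_ne_zero
      · exact h4.1
  | neg j =>
    obtain ⟨h1, h2, h3⟩ := hc
    rcases h.bsat j h1 h2 with h4 | h4
    · exact neg_nonneg.2 h4.1
    · rw [h3] at h4; exact absurd h4.2.symm one_ne_zero

/-- Converse of `Region.val_nonneg`: on a fixed face of the cube, once `V_S = 0` is known, the
region is cut out by the valid constraints. -/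
lemma Face.region_of_val {x₀ : Vec n} (h : Face V i S x₀) (hx : x ∈ cube n)
    (hS : ∀ l ∈ S, V x l = 0) (heq : ∀ l, l ∉ insert i S → x l = x₀ l)
    (hv : ∀ c : Con n, c.Valid i S x₀ → 0 ≤ c.val V x) : Region V i S x := by
  refine ⟨⟨hx, h.lt, hS, fun j hj hjS => ?_, fun l hl => ?_⟩, hv (.pos i) (Or.inl rfl)⟩
  · have hj' := heq j (by simp [hj.ne, hjS])
    rcases h.bsat j hj hjS with h1 | h1
    · exact Or.inl ⟨neg_nonneg.1 (hv (.neg j) ⟨hj, hjS, h1.2⟩), hj'.trans h1.2⟩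
    · exact Or.inr ⟨hv (.pos j) (Or.inr ⟨hj, hjS, h1.2⟩), hj'.trans h1.2⟩
  · rw [heq l, h.tail l hl]
    simp only [Finset.mem_insert, not_or]
    exact ⟨hl.ne', fun h' => lt_asymm hl (h.lt l h')⟩

lemma Regular.dir_apply_ne_zero (hV : Regular σmin σmax L Λ V) (hi : i ∉ S) (hx : x ∈ cube n)
    (hS : ∀ l ∈ S, V x l = 0) (hb : ∀ l, l ∉ insert i S → OnBoundary x l) {k : Fin n}
    (hk : k ∈ insert i S) (hkb : OnBoundary x k) : dir V i S x k ≠ 0 := by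
  have hd := (hV.isDirection_dir hi hx hS).1
  refine hV.transversal S i hi x hx hS hb _ (fun h => ?_) hd.2.1 (fun j hj => ?_) k hk hkb
  · have := hd.1; rw [h, norm_zero] at this; exact zero_ne_one this
  · rw [sum_insert_jac_mul V x _ j i S hd.2.1]; exact hd.DV_eq_zero hj

lemma Face.zero_insert (h : Face V i S x) {j : Fin n} (hj : V x j = 0) :
    ∀ l ∈ insert j S, V x l = 0 := fun l hl => by
  rcases Finset.mem_insert.1 hl with rfl | hl
  · exact hj
  · exact h.zero l hl

lemma Face.onBoundary_insert (h : Face V i S x) {j l : Fin n} (hl : l ∉ insert i (insert j S)) :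
    OnBoundary x l := h.onBoundary fun h' => hl <| by
  simp only [Finset.mem_insert] at h' ⊢; tauto

/-- Assumption 3 for `S ∪ {j}`, transferred to `S` by `sign_DV_dir`. -/
lemma Regular.DV_dir_ne_zero (hV : Regular σmin σmax L Λ V) (h : Face V i S x) {j : Fin n}
    (hj : j < i) (hjS : j ∉ S) (hVj : V x j = 0) : DV V x (dir V i S x) j ≠ 0 := by
  have h1 := hV.sign_DV_dir h.notMem hjS hj.ne h.mem (h.zero_insert hVj)
  have h2 := hV.dir_apply_ne_zero (i := i) (S := insert j S) (by simp [hj.ne', h.notMem]) h.mem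
    (h.zero_insert hVj) (fun l hl => h.onBoundary_insert hl) (k := j) (by simp)
    (h.bsat j hj hjS).onBoundary
  intro h0
  rw [h0, sign_zero, eq_comm, sign_eq_zero_iff] at h1
  exact h2 h1

/-- An epoch never grazes a constraint. For `V_i ≥ 0` a zero slope would make the block of `S ∪ {i}`
singular, against Assumption 1; all other cases rest on Assumption 3. -/
lemma Regular.slope_ne_zero (hV : Regular σmin σmax L Λ V) (h : Face V i S x) {c : Con n}
    (hc : c.Valid i S x) (h0 : c.val V x = 0) : c.slope V x (dir V i S x) ≠ 0 := by
  cases c with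
  | lo k => exact hV.dir_apply_ne_zero h.notMem h.mem h.zero (fun l => h.onBoundary) hc (Or.inl h0)
  | hi k => exact neg_ne_zero.2 (hV.dir_apply_ne_zero h.notMem h.mem h.zero
      (fun l => h.onBoundary) hc (Or.inr (sub_eq_zero.1 h0).symm))
  | pos j =>
    rcases hc with rfl | ⟨h1, h2, h3⟩
    · intro h'
      have h1 := hV.sign_DV_dir_self h.notMem h.mem h.zero
      have h2 : DV V x (dir V j S x) j = 0 := h'
      rw [h2, sign_zero] at h1
      have h3 : ∀ a : SignType, 0 = -a → a = 0 := by decide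
      exact hV.orient_ne_zero h.mem (h.zero_insert h0) (h3 _ h1)
    · exact hV.DV_dir_ne_zero h h1 h2 h0
  | neg j => exact neg_ne_zero.2 (hV.DV_dir_ne_zero h hc.1 hc.2.1 (neg_eq_zero.1 h0))

/-- All active constraints are being left in the direction of the epoch. -/
def Inward (V : Vec n → Vec n) (i : Fin n) (S : Finset (Fin n)) (x : Vec n) : Prop :=
  ∀ c : Con n, c.Valid i S x → c.val V x = 0 → 0 < c.slope V x (dir V i S x)

lemma Regular.hasDerivWithinAt_val (hV : Regular σmin σmax L Λ V) {z : ℝ → Vec n} {d : Vec n}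
    {s : Set ℝ} {t : ℝ} (hz : HasDerivWithinAt z d s t) (hs : ∀ u ∈ s, z u ∈ cube n)
    (ht : t ∈ s) (c : Con n) :
    HasDerivWithinAt (fun u => c.val V (z u)) (c.slope V (z t) d) s t := by
  cases c with
  | lo k => exact hasDerivWithinAt_apply hz k
  | hi k => exact (hasDerivWithinAt_apply hz k).const_sub 1
  | pos j => exact hV.hasDerivWithinAt_comp hz hs ht j
  | neg j => exact (hV.hasDerivWithinAt_comp hz hs ht j).neg

lemma eventually_pos_of_hasDerivWithinAt {f : ℝ → ℝ} {f' t b : ℝ} (htb : t < b)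
    (hf : HasDerivWithinAt f f' (Icc t b) t) (h0 : 0 ≤ f t) (h1 : f t = 0 → 0 < f') :
    ∀ᶠ s in 𝓝[>] t, 0 < f s := by
  have hf' : HasDerivWithinAt f f' (Ioi t) t := by
    refine (hf.mono_of_mem_nhdsWithin ?_ : HasDerivWithinAt f f' (Ici t) t).mono Ioi_subset_Ici_self
    exact Icc_mem_nhdsGE htb
  rcases h0.eq_or_lt with h | h
  · have h2 := (hasDerivWithinAt_iff_tendsto_slope' (by simp)).1 hf'
    filter_upwards [h2.eventually (lt_mem_nhds (h1 h.symm)), self_mem_nhdsWithin] with s hs hts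
    rw [slope_def_field, ← h, sub_zero] at hs
    exact (div_pos_iff_of_pos_right (sub_pos.2 hts)).1 hs
  · exact hf'.continuousWithinAt.eventually (lt_mem_nhds h)

lemma nonpos_of_hasDerivWithinAt {f : ℝ → ℝ} {f' t : ℝ} (ht : 0 < t)
    (hf : HasDerivWithinAt f f' (Icc 0 t) t) (h0 : f t = 0) (h1 : ∀ s ∈ Icc 0 t, 0 ≤ f s) :
    f' ≤ 0 := by
  have h2 := (hasDerivWithinAt_iff_tendsto_slope' (by simp)).1 (hf.mono Ico_subset_Icc_self)
  have : (𝓝[Ico 0 t] t).NeBot := by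
    rw [nhdsWithin_Ico_eq_nhdsLT ht]; infer_instance
  refine le_of_tendsto h2 ?_
  filter_upwards [self_mem_nhdsWithin] with s hs
  rw [slope_def_field, h0, sub_zero]
  exact div_nonpos_of_nonneg_of_nonpos (h1 s ⟨hs.1, hs.2.le⟩) (sub_nonpos.2 hs.2.le)

lemma IsField.const_apply {F : Vec n → Vec n} {K : NNReal} (hF : IsField V i S F K)
    {z : ℝ → Vec n} {τ : ℝ} (hz : ∀ t ∈ Icc 0 τ, HasDerivWithinAt z (F (z t)) (Icc 0 τ) t)
    {t : ℝ} (ht : t ∈ Icc 0 τ) {l : Fin n} (hl : l ∉ insert i S) : z t l = z 0 l := by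
  refine eq_of_hasDerivWithinAt_zero (f := fun u => z u l) (fun u hu => ?_) t ht
  have := hasDerivWithinAt_apply (hz u hu) l
  rwa [hF.support _ l hl] at this

/-- An epoch enters the interior of its region from a point where it points inward. -/
lemma Regular.eventually_interior (hV : Regular σmin σmax L Λ V)
    {F : Vec n → Vec n} {K : NNReal} (hF : IsField V i S F K) {z : ℝ → Vec n} {T t : ℝ}
    (hz : ∀ t ∈ Icc 0 T, HasDerivWithinAt z (F (z t)) (Icc 0 T) t) (ht : t ∈ Ico 0 T)
    (hr : Region V i S (z t)) (hin : Inward V i S (z t)) :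
    ∀ᶠ s in 𝓝[>] t, Region V i S (z s) ∧ ∀ c : Con n, c.Valid i S (z s) → 0 < c.val V (z s) := by
  have htT : t ∈ Icc 0 T := ⟨ht.1, ht.2.le⟩
  have hzt : HasDerivWithinAt z (dir V i S (z t)) (Icc t T) t := by
    rw [← hF.eq_dir _ hr.mem hr.zero]
    exact (hz t htT).mono (Icc_subset_Icc_left ht.1)
  have hconst : ∀ s ∈ Icc 0 T, ∀ l, l ∉ insert i S → z s l = z t l := fun s hs l hl => by
    rw [hF.const_apply hz hs hl, hF.const_apply hz htT hl]
  -- The constraints on the coordinates come first: they keep `z` in the cube, where `V_S = 0`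
  -- persists and `V` can be differentiated along `z`.
  have e1 : ∀ᶠ s in 𝓝[>] t, ∀ k ∈ insert i S, 0 < z s k ∧ 0 < 1 - z s k := by
    rw [eventually_all_finset]
    intro k hk
    have h1 := hasDerivWithinAt_apply hzt k
    exact (eventually_pos_of_hasDerivWithinAt ht.2 h1 (hr.mem k).1 (hin (.lo k) hk)).and
      (eventually_pos_of_hasDerivWithinAt ht.2 (h1.const_sub 1) (sub_nonneg.2 (hr.mem k).2)
        (hin (.hi k) hk))
  have e2 : ∀ᶠ s in 𝓝[>] t, z s ∈ cube n := by
    filter_upwards [e1, Ioc_mem_nhdsGT ht.2] with s hs hsT k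
    by_cases hk : k ∈ insert i S
    · exact ⟨(hs k hk).1.le, sub_nonneg.1 (hs k hk).2.le⟩
    · rw [hconst s ⟨ht.1.trans hsT.1.le, hsT.2⟩ k hk]; exact hr.mem k
  obtain ⟨b', hb', hsub'⟩ := mem_nhdsGT_iff_exists_Ioc_subset.1 e2
  set b := min b' T with hb
  have htb : t < b := lt_min hb' ht.2
  have hsub : ∀ s ∈ Icc t b, z s ∈ cube n := fun s hs => by
    rcases hs.1.eq_or_lt with h | h
    · rw [← h]; exact hr.mem
    · exact hsub' ⟨h, hs.2.trans (min_le_left _ _)⟩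
  have hzb : ∀ s ∈ Icc t b, HasDerivWithinAt z (F (z s)) (Icc t b) s := fun s hs =>
    (hz s ⟨ht.1.trans hs.1, hs.2.trans (min_le_right _ _)⟩).mono
      (Icc_subset_Icc ht.1 (min_le_right _ _))
  have hzero := hV.zero_of_solution hF hzb hsub hr.zero
  have hzt' := hzb t (left_mem_Icc.2 htb.le)
  rw [hF.eq_dir _ hr.mem hr.zero] at hzt'
  have e3 : ∀ c : Con n, c.Valid i S (z t) → ∀ᶠ s in 𝓝[>] t, 0 < c.val V (z s) := fun c hc =>
    eventually_pos_of_hasDerivWithinAt htb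
      (hV.hasDerivWithinAt_val hzt' hsub (left_mem_Icc.2 htb.le) c) (hr.val_nonneg hc) (hin c hc)
  have e4 : ∀ᶠ s in 𝓝[>] t, ∀ c : Con n, c.Valid i S (z t) → 0 < c.val V (z s) := by
    have h1 : ∀ᶠ s in 𝓝[>] t, ∀ j : Fin n,
        (Con.Valid i S (z t) (.pos j) → 0 < Con.val V (z s) (.pos j)) ∧
        (Con.Valid i S (z t) (.neg j) → 0 < Con.val V (z s) (.neg j)) := by
      rw [eventually_all]
      intro j
      refine Eventually.and ?_ ?_
      · by_cases h : Con.Valid i S (z t) (.pos j)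
        · exact (e3 _ h).mono fun _ h' _ => h'
        · exact Eventually.of_forall fun _ h' => absurd h' h
      · by_cases h : Con.Valid i S (z t) (.neg j)
        · exact (e3 _ h).mono fun _ h' _ => h'
        · exact Eventually.of_forall fun _ h' => absurd h' h
    filter_upwards [e1, h1] with s hs1 hs2 c hc
    cases c with
    | lo k => exact (hs1 k hc).1
    | hi k => exact (hs1 k hc).2
    | pos j => exact (hs2 j).1 hc
    | neg j => exact (hs2 j).2 hc
  filter_upwards [e4, Ioc_mem_nhdsGT htb] with s hs hsb
  have hsT : s ∈ Icc 0 T := ⟨ht.1.trans hsb.1.le, hsb.2.trans (min_le_right _ _)⟩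
  have hsb' : s ∈ Icc t b := ⟨hsb.1.le, hsb.2⟩
  refine ⟨hr.toFace.region_of_val (hsub s hsb') (hzero s hsb') (hconst s hsT)
    fun c hc => (hs c hc).le, fun c hc => hs c ?_⟩
  exact hc.congr fun l hl => (hconst s hsT l hl).symm

lemma nonneg_right_of_continuousOn {f : ℝ → ℝ} {τ : ℝ} (hτ : 0 < τ)
    (hf : ContinuousWithinAt f (Icc 0 τ) τ) (h : ∀ t ∈ Ioo 0 τ, 0 ≤ f t) : 0 ≤ f τ := by
  have : (𝓝[Ioo 0 τ] τ).NeBot := by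
    rw [nhdsWithin_Ioo_eq_nhdsLT hτ]; infer_instance
  refine ge_of_tendsto (hf.mono Ioo_subset_Icc_self) ?_
  filter_upwards [self_mem_nhdsWithin] with t ht using h t ht

/-- Where a constraint is active, after the start of an epoch, the epoch points outward. -/
lemma Regular.slope_neg (hV : Regular σmin σmax L Λ V) {z : ℝ → Vec n} {τ : ℝ}
    (hz : IsTrajectory V i S x τ z) {t : ℝ} (ht : t ∈ Ioc 0 τ)
    (hr : ∀ s ∈ Icc 0 t, Region V i S (z s)) {c : Con n} (hc : c.Valid i S (z t))
    (h0 : c.val V (z t) = 0) : c.slope V (z t) (dir V i S (z t)) < 0 := by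
  have htt : t ∈ Icc 0 t := right_mem_Icc.2 ht.1.le
  have hr0 := hr 0 (left_mem_Icc.2 ht.1.le)
  have hz' : IsTrajectory V i S (z 0) τ z := by rw [hz.2.1]; exact hz
  have hd := (hV.hasDerivWithinAt_dir hr0.notMem hz' hr0.zero t ⟨ht.1.le, ht.2⟩).mono
    (Icc_subset_Icc_right ht.2)
  have h1 := hV.hasDerivWithinAt_val hd (fun u hu => (hr u hu).mem) htt c
  -- A nonnegative quantity that reaches zero has slope at most zero there; transversality makes
  -- this strict.
  refine lt_of_le_of_ne (nonpos_of_hasDerivWithinAt ht.1 h1 h0 fun s hs => ?_)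
    (hV.slope_ne_zero (hr t htt).toFace hc h0)
  refine (hr s hs).val_nonneg (hc.congr fun l hl => ?_)
  obtain ⟨F, K, hF⟩ := hV.exists_isField (i := i) (S := S) hr0.notMem
  have hsol := hV.solution_of_trajectory hr0.notMem hF hz' hr0.zero
  rw [hF.const_apply hsol ⟨hs.1, hs.2.trans ht.2⟩ hl, hF.const_apply hsol ⟨ht.1.le, ht.2⟩ hl]

/-- An epoch that points inward runs inside its region until it meets the boundary again. -/
theorem Regular.exists_epoch (hV : Regular σmin σmax L Λ V) (hr : Region V i S x)
    (hin : Inward V i S x) :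
    ∃ (τ : ℝ) (z : ℝ → Vec n), 0 < τ ∧ IsTrajectory V i S x τ z ∧
      (∀ t ∈ Icc 0 τ, Region V i S (z t)) ∧
      (∀ t ∈ Ioo 0 τ, ∀ c : Con n, c.Valid i S (z t) → c.val V (z t) ≠ 0) ∧
      ∃ c : Con n, c.Valid i S (z τ) ∧ c.val V (z τ) = 0 := by
  have hi := hr.notMem
  obtain ⟨F, K, hF⟩ := hV.exists_isField (i := i) (S := S) hi
  have hκ : 0 < 1 + |Λ| / σmin := by have := hV.pos; positivity
  -- Longer than coordinate `i` can move at its minimal speed without leaving the unit interval.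
  set T := (1 + |Λ| / σmin) + 1 with hT
  have hT0 : 0 < T := by positivity
  obtain ⟨z, hz0, hz⟩ := exists_solution hF.lipschitz hF.norm_le x hT0.le
  set Q : ℝ → Prop := fun s =>
    Region V i S (z s) ∧ ∀ c : Con n, c.Valid i S (z s) → 0 < c.val V (z s) with hQ
  -- The times at which `z` is not in the interior of the region; the epoch lasts until their
  -- infimum.
  set B := {t : ℝ | t ∈ Ioc 0 T ∧ ¬ Q t} with hB
  have hr' : Region V i S (z 0) := by rw [hz0]; exact hr
  have hin' : Inward V i S (z 0) := by rw [hz0]; exact hin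
  have hlong : ∀ b ∈ Icc 0 T, (∀ t ∈ Ioo 0 b, Q t) → ∀ t ∈ Icc 0 b, z t ∈ cube n := by
    intro b hb hq t ht k
    rcases ht.1.eq_or_lt with h | h
    · rw [← h]; exact hr'.mem k
    rcases ht.2.eq_or_lt with h' | h'
    · subst h'
      have hc : ContinuousWithinAt (fun u => z u k) (Icc 0 t) t :=
        (hasDerivWithinAt_apply (solution_mono hb.2 hz t ht) k).continuousWithinAt
      exact ⟨nonneg_right_of_continuousOn h hc fun s hs => ((hq s hs).1.mem k).1,
        sub_nonneg.1 (nonneg_right_of_continuousOn (f := fun u => 1 - z u k) h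
          (continuousWithinAt_const.sub hc) fun s hs => sub_nonneg.2 ((hq s hs).1.mem k).2)⟩
    · exact (hq t ⟨h, h'⟩).1.mem k
  have hBne : B.Nonempty := by
    by_contra hne
    have hq : ∀ t ∈ Ioo 0 T, Q t := fun t ht => by
      by_contra h; exact hne ⟨t, ⟨ht.1, ht.2.le⟩, h⟩
    have hcube := hlong T ⟨hT0.le, le_rfl⟩ hq
    have htr := hV.trajectory_of_solution hi hF hT0.le hz hcube hr'.zero
    have h1 := hV.mul_le_abs_sub hi htr hr'.zero
    have h2 : |z T i - z 0 i| ≤ 1 := by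
      have a := hcube T ⟨hT0.le, le_rfl⟩ i
      have b := hr'.mem i
      rw [abs_le]; constructor <;> linarith [a.1, a.2, b.1, b.2]
    have h3 : (1 + |Λ| / σmin)⁻¹ * T = 1 + (1 + |Λ| / σmin)⁻¹ := by
      rw [hT, mul_add, inv_mul_cancel₀ hκ.ne', mul_one]
    have h4 := inv_pos.2 hκ
    linarith
  have hBbdd : BddBelow B := ⟨0, fun t ht => ht.1.1.le⟩
  set τ := sInf B with hτ
  have hev := hV.eventually_interior hF hz ⟨le_rfl, hT0⟩ hr' hin'
  obtain ⟨ε, hε, hεQ⟩ := mem_nhdsGT_iff_exists_Ioc_subset.1 hev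
  have hτ0 : 0 < τ := lt_of_lt_of_le (mem_Ioi.1 hε) (le_csInf hBne fun t ht => by
    by_contra hlt
    exact ht.2 (hεQ ⟨ht.1.1, (not_le.1 hlt).le⟩))
  have hτT : τ ≤ T := by
    obtain ⟨t, ht⟩ := hBne
    exact (csInf_le hBbdd ht).trans ht.1.2
  have hq : ∀ t ∈ Ioo 0 τ, Q t := fun t ht => by
    by_contra h
    exact absurd (csInf_le hBbdd (⟨⟨ht.1, ht.2.le.trans hτT⟩, h⟩ : t ∈ B)) (not_le.2 ht.2)
  have hzτ := solution_mono hτT hz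
  have hcube := hlong τ ⟨hτ0.le, hτT⟩ hq
  have htr := hV.trajectory_of_solution hi hF hτ0.le hzτ hcube hr'.zero
  have hττ : τ ∈ Icc 0 τ := right_mem_Icc.2 hτ0.le
  have hconst : ∀ t ∈ Icc 0 τ, ∀ l, l ∉ insert i S → z t l = z 0 l := fun t ht l hl =>
    hF.const_apply hzτ ht hl
  have hrτ : Region V i S (z τ) := by
    refine hr'.toFace.region_of_val (hcube τ hττ)
      (hV.zero_of_solution hF hzτ hcube hr'.zero τ hττ) (hconst τ hττ) fun c hc => ?_
    refine nonneg_right_of_continuousOn (f := fun u => c.val V (z u)) hτ0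
      (hV.hasDerivWithinAt_val (hzτ τ hττ) hcube hττ c).continuousWithinAt fun t ht => ?_
    exact ((hq t ht).2 c (hc.congr (hconst t ⟨ht.1.le, ht.2.le⟩))).le
  have hreg : ∀ t ∈ Icc 0 τ, Region V i S (z t) := fun t ht => by
    rcases ht.1.eq_or_lt with h | h
    · rw [← h]; exact hr'
    rcases ht.2.eq_or_lt with h' | h'
    · rw [h']; exact hrτ
    · exact (hq t ⟨h, h'⟩).1
  rw [hz0] at htr
  refine ⟨τ, z, hτ0, htr, hreg, fun t ht c hc => ((hq t ht).2 c hc).ne', ?_⟩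
  -- If no constraint were active at `τ`, the curve would stay interior for a while longer, against
  -- the choice of `τ`.
  by_contra hno
  push Not at hno
  have hQτ : Q τ := ⟨hrτ, fun c hc => lt_of_le_of_ne (hrτ.val_nonneg hc) (hno c hc).symm⟩
  rcases hτT.eq_or_lt with h | h
  · obtain ⟨t, ht⟩ := hBne
    have : t = τ := le_antisymm (ht.1.2.trans h.ge) (csInf_le hBbdd ht)
    exact ht.2 (this ▸ hQτ)
  · have hev := hV.eventually_interior hF hz ⟨hτ0.le, h⟩ hrτ
      fun c hc h0 => absurd h0 (hno c hc)
    obtain ⟨ε, hε, hεQ⟩ := mem_nhdsGT_iff_exists_Ioc_subset.1 hev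
    have : ε ≤ sInf B := le_csInf hBne fun t ht => by
      by_contra hlt
      rcases (csInf_le hBbdd ht).eq_or_lt with h' | h'
      · exact ht.2 (h' ▸ hQτ)
      · exact ht.2 (hεQ ⟨h', (not_le.1 hlt).le⟩)
    exact absurd (mem_Ioi.1 hε) (not_lt.2 this)

/-! ### Solutions of the variational inequality -/

/-- The cube is a product, so comparing with points that differ from `x` in one coordinate decouples
the inequality. -/
lemma isVISolution_iff (hx : x ∈ cube n) :
    IsVISolution V (cube n) x ↔ ∀ j, Satisfied V x j := by
  constructor
  · intro h j
    have key : ∀ a ∈ Icc (0 : ℝ) 1, 0 ≤ V x j * (x j - a) := by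
      intro a ha
      have h1 := h.2 (WithLp.toLp 2 (Function.update x.ofLp j a)) (fun k => by
        by_cases hk : k = j
        · subst hk; simpa using ha
        · simpa [hk] using hx k)
      rw [PiLp.inner_apply, Finset.sum_eq_single j (fun k _ hk => by simp [hk]) (by simp)] at h1
      simpa [mul_comm] using h1
    have h0 := key 0 (by simp)
    have h1 := key 1 (by simp)
    have hj := hx j
    rcases lt_trichotomy (V x j) 0 with h2 | h2 | h2
    · exact Or.inr (Or.inl ⟨h2.le, le_antisymm (by nlinarith) hj.1⟩)
    · exact Or.inl h2
    · exact Or.inr (Or.inr ⟨h2.le, le_antisymm hj.2 (by nlinarith)⟩)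
  · intro h
    refine ⟨hx, fun y hy => ?_⟩
    rw [PiLp.inner_apply]
    refine Finset.sum_nonneg fun j _ => ?_
    have hj := hy j
    have : 0 ≤ V x j * (x j - y j) := by
      rcases h j with h1 | ⟨h1, h2⟩ | ⟨h1, h2⟩
      · have : V x j = 0 := h1
        simp [this]
      · rw [h2]; nlinarith [hj.1]
      · rw [h2]; nlinarith [hj.2]
    simpa [mul_comm] using this

/-! ### Exit events -/

lemma Region.active_of_satisfied (hr : Region V i S x) (h : Satisfied V x i) :
    ∃ c : Con n, c.Valid i S x ∧ c.val V x = 0 := by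
  rcases h with h | ⟨h1, h2⟩ | ⟨h1, h2⟩
  · exact ⟨.pos i, Or.inl rfl, h⟩
  · exact ⟨.pos i, Or.inl rfl, le_antisymm h1 hr.nonneg⟩
  · exact ⟨.hi i, Finset.mem_insert_self _ _, sub_eq_zero.2 h2.symm⟩

lemma Regular.badExit_iff (hV : Regular σmin σmax L Λ V) (hr : Face V i S x) {j : Fin n} :
    BadExit V i S x j ↔ j ∈ insert i S ∧
      ((0 < dir V i S x j ∧ x j = 1) ∨ (dir V i S x j < 0 ∧ x j = 0)) := by
  constructor
  · rintro ⟨-, hj, d, hd, h⟩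
    rw [hV.eq_dir hr.notMem hr.mem hr.zero hd] at h
    exact ⟨hj, h⟩
  · rintro ⟨hj, h⟩
    exact ⟨hr.epochPoint, hj, _, hV.isDirection_of_face hr, h⟩

lemma Regular.middlingExit_iff (hV : Regular σmin σmax L Λ V) (hr : Face V i S x) {j : Fin n} :
    MiddlingExit V i S x j ↔ j < i ∧ j ∉ S ∧ V x j = 0 ∧
      ((0 < DV V x (dir V i S x) j ∧ x j = 0) ∨ (DV V x (dir V i S x) j < 0 ∧ x j = 1)) := by
  constructor
  · rintro ⟨-, h1, h2, h3, d, hd, h⟩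
    rw [hV.eq_dir hr.notMem hr.mem hr.zero hd, sum_jac_mul] at h
    exact ⟨h1, h2, h3, h⟩
  · rintro ⟨h1, h2, h3, h⟩
    exact ⟨hr.epochPoint, h1, h2, h3, _, hV.isDirection_of_face hr, by rwa [sum_jac_mul]⟩

/-- A bad or middling exit happens at an active constraint, in the outward direction. -/
lemma Regular.exists_outward (hV : Regular σmin σmax L Λ V) (hr : Face V i S x)
    (h : (∃ j, BadExit V i S x j) ∨ ∃ j, MiddlingExit V i S x j) :
    ∃ c : Con n, c.Valid i S x ∧ c.val V x = 0 ∧ c.slope V x (dir V i S x) < 0 := by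
  rcases h with ⟨j, h⟩ | ⟨j, h⟩
  · obtain ⟨hj, h | h⟩ := (Regular.badExit_iff hV hr).1 h
    · exact ⟨.hi j, hj, sub_eq_zero.2 h.2.symm, neg_neg_of_pos h.1⟩
    · exact ⟨.lo j, hj, h.2, h.1⟩
  · obtain ⟨h1, h2, h3, h | h⟩ := (Regular.middlingExit_iff hV hr).1 h
    · exact ⟨.neg j, ⟨h1, h2, h.2⟩, neg_eq_zero.2 h3, neg_neg_of_pos h.1⟩
    · exact ⟨.pos j, Or.inr ⟨h1, h2, h.2⟩, h3, h.1⟩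

/-- Outward at a coordinate means bad, at `V_i` good, at an earlier `V_j` middling. Positive time is
needed for the good event of an epoch that went back. -/
lemma Regular.exitEvent_of_outward (hV : Regular σmin σmax L Λ V) {s : State n}
    (hr : Region V i s.S x) {c : Con n} (hc : c.Valid i s.S x) (h0 : c.val V x = 0)
    (h1 : c.slope V x (dir V i s.S x) < 0) {t : ℝ} (ht : 0 < t) : ExitEvent V s i t x := by
  cases c with
  | lo k => exact Or.inr (Or.inl ⟨k, (Regular.badExit_iff hV hr.toFace).2 ⟨hc, Or.inr ⟨h1, h0⟩⟩⟩)
  | hi k => exact Or.inr (Or.inl ⟨k, (Regular.badExit_iff hV hr.toFace).2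
      ⟨hc, Or.inl ⟨neg_neg_iff_pos.1 h1, (sub_eq_zero.1 h0).symm⟩⟩⟩)
  | pos j =>
    rcases hc with rfl | ⟨h2, h3, h4⟩
    · exact Or.inl ⟨⟨hr.epochPoint, Or.inl h0⟩, fun _ => ht⟩
    · exact Or.inr (Or.inr ⟨j, (Regular.middlingExit_iff hV hr.toFace).2 ⟨h2, h3, h0, Or.inr ⟨h1, h4⟩⟩⟩)
  | neg j =>
    exact Or.inr (Or.inr ⟨j, (Regular.middlingExit_iff hV hr.toFace).2
      ⟨hc.1, hc.2.1, neg_eq_zero.1 h0, Or.inl ⟨neg_neg_iff_pos.1 h1, hc.2.2⟩⟩⟩)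

lemma Regular.exists_active_of_exitEvent (hV : Regular σmin σmax L Λ V) {s : State n}
    (hr : Region V i s.S x) {t : ℝ} (h : ExitEvent V s i t x) :
    ∃ c : Con n, c.Valid i s.S x ∧ c.val V x = 0 := by
  rcases h with h | h
  · exact hr.active_of_satisfied h.1.2
  · obtain ⟨c, h1, h2, -⟩ := hV.exists_outward hr.toFace h
    exact ⟨c, h1, h2⟩

end Constraints

section States

variable {n : ℕ} {σmin σmax L Λ : ℝ} {V : Vec n → Vec n} {i : Fin n} {S : Finset (Fin n)}
  {x : Vec n}

/-! ### Uniqueness of the active constraint -/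

lemma Regular.corner_coord (hV : Regular σmin σmax L Λ V) (h : Face V i S x) {k k' : Fin n}
    (hk : k ∈ insert i S) (hkb : OnBoundary x k) (hk' : k' ∈ insert i S)
    (hkb' : OnBoundary x k') : k' = k :=
  hV.corner x h.mem S i h.notMem h.zero (fun _ => h.onBoundary) k' hk' k hk hkb' hkb

/-- Otherwise `j` could join `S`, and then `j` and `k` would both be on the boundary, against
Assumption 2. So bad and middling events do not coincide. -/
lemma Regular.corner_field (hV : Regular σmin σmax L Λ V) (h : Face V i S x) {k j : Fin n}
    (hk : k ∈ insert i S) (hkb : OnBoundary x k) (hj : j < i) (hjS : j ∉ S) : V x j ≠ 0 := by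
  intro h0
  have h1 : i ∉ insert j S := by simp [hj.ne', h.notMem]
  have h2 := hV.corner x h.mem (insert j S) i h1 (h.zero_insert h0)
    (fun _ => h.onBoundary_insert) j (by simp) k
    (by simp only [Finset.mem_insert] at hk ⊢; tauto) (h.bsat j hj hjS).onBoundary hkb
  rw [← h2] at hk
  simp [hj.ne, hjS] at hk

lemma Regular.corner_field_unique (hV : Regular σmin σmax L Λ V) (h : Face V i S x) {j j' : Fin n}
    (hj : j < i) (hjS : j ∉ S) (h0 : V x j = 0) (hj' : j' < i) (hjS' : j' ∉ S)
    (h0' : V x j' = 0) : j' = j := by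
  have h1 : i ∉ insert j' (insert j S) := by simp [hj.ne', hj'.ne', h.notMem]
  refine hV.corner x h.mem (insert j' (insert j S)) i h1 (fun l hl => ?_) (fun l hl => ?_) j'
    (by simp) j (by simp) (h.bsat j' hj' hjS').onBoundary (h.bsat j hj hjS).onBoundary
  · rcases Finset.mem_insert.1 hl with rfl | hl
    · exact h0'
    · exact h.zero_insert h0 l hl
  · refine h.onBoundary fun h' => hl ?_
    simp only [Finset.mem_insert] at h' ⊢; tauto

/-- Here `i` joins `S` and `l` takes its role; both are on the boundary, against Assumption 2. -/
lemma Regular.corner_tail (hV : Regular σmin σmax L Λ V) (h : Face V i S x) (hi0 : OnBoundary x i)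
    (h0 : V x i = 0) {l : Fin n} (hl : i < l) : False := by
  have h1 : l ∉ insert i S := by
    simp only [Finset.mem_insert, not_or]
    exact ⟨hl.ne', fun h' => lt_asymm hl (h.lt l h')⟩
  have := hV.corner x h.mem (insert i S) l h1 (h.zero_insert h0)
    (fun k hk => h.onBoundary fun h' => hk (Finset.mem_insert_of_mem h')) i (by simp) l (by simp)
    hi0 (Or.inl (h.tail l hl))
  exact hl.ne this

/-! ### The states of the dynamics -/

/-- An epoch of positive duration starts from `s`. -/
structure Ready (V : Vec n → Vec n) (s : State n) (i : Fin n) : Prop where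
  idx : s.idx = (i : ℕ)
  region : Region V i s.S s.pt
  inward : Inward V i s.S s.pt
  active : ∃ c : Con n, c.Valid i s.S s.pt ∧ c.val V s.pt = 0
  back_iff : s.back = true ↔ Satisfied V s.pt i
  tail : s.back = true → ∃ l, i < l ∧ 0 < V s.pt l

/-- A new coordinate comes under examination and is satisfied at once. -/
structure Passing (V : Vec n → Vec n) (s : State n) (i : Fin n) : Prop where
  idx : s.idx = (i : ℕ)
  face : Face V i s.S s.pt
  pt_eq : s.pt i = 0
  nonpos : V s.pt i ≤ 0
  back : s.back = false
  orient : orient V s.S s.pt = 1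

/-- An earlier coordinate comes under examination again and is left at once. -/
structure Returning (V : Vec n → Vec n) (s : State n) (i : Fin n) : Prop where
  idx : s.idx = (i : ℕ)
  face : Face V i s.S s.pt
  pt_eq : s.pt i = 0
  nonpos : V s.pt i ≤ 0
  back : s.back = true
  orient : orient V s.S s.pt = -1
  tail : ∃ l, i < l ∧ 0 < V s.pt l

/-- The invariant of the dynamics. -/
def Inv (V : Vec n → Vec n) (s : State n) : Prop :=
  IsVISolution V (cube n) s.pt ∨ ∃ i, Ready V s i ∨ Passing V s i ∨ Returning V s i

/-- If `V_i ≤ 0` the coordinate is satisfied and passes. Otherwise orientation `1` makes `x_i` grow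
from `0`, and Assumption 2 leaves no other active constraint. -/
lemma Regular.inv_of_fresh (hV : Regular σmin σmax L Λ V) (h : Face V i S x) (hx : x i = 0)
    (ho : orient V S x = 1) : Inv V ⟨i, S, x, false⟩ := by
  right
  refine ⟨i, ?_⟩
  rcases le_or_gt (V x i) 0 with h0 | h0
  · exact Or.inr (Or.inl ⟨rfl, h, hx, h0, rfl, ho⟩)
  have hib : OnBoundary x i := Or.inl hx
  have hii : i ∈ insert i S := Finset.mem_insert_self _ _
  refine Or.inl ⟨rfl, ⟨h, h0.le⟩, ?_, ⟨.lo i, hii, hx⟩, ⟨by simp, ?_⟩, by simp⟩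
  · intro c hc hv
    cases c with
    | lo k =>
      have : k = i := hV.corner_coord h hii hib hc (Or.inl hv)
      subst this
      have h1 := hV.sign_dir_apply_self h.notMem h.mem h.zero
      rw [ho, sign_eq_one_iff] at h1
      exact h1
    | hi k =>
      have hk : x k = 1 := (sub_eq_zero.1 hv).symm
      have : k = i := hV.corner_coord h hii hib hc (Or.inr hk)
      subst this
      rw [hx] at hk; exact absurd hk zero_ne_one
    | pos j =>
      rcases hc with rfl | ⟨h1, h2, -⟩
      · exact absurd hv h0.ne'
      · exact absurd hv (hV.corner_field h hii hib h1 h2)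
    | neg j => exact absurd (neg_eq_zero.1 hv) (hV.corner_field h hii hib hc.1 hc.2.1)
  · rintro (h1 | h1 | h1)
    · exact absurd h1 h0.ne'
    · exact absurd h1.1 (not_le.2 h0)
    · have : x i = 1 := h1.2
      rw [hx] at this; exact absurd this zero_ne_one

/-- With orientation `-1` the epoch of `p` leaves the point where `p` is satisfied: `V_p` grows from
`0` if `p ∈ S`, and `x_p` decreases if it is `1`. If `x_p = 0`, the direction leaves the cube and
another retreat follows. -/
lemma Regular.inv_of_retreat (hV : Regular σmin σmax L Λ V) (h : Face V i S x) (hx : x i = 0)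
    (ho : orient V S x = -1) (ht : ∃ l, i ≤ l ∧ 0 < V x l) {p : Fin n}
    (hp : (p : ℕ) + 1 = (i : ℕ)) : Inv V ⟨p, S.erase p, x, true⟩ := by
  right
  refine ⟨p, ?_⟩
  have hib : OnBoundary x i := Or.inl hx
  have hii : i ∈ insert i S := Finset.mem_insert_self _ _
  have hpi : p < i := Fin.lt_def.2 (by omega)
  have hlt : ∀ j : Fin n, j < i → j ≠ p → j < p := fun j hj hjp => by
    have := Fin.val_ne_of_ne hjp
    rw [Fin.lt_def] at *; omega
  have hface : Face V p (S.erase p) x := by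
    refine ⟨h.mem, fun j hj => ?_, fun j hj => h.zero j (Finset.mem_of_mem_erase hj),
      fun j hj hjS => ?_, fun l hl => ?_⟩
    · exact hlt j (h.lt j (Finset.mem_of_mem_erase hj)) (Finset.ne_of_mem_erase hj)
    · exact h.bsat j (hj.trans hpi) fun h' => hjS (Finset.mem_erase.2 ⟨hj.ne, h'⟩)
    · by_cases hli : l = i
      · rw [hli, hx]
      · refine h.tail l ?_
        have := Fin.val_ne_of_ne hli
        rw [Fin.lt_def] at *; omega
  have htail : ∃ l, p < l ∧ 0 < V x l := by
    obtain ⟨l, hl, hl'⟩ := ht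
    exact ⟨l, hpi.trans_le hl, hl'⟩
  have hcoord : ∀ k ∈ S, ¬ OnBoundary x k := fun k hk hkb => by
    have := hV.corner_coord h hii hib (Finset.mem_insert_of_mem hk) hkb
    exact h.notMem (this ▸ hk)
  have hfield : ∀ j < i, j ∉ S → V x j ≠ 0 := fun j => hV.corner_field h hii hib
  by_cases hpS : p ∈ S
  · have hins : insert p (S.erase p) = S := Finset.insert_erase hpS
    have hVp := h.zero p hpS
    refine Or.inl ⟨rfl, ⟨hface, hVp.ge⟩, ?_, ⟨.pos p, Or.inl rfl, hVp⟩,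
      ⟨fun _ => Or.inl hVp, fun _ => rfl⟩, fun _ => htail⟩
    intro c hc hv
    cases c with
    | lo k => exact absurd (Or.inl hv) (hcoord k (hins ▸ hc))
    | hi k => exact absurd (Or.inr (sub_eq_zero.1 hv).symm) (hcoord k (hins ▸ hc))
    | pos j =>
      by_cases hjp : j = p
      · subst hjp
        have h1 := hV.sign_DV_dir_self hface.notMem hface.mem hface.zero
        rw [hins, ho, neg_neg, sign_eq_one_iff] at h1
        exact h1
      · rcases hc with rfl | ⟨h1, h2, -⟩
        · exact absurd rfl hjp
        · exact absurd hv (hfield j (h1.trans hpi) fun h' => h2 (Finset.mem_erase.2 ⟨hjp, h'⟩))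
    | neg j => exact absurd (neg_eq_zero.1 hv) (hfield j (hc.1.trans hpi)
        fun h' => hc.2.1 (Finset.mem_erase.2 ⟨hc.1.ne, h'⟩))
  · rw [Finset.erase_eq_of_notMem hpS] at hface ⊢
    rcases h.bsat p hpi hpS with ⟨h1, h2⟩ | ⟨h1, h2⟩
    · exact Or.inr (Or.inr ⟨rfl, hface, h2, h1, rfl, ho, htail⟩)
    · refine Or.inl ⟨rfl, ⟨hface, h1⟩, ?_, ⟨.hi p, Finset.mem_insert_self _ _, sub_eq_zero.2 h2.symm⟩,
        ⟨fun _ => Or.inr (Or.inr ⟨h1, h2⟩), fun _ => rfl⟩, fun _ => htail⟩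
      intro c hc hv
      cases c with
      | lo k =>
        rcases Finset.mem_insert.1 hc with rfl | hk
        · have h3 : x k = 0 := hv
          rw [h2] at h3; exact absurd h3 one_ne_zero
        · exact absurd (Or.inl hv) (hcoord k hk)
      | hi k =>
        rcases Finset.mem_insert.1 hc with rfl | hk
        · have h3 := hV.sign_dir_apply_self hface.notMem hface.mem hface.zero
          rw [ho, sign_eq_neg_one_iff] at h3
          exact neg_pos.2 h3
        · exact absurd (Or.inr (sub_eq_zero.1 hv).symm) (hcoord k hk)
      | pos j =>
        rcases hc with rfl | ⟨h3, h4, -⟩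
        · exact absurd hv (hfield j hpi hpS)
        · exact absurd hv (hfield j (h3.trans hpi) h4)
      | neg j => exact absurd (neg_eq_zero.1 hv) (hfield j (hc.1.trans hpi) hc.2.1)

/-- The orientation is demanded only if a further coordinate exists; after the last one every
coordinate is satisfied and the point is a solution. -/
lemma Regular.inv_of_advance (hV : Regular σmin σmax L Λ V) (hx : x ∈ cube n)
    (hlt : ∀ j ∈ S, j ≤ i) (hS : ∀ j ∈ S, V x j = 0)
    (hb : ∀ j ≤ i, j ∉ S → BoundarySat V x j) (ht : ∀ l, i < l → x l = 0)
    (ho : ∀ l, i < l → orient V S x = 1) : Inv V ⟨(i : ℕ) + 1, S, x, false⟩ := by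
  by_cases hn : (i : ℕ) + 1 < n
  · set i' : Fin n := ⟨(i : ℕ) + 1, hn⟩
    have hii : i < i' := Fin.lt_def.2 (Nat.lt_succ_self _)
    have h : Face V i' S x := ⟨hx, fun j hj => (hlt j hj).trans_lt hii, hS,
      fun j hj => hb j (Fin.le_def.2 (Nat.lt_succ_iff.1 (Fin.lt_def.1 hj))),
      fun l hl => ht l (hii.trans hl)⟩
    exact hV.inv_of_fresh h (ht i' hii) (ho i' hii)
  · left
    refine (isVISolution_iff hx).2 fun j => ?_
    have hj : j ≤ i := by rw [Fin.le_def]; omega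
    by_cases hjS : j ∈ S
    · exact Or.inl (hS j hjS)
    · exact Or.inr (hb j hj hjS)

lemma Region.pos_of_not_satisfied (hr : Region V i S x) (h : ¬ Satisfied V x i) : 0 < V x i :=
  lt_of_le_of_ne hr.nonneg fun h0 => h (Or.inl h0.symm)

/-- A coordinate in `S` that meets the boundary leaves `S`. -/
lemma Regular.ready_of_erase (hV : Regular σmin σmax L Λ V) (hr : Region V i S x)
    (hsat : ¬ Satisfied V x i) {j : Fin n} (hji : j ≠ i) (hbad : BadExit V i S x j) :
    Ready V ⟨i, S.erase j, x, false⟩ i := by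
  obtain ⟨hjS, hd⟩ := (hV.badExit_iff hr.toFace).1 hbad
  have hjS' : j ∈ S := by simpa [hji] using hjS
  have hjb : OnBoundary x j := hd.symm.imp And.right And.right
  have hVj := hr.zero j hjS'
  have hVi := hr.pos_of_not_satisfied hsat
  have hins : insert j (S.erase j) = S := Finset.insert_erase hjS'
  have hface : Face V i (S.erase j) x := by
    refine ⟨hr.mem, fun k hk => hr.lt k (Finset.mem_of_mem_erase hk),
      fun k hk => hr.zero k (Finset.mem_of_mem_erase hk), fun k hk hkS => ?_, hr.tail⟩
    by_cases hkj : k = j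
    · subst hkj
      exact hjb.imp (fun h => ⟨hVj.le, h⟩) (fun h => ⟨hVj.ge, h⟩)
    · exact hr.bsat k hk fun h => hkS (Finset.mem_erase.2 ⟨hkj, h⟩)
  -- The outward motion of `x_j` under `S` has the sign of the motion of `V_j` once `j` has left
  -- `S`, and there this sign is inward.
  have hsign := hV.sign_DV_dir (i := i) (S := S.erase j) (j := j) hface.notMem
    (Finset.notMem_erase j S) hji hr.mem (by rw [hins]; exact hr.zero)
  rw [hins] at hsign
  have hcoord : ∀ k ∈ insert i (S.erase j), ¬ OnBoundary x k := fun k hk hkb => by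
    have hk' : k ∈ insert i S := Finset.insert_subset_insert _ (Finset.erase_subset _ _) hk
    have := hV.corner_coord hr.toFace hjS hjb hk' hkb
    subst this
    simp [hji] at hk
  have hfield : ∀ k < i, k ∉ S.erase j → V x k = 0 → k = j := fun k hk hkS h0 => by
    by_contra hkj
    exact hV.corner_field hr.toFace hjS hjb hk (fun h => hkS (Finset.mem_erase.2 ⟨hkj, h⟩)) h0
  have hji' : j < i := hr.lt j hjS'
  refine ⟨rfl, ⟨hface, hVi.le⟩, ?_, ?_, ⟨by simp, fun h => absurd h hsat⟩, by simp⟩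
  · intro c hc hv
    cases c with
    | lo k => exact absurd (Or.inl hv) (hcoord k hc)
    | hi k => exact absurd (Or.inr (sub_eq_zero.1 hv).symm) (hcoord k hc)
    | pos k =>
      rcases hc with rfl | ⟨h1, h2, h3⟩
      · exact absurd hv hVi.ne'
      · have := hfield k h1 h2 hv
        subst this
        rcases hd with hd | hd
        · rw [sign_pos hd.1, sign_eq_one_iff] at hsign
          exact hsign
        · have h3 : x k = 1 := h3
          rw [hd.2] at h3; exact absurd h3 zero_ne_one
    | neg k =>
      have := hfield k hc.1 hc.2.1 (neg_eq_zero.1 hv)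
      subst this
      rcases hd with hd | hd
      · have h3 : x k = 0 := hc.2.2
        rw [hd.2] at h3; exact absurd h3 one_ne_zero
      · rw [sign_neg hd.1, sign_eq_neg_one_iff] at hsign
        exact neg_pos.2 hsign
  · rcases hjb with h | h
    · exact ⟨.neg j, ⟨hji', Finset.notMem_erase j S, h⟩, neg_eq_zero.2 hVj⟩
    · exact ⟨.pos j, Or.inr ⟨hji', Finset.notMem_erase j S, h⟩, hVj⟩

/-- A boundary-satisfied coordinate whose field vanishes enters `S`. -/
lemma Regular.ready_of_insert (hV : Regular σmin σmax L Λ V) (hr : Region V i S x)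
    (hsat : ¬ Satisfied V x i) {j : Fin n} (hmid : MiddlingExit V i S x j) :
    Ready V ⟨i, insert j S, x, false⟩ i := by
  obtain ⟨hji, hjS, hVj, hd⟩ := (hV.middlingExit_iff hr.toFace).1 hmid
  have hVi := hr.pos_of_not_satisfied hsat
  have hjb : OnBoundary x j := (hr.bsat j hji hjS).onBoundary
  have hface : Face V i (insert j S) x := by
    refine ⟨hr.mem, fun k hk => ?_, hr.zero_insert hVj, fun k hk hkS => ?_, hr.tail⟩
    · rcases Finset.mem_insert.1 hk with rfl | hk
      · exact hji
      · exact hr.lt k hk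
    · exact hr.bsat k hk fun h => hkS (Finset.mem_insert_of_mem h)
  have hsign := hV.sign_DV_dir hr.notMem hjS hji.ne hr.mem (hr.zero_insert hVj)
  have hj' : j ∈ insert i (insert j S) := by simp
  refine ⟨rfl, ⟨hface, hVi.le⟩, ?_, ?_, ⟨by simp, fun h => absurd h hsat⟩, by simp⟩
  · intro c hc hv
    cases c with
    | lo k =>
      have := hV.corner_coord hface hj' hjb hc (Or.inl hv)
      subst this
      rcases hd with hd | hd
      · rw [sign_pos hd.1, eq_comm, sign_eq_one_iff] at hsign
        exact hsign
      · have h3 : x k = 0 := hv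
        rw [hd.2] at h3; exact absurd h3 one_ne_zero
    | hi k =>
      have h3 : x k = 1 := (sub_eq_zero.1 hv).symm
      have := hV.corner_coord hface hj' hjb hc (Or.inr h3)
      subst this
      rcases hd with hd | hd
      · rw [hd.2] at h3; exact absurd h3 zero_ne_one
      · rw [sign_neg hd.1, eq_comm, sign_eq_neg_one_iff] at hsign
        exact neg_pos.2 hsign
    | pos k =>
      rcases hc with rfl | ⟨h1, h2, -⟩
      · exact absurd hv hVi.ne'
      · exact absurd hv (hV.corner_field hface hj' hjb h1 h2)
    | neg k => exact absurd (neg_eq_zero.1 hv) (hV.corner_field hface hj' hjb hc.1 hc.2.1)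
  · rcases hjb with h | h
    · exact ⟨.lo j, hj', h⟩
    · exact ⟨.hi j, hj', sub_eq_zero.2 h.symm⟩

/-! ### Epochs -/

lemma Update.exitEvent {s s' : State n} {τ : ℝ} (h : Update V s i τ x s') :
    ExitEvent V s i τ x := by
  cases h with
  | good_zero h _ => exact Or.inl h
  | good_boundary h _ => exact Or.inl h
  | bad_self p _ _ h => exact Or.inr (Or.inl ⟨_, h⟩)
  | bad_other j _ _ _ h => exact Or.inr (Or.inl ⟨_, h⟩)
  | middling j _ _ h => exact Or.inr (Or.inr ⟨_, h⟩)

lemma Update.pt_eq {s s' : State n} {τ : ℝ} (h : Update V s i τ x s') : s'.pt = x := by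
  cases h <;> rfl

/-- The priority of the rules leaves only the trigger open, and Assumption 2 admits a single one. -/
lemma Update.unique (hV : Regular σmin σmax L Λ V) {s s₁ s₂ : State n} {τ : ℝ}
    (hf : Face V i s.S x) (h₁ : Update V s i τ x s₁) (h₂ : Update V s i τ x s₂) : s₁ = s₂ := by
  have hbad : ∀ j j', BadExit V i s.S x j → BadExit V i s.S x j' → j = j' := fun j j' h h' => by
    obtain ⟨a, b⟩ := (hV.badExit_iff hf).1 h
    obtain ⟨a', b'⟩ := (hV.badExit_iff hf).1 h'
    exact hV.corner_coord hf a' (b'.symm.imp And.right And.right) a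
      (b.symm.imp And.right And.right)
  cases h₁ with
  | good_zero h h' =>
    cases h₂ with
    | good_zero => rfl
    | good_boundary _ g' => exact absurd h' g'
    | bad_self _ _ g => exact absurd h g
    | bad_other _ g => exact absurd h g
    | middling _ g => exact absurd h g
  | good_boundary h h' =>
    cases h₂ with
    | good_zero _ g' => exact absurd g' h'
    | good_boundary => rfl
    | bad_self _ _ g => exact absurd h g
    | bad_other _ g => exact absurd h g
    | middling _ g => exact absurd h g
  | bad_self p hp h h' =>
    cases h₂ with
    | good_zero g => exact absurd g h
    | good_boundary g => exact absurd g h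
    | bad_self p' hp' =>
      have : p = p' := Fin.ext (by omega)
      rw [this]
    | bad_other _ _ g => exact absurd h' g
    | middling _ _ g => exact absurd ⟨_, h'⟩ g
  | bad_other j h h' hj hb =>
    cases h₂ with
    | good_zero g => exact absurd g h
    | good_boundary g => exact absurd g h
    | bad_self _ _ _ g => exact absurd g h'
    | bad_other j' _ _ _ gb => rw [hbad j j' hb gb]
    | middling _ _ g => exact absurd ⟨_, hb⟩ g
  | middling j h h' hm =>
    cases h₂ with
    | good_zero g => exact absurd g h
    | good_boundary g => exact absurd g h
    | bad_self _ _ _ g => exact absurd ⟨_, g⟩ h'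
    | bad_other _ _ _ _ g => exact absurd ⟨_, g⟩ h'
    | middling j' _ _ gm =>
      obtain ⟨a, b, c, -⟩ := (hV.middlingExit_iff hf).1 hm
      obtain ⟨a', b', c', -⟩ := (hV.middlingExit_iff hf).1 gm
      rw [hV.corner_field_unique hf a' b' c' a b c]

/-- At the first coordinate `S` is empty and the empty determinant gives orientation `1`; no retreat
is ever needed there. -/
lemma exists_pred_of_orient (hf : Face V i S x) (ho : orient V S x = -1) :
    ∃ p : Fin n, (p : ℕ) + 1 = (i : ℕ) := by
  rcases Nat.eq_zero_or_pos (i : ℕ) with h | h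
  · have hS : S = ∅ := Finset.eq_empty_of_forall_notMem fun j hj => by
      have := Fin.lt_def.1 (hf.lt j hj); omega
    subst hS
    rw [orient, Matrix.det_isEmpty] at ho
    simp at ho
  · exact ⟨⟨(i : ℕ) - 1, by omega⟩, by simp; omega⟩

lemma exists_update {s : State n} {τ : ℝ} (h : ExitEvent V s i τ x)
    (hp : ¬ GoodEvent V s i τ x → BadExit V i s.S x i → ∃ p : Fin n, (p : ℕ) + 1 = (i : ℕ)) :
    ∃ s', Update V s i τ x s' := by
  by_cases hg : GoodEvent V s i τ x
  · by_cases hz : ZeroSat V x i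
    · exact ⟨_, .good_zero hg hz⟩
    · exact ⟨_, .good_boundary hg hz⟩
  by_cases hb : BadExit V i s.S x i
  · obtain ⟨p, hp⟩ := hp hg hb
    exact ⟨_, .bad_self p hp hg hb⟩
  by_cases hb' : ∃ j, BadExit V i s.S x j
  · obtain ⟨j, hj⟩ := hb'
    exact ⟨_, .bad_other j hg hb (fun h => hb (h ▸ hj)) hj⟩
  rcases h with h | h | ⟨j, h⟩
  · exact absurd h hg
  · exact absurd h hb'
  · exact ⟨_, .middling j hg hb' h⟩

/-- A complete epoch. -/
structure Epoch (V : Vec n → Vec n) (s : State n) (i : Fin n) (τ : ℝ) (z : ℝ → Vec n) : Prop where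
  exec : Executes V s i τ z
  exit : ExitEvent V s i τ (z τ)
  kind : (Ready V s i ∧ 0 < τ ∧ ∀ t ∈ Icc 0 τ, Region V i s.S (z t)) ∨
    (τ = 0 ∧ (Passing V s i ∨ Returning V s i))

lemma Epoch.face {s : State n} {τ : ℝ} {z : ℝ → Vec n} (h : Epoch V s i τ z) :
    Face V i s.S (z τ) := by
  have h0 : z 0 = s.pt := h.exec.2.2.1.2.1
  rcases h.kind with ⟨-, h1, h2⟩ | ⟨rfl, h1 | h1⟩
  · exact (h2 τ (right_mem_Icc.2 h1.le)).toFace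
  · rw [h0]; exact h1.face
  · rw [h0]; exact h1.face

lemma Epoch.zero {s : State n} {τ : ℝ} {z : ℝ → Vec n} (h : Epoch V s i τ z) :
    ∀ l ∈ s.S, V s.pt l = 0 := by
  rcases h.kind with ⟨h1, -, -⟩ | ⟨-, h1 | h1⟩
  · exact h1.region.zero
  · exact h1.face.zero
  · exact h1.face.zero

lemma isTrajectory_zero (hd : IsDirection V i S x (dir V i S x)) (hx : x ∈ cube n) :
    IsTrajectory V i S x 0 fun _ => x := by
  refine ⟨le_rfl, rfl, fun t _ => ⟨hx, _, hd, ?_⟩⟩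
  rw [Icc_self]
  exact hasDerivWithinAt_iff_hasFDerivWithinAt.2 (.of_subsingleton subsingleton_singleton)

lemma Regular.exists_epoch_of_inv (hV : Regular σmin σmax L Λ V) {s : State n} (hs : Inv V s)
    (hns : ¬ IsVISolution V (cube n) s.pt) : ∃ i τ z, Epoch V s i τ z := by
  obtain ⟨i, h | h | h⟩ := hs.resolve_left hns
  · obtain ⟨τ, z, hτ, hz, hr, hint, c, hc, hc0⟩ := hV.exists_epoch h.region h.inward
    have hττ : τ ∈ Icc 0 τ := right_mem_Icc.2 hτ.le
    refine ⟨i, τ, z, ⟨hns, h.idx, hz, fun t ht he => ?_⟩, ?_, Or.inl ⟨h, hτ, hr⟩⟩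
    -- At time `0` the active constraints are inward, which excludes bad and middling events; a good
    -- event would mean that `i` is satisfied, hence `back`, and then time `0` does not count.
    · rcases ht.1.eq_or_lt with h0 | h0
      · subst h0
        rw [hz.2.1] at he
        rcases he with he | he
        · have : s.back = true := h.back_iff.2 he.1.2
          exact lt_irrefl _ (he.2 this)
        · obtain ⟨c, h1, h2, h3⟩ := hV.exists_outward h.region.toFace he
          exact lt_asymm h3 (h.inward c h1 h2)
      · obtain ⟨c, h1, h2⟩ := hV.exists_active_of_exitEvent (hr t ⟨ht.1, ht.2.le⟩) he
        exact hint t ⟨h0, ht.2⟩ c h1 h2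
    · exact hV.exitEvent_of_outward (hr τ hττ) hc hc0 (hV.slope_neg hz ⟨hτ, le_rfl⟩ hr hc hc0) hτ
  · refine ⟨i, 0, fun _ => s.pt, ⟨hns, h.idx, isTrajectory_zero (hV.isDirection_of_face h.face)
      h.face.mem, by simp⟩, Or.inl ⟨⟨h.face.epochPoint, Or.inr (Or.inl ⟨h.nonpos, h.pt_eq⟩)⟩, ?_⟩,
      Or.inr ⟨rfl, Or.inl h⟩⟩
    simp [h.back]
  · refine ⟨i, 0, fun _ => s.pt, ⟨hns, h.idx, isTrajectory_zero (hV.isDirection_of_face h.face)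
      h.face.mem, by simp⟩, Or.inr (Or.inl ⟨i, (hV.badExit_iff h.face).2
        ⟨Finset.mem_insert_self _ _, Or.inr ⟨?_, h.pt_eq⟩⟩⟩), Or.inr ⟨rfl, Or.inr h⟩⟩
    have h1 := hV.sign_dir_apply_self h.face.notMem h.face.mem h.face.zero
    rwa [h.orient, sign_eq_neg_one_iff] at h1

/-- By uniqueness for the differential equation every execution follows the epoch, and it cannot
pass the exit event. -/
lemma Regular.executes_le (hV : Regular σmin σmax L Λ V) {s : State n} {i' : Fin n} {τ τ' : ℝ}
    {z z' : ℝ → Vec n} (h : Epoch V s i τ z) (h' : Executes V s i' τ' z') :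
    i' = i ∧ τ' ≤ τ ∧ EqOn z' z (Icc 0 τ') := by
  have hi : i' = i := Fin.ext (h'.2.1.symm.trans h.exec.2.1)
  subst hi
  have hle : τ' ≤ τ := by
    by_contra hlt
    push Not at hlt
    have heq := hV.trajectory_eqOn h.face.notMem h.exec.2.2.1 h'.2.2.1 h.zero hlt.le
    have h1 := h.exit
    have h0 := h.exec.2.2.1.1
    rw [heq (right_mem_Icc.2 h0)] at h1
    exact h'.2.2.2 τ ⟨h0, hlt⟩ h1
  exact ⟨rfl, hle, hV.trajectory_eqOn h.face.notMem h'.2.2.1 h.exec.2.2.1 h.zero hle⟩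

lemma Regular.epoch_of_step (hV : Regular σmin σmax L Λ V) {s s' : State n} {τ : ℝ}
    (hs : Inv V s) (h : EpochStep V s τ s') :
    ∃ i z, Epoch V s i τ z ∧ Update V s i τ (z τ) s' := by
  obtain ⟨i, z, hz, hu⟩ := h
  obtain ⟨j, τ', z', he⟩ := hV.exists_epoch_of_inv hs hz.1
  obtain ⟨hij, hle, heq⟩ := hV.executes_le he hz
  subst hij
  have hτ0 : 0 ≤ τ := hz.2.2.1.1
  have hττ : τ = τ' := by
    refine le_antisymm hle (not_lt.1 fun hlt => he.exec.2.2.2 τ ⟨hτ0, hlt⟩ ?_)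
    rw [← heq (right_mem_Icc.2 hτ0)]
    exact hu.exitEvent
  subst hττ
  refine ⟨i, z, ⟨hz, hu.exitEvent, he.kind.imp_left fun h => ⟨h.1, h.2.1, fun t ht => ?_⟩⟩, hu⟩
  rw [heq ht]
  exact h.2.2 t ht

lemma Regular.step_unique (hV : Regular σmin σmax L Λ V) {s s₁ s₂ : State n} {τ₁ τ₂ : ℝ}
    (hs : Inv V s) (h₁ : EpochStep V s τ₁ s₁) (h₂ : EpochStep V s τ₂ s₂) :
    τ₁ = τ₂ ∧ s₁ = s₂ := by
  obtain ⟨i₁, z₁, e₁, u₁⟩ := hV.epoch_of_step hs h₁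
  obtain ⟨i₂, z₂, e₂, u₂⟩ := hV.epoch_of_step hs h₂
  obtain ⟨hi, hle, heq⟩ := hV.executes_le e₁ e₂.exec
  obtain ⟨-, hle', -⟩ := hV.executes_le e₂ e₁.exec
  have hτ : τ₁ = τ₂ := le_antisymm hle' hle
  subst hi hτ
  refine ⟨rfl, ?_⟩
  rw [heq (right_mem_Icc.2 e₁.exec.2.2.1.1)] at u₂
  exact u₁.unique hV e₁.face u₂

/-! ### The invariant -/

/-- At `x_i = 1` with `V_i ≥ 0` the good event would have had priority, so `x_i` leaves through `0`,
downwards. -/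
lemma Regular.bad_self_of_ready (hV : Regular σmin σmax L Λ V) {s : State n} {τ : ℝ}
    (hr : Region V i s.S x) (hτ : 0 < τ) (hg : ¬ GoodEvent V s i τ x)
    (hb : BadExit V i s.S x i) : x i = 0 ∧ orient V s.S x = -1 ∧ 0 < V x i := by
  have hsat : ¬ Satisfied V x i := fun h => hg ⟨⟨hr.epochPoint, h⟩, fun _ => hτ⟩
  obtain ⟨-, h | h⟩ := (hV.badExit_iff hr.toFace).1 hb
  · exact absurd (Or.inr (Or.inr ⟨hr.nonneg, h.2⟩)) hsat
  · refine ⟨h.2, ?_, hr.pos_of_not_satisfied hsat⟩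
    rw [← hV.sign_dir_apply_self hr.notMem hr.mem hr.zero, sign_eq_neg_one_iff]
    exact h.1

lemma Returning.badExit (hV : Regular σmin σmax L Λ V) {s : State n} (h : Returning V s i) :
    BadExit V i s.S s.pt i := by
  refine (hV.badExit_iff h.face).2 ⟨Finset.mem_insert_self _ _, Or.inr ⟨?_, h.pt_eq⟩⟩
  have h1 := hV.sign_dir_apply_self h.face.notMem h.face.mem h.face.zero
  rwa [h.orient, sign_eq_neg_one_iff] at h1

lemma Regular.exists_step (hV : Regular σmin σmax L Λ V) {s : State n} (hs : Inv V s)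
    (hns : ¬ IsVISolution V (cube n) s.pt) : ∃ τ s', EpochStep V s τ s' := by
  obtain ⟨i, τ, z, h⟩ := hV.exists_epoch_of_inv hs hns
  have h0 : z 0 = s.pt := h.exec.2.2.1.2.1
  obtain ⟨s', hs'⟩ := exists_update h.exit fun hg hb => by
    rcases h.kind with ⟨-, h1, h2⟩ | ⟨rfl, h1 | h1⟩
    · have hr := h2 τ (right_mem_Icc.2 h1.le)
      exact exists_pred_of_orient hr.toFace (hV.bad_self_of_ready hr h1 hg hb).2.1
    · rw [h0] at hg
      exact absurd ⟨⟨h1.face.epochPoint, Or.inr (Or.inl ⟨h1.nonpos, h1.pt_eq⟩)⟩,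
        by simp [h1.back]⟩ hg
    · exact exists_pred_of_orient h1.face h1.orient
  exact ⟨τ, s', i, z, h.exec, hs'⟩

/-- At its end an epoch points outward, which fixes orientations: `V_i` falling to `0` gives `1` for
`S ∪ {i}`, `x_i` rising to `1` gives `1` for `S`, and `x_i` falling to `0` gives `-1` for `S`. -/
lemma Regular.inv_of_step (hV : Regular σmin σmax L Λ V) {s s' : State n} {τ : ℝ}
    (hs : Inv V s) (h : EpochStep V s τ s') : Inv V s' := by
  obtain ⟨i, z, he, hu⟩ := hV.epoch_of_step hs h
  have h0 : z 0 = s.pt := he.exec.2.2.1.2.1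
  have hle : ∀ j : Fin n, j ≤ i → j ≠ i → j < i := fun j h h' => lt_of_le_of_ne h h'
  have hgz : ∀ y, Face V i s.S y → ZeroSat V y i →
      (∀ l, i < l → orient V (insert i s.S) y = 1) →
      Inv V ⟨(i : ℕ) + 1, insert i s.S, y, false⟩ := by
    intro y hf hz ho
    refine hV.inv_of_advance hf.mem (fun j hj => ?_) (hf.zero_insert hz) (fun j hj hjS => ?_)
      hf.tail ho
    · rcases Finset.mem_insert.1 hj with rfl | hj
      · exact le_rfl
      · exact (hf.lt j hj).le
    · simp only [Finset.mem_insert, not_or] at hjS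
      exact hf.bsat j (hle j hj hjS.1) hjS.2
  have hgb : ∀ y, Face V i s.S y → BoundarySat V y i → orient V s.S y = 1 →
      Inv V ⟨(i : ℕ) + 1, s.S, y, false⟩ := by
    intro y hf hb ho
    refine hV.inv_of_advance hf.mem (fun j hj => (hf.lt j hj).le) hf.zero (fun j hj hjS => ?_)
      hf.tail fun _ _ => ho
    by_cases hji : j = i
    · rw [hji]; exact hb
    · exact hf.bsat j (hle j hj hji) hjS
  rcases he.kind with ⟨hready, hτ, hr⟩ | ⟨rfl, hp | hp⟩
  · have hrτ := hr τ (right_mem_Icc.2 hτ.le)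
    have hout : ∀ c : Con n, c.Valid i s.S (z τ) → c.val V (z τ) = 0 →
        c.slope V (z τ) (dir V i s.S (z τ)) < 0 := fun c hc hv =>
      hV.slope_neg he.exec.2.2.1 ⟨hτ, le_rfl⟩ hr hc hv
    have hsat : ¬ GoodEvent V s i τ (z τ) → ¬ Satisfied V (z τ) i := fun hg h =>
      hg ⟨⟨hrτ.epochPoint, h⟩, fun _ => hτ⟩
    have hsd := hV.sign_dir_apply_self hrτ.notMem hrτ.mem hrτ.zero
    cases hu with
    | good_zero hg hz =>
      refine hgz _ hrτ.toFace hz fun _ _ => ?_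
      have h1 : DV V (z τ) (dir V i s.S (z τ)) i < 0 := hout (.pos i) (Or.inl rfl) hz
      have h2 := hV.sign_DV_dir_self hrτ.notMem hrτ.mem hrτ.zero
      rw [sign_neg h1] at h2
      have h3 : ∀ a : SignType, -1 = -a → a = 1 := by decide
      exact h3 _ h2
    | good_boundary hg hz =>
      have hb : BoundarySat V (z τ) i := hg.1.2.resolve_left hz
      refine hgb _ hrτ.toFace hb ?_
      have h1 : z τ i = 1 := by
        rcases hb with h1 | h1
        · exact absurd (le_antisymm h1.1 hrτ.nonneg) hz
        · exact h1.2
      have h2 : -dir V i s.S (z τ) i < 0 :=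
        hout (.hi i) (Finset.mem_insert_self _ _) (sub_eq_zero.2 h1.symm)
      rw [← hsd, sign_eq_one_iff]
      linarith
    | bad_self p hp hg hb =>
      obtain ⟨h1, h2, h3⟩ := hV.bad_self_of_ready hrτ hτ hg hb
      exact hV.inv_of_retreat hrτ.toFace h1 h2 ⟨i, le_rfl, h3⟩ hp
    | bad_other j hg _ hji hb =>
      exact Or.inr ⟨i, Or.inl (hV.ready_of_erase hrτ (hsat hg) hji hb)⟩
    | middling j hg _ hm =>
      exact Or.inr ⟨i, Or.inl (hV.ready_of_insert hrτ (hsat hg) hm)⟩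
  · have hf := hp.face
    have hg : GoodEvent V s i 0 (z 0) := by
      rw [h0]
      exact ⟨⟨hf.epochPoint, Or.inr (Or.inl ⟨hp.nonpos, hp.pt_eq⟩)⟩, by simp [hp.back]⟩
    have hb : BoundarySat V (z 0) i := by rw [h0]; exact Or.inl ⟨hp.nonpos, hp.pt_eq⟩
    rw [← h0] at hf
    cases hu with
    | good_zero _ hz =>
      -- `x_i = V_i = 0` can occur at the last coordinate only, where no orientation is required.
      exact hgz _ hf hz fun l hl => (hV.corner_tail hf hb.onBoundary hz hl).elim
    | good_boundary _ hz => exact hgb _ hf hb (by rw [h0]; exact hp.orient)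
    | bad_self p hp g => exact absurd hg g
    | bad_other j g => exact absurd hg g
    | middling j g => exact absurd hg g
  · have hng : ¬ GoodEvent V s i 0 (z 0) := fun h => lt_irrefl _ (h.2 hp.back)
    have hb := hp.badExit hV
    rw [← h0] at hb
    cases hu with
    | good_zero g => exact absurd g hng
    | good_boundary g => exact absurd g hng
    | bad_self p hpi =>
      rw [h0]
      obtain ⟨l, hl, hl'⟩ := hp.tail
      exact hV.inv_of_retreat hp.face hp.pt_eq hp.orient ⟨l, hl.le, hl'⟩ hpi
    | bad_other j _ g => exact absurd hb g
    | middling j _ g => exact absurd ⟨i, hb⟩ g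

/-! ### Reversibility -/

/-- Epochs of the same kind that meet start from the same state. -/
lemma Regular.eq_of_meet (hV : Regular σmin σmax L Λ V) {s s' : State n} {τ τ' : ℝ}
    {z z' : ℝ → Vec n} (hs : Ready V s i) (hs' : Ready V s' i) (hSS : s.S = s'.S)
    (hz : IsTrajectory V i s.S s.pt τ z) (hz' : IsTrajectory V i s'.S s'.pt τ' z')
    (hr : ∀ t ∈ Icc 0 τ, Region V i s.S (z t)) (hr' : ∀ t ∈ Icc 0 τ', Region V i s'.S (z' t))
    {t t' : ℝ} (ht : t ∈ Icc 0 τ) (ht' : t' ∈ Icc 0 τ') (h : z t = z' t') : s = s' := by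
  wlog htt : t ≤ t' generalizing s s' τ τ' z z' t t'
  · exact (this hs' hs hSS.symm hz' hz hr' hr ht' ht h.symm (not_le.1 htt).le).symm
  have hstart : s.pt = z' (t' - t) := by
    have h1 := hz'
    rw [← hSS] at h1
    exact hV.trajectory_meet hs.region.notMem hz h1 hs.region.zero
      (hSS ▸ hs'.region.zero) ht ht' htt h
  have hpt : s.pt = s'.pt := by
    rcases htt.eq_or_lt with h1 | h1
    · rw [hstart, h1, sub_self, hz'.2.1]
    -- The start of `s` would lie on the other epoch at a positive time, where active constraints
    -- are outward; but at a start they are inward.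
    · obtain ⟨c, hc, hc0⟩ := hs.active
      have h2 := hs.inward c hc hc0
      rw [hSS, hstart] at hc h2
      rw [hstart] at hc0
      have h3 : t' - t ∈ Ioc 0 τ' := ⟨sub_pos.2 h1, by linarith [ht.1, ht'.2]⟩
      exact absurd (hV.slope_neg hz' h3 (fun u hu => hr' u ⟨hu.1, hu.2.trans h3.2⟩) hc hc0)
        (lt_asymm h2)
  have hb : s.back = s'.back := by
    rw [Bool.eq_iff_iff, hs.back_iff, hs'.back_iff, hpt]
  have hidx : s.idx = s'.idx := hs.idx.trans hs'.idx.symm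
  cases s; cases s'
  simp only [State.mk.injEq]
  exact ⟨hidx, hSS, hpt, hb⟩

/-- Two epochs of positive duration meet at the exit. An instantaneous one cannot share it with
them: passing needs `d_i > 0` at `x_i = 0`, where the other arrives with `d_i < 0`; returning would
force `V_i = x_i = 0` with a coordinate left. Passing and returning differ in orientation. -/
lemma Regular.eq_of_exit_eq (hV : Regular σmin σmax L Λ V) {s s' : State n} {τ τ' : ℝ}
    {z z' : ℝ → Vec n} (h : Epoch V s i τ z) (h' : Epoch V s' i τ' z') (hSS : s.S = s'.S)
    (hy : z τ = z' τ') : s = s' := by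
  have h0 : z 0 = s.pt := h.exec.2.2.1.2.1
  have h0' : z' 0 = s'.pt := h'.exec.2.2.1.2.1
  have hidx : s.idx = s'.idx := h.exec.2.1.trans h'.exec.2.1.symm
  have hpass : ∀ {s s' : State n} {τ' : ℝ} {z' : ℝ → Vec n}, Epoch V s' i τ' z' → s.S = s'.S →
      s.pt = z' τ' → 0 < τ' → (∀ t ∈ Icc 0 τ', Region V i s'.S (z' t)) →
      ¬ (Passing V s i ∨ Returning V s i) := by
    intro s s' τ' z' h' hSS hpt hτ hr hs
    have hrτ := hr τ' (right_mem_Icc.2 hτ.le)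
    rcases hs with hs | hs
    · have h1 : (0 : ℝ) < dir V i s.S s.pt i := by
        have := hV.sign_dir_apply_self hs.face.notMem hs.face.mem hs.face.zero
        rwa [hs.orient, sign_eq_one_iff] at this
      rw [hSS, hpt] at h1
      exact lt_asymm h1 (hV.slope_neg h'.exec.2.2.1 ⟨hτ, le_rfl⟩ hr (c := .lo i)
        (Finset.mem_insert_self _ _) (by rw [← hpt]; exact hs.pt_eq))
    · obtain ⟨l, hl, -⟩ := hs.tail
      have h1 : 0 ≤ V s.pt i := by rw [hpt]; exact hrτ.nonneg
      exact hV.corner_tail hs.face (Or.inl hs.pt_eq) (le_antisymm hs.nonpos h1) hl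
  rcases h.kind with ⟨h1, h2, h3⟩ | ⟨rfl, h1⟩ <;> rcases h'.kind with ⟨h1', h2', h3'⟩ | ⟨rfl, h1'⟩
  · exact hV.eq_of_meet h1 h1' hSS h.exec.2.2.1 h'.exec.2.2.1 h3 h3'
      (right_mem_Icc.2 h2.le) (right_mem_Icc.2 h2'.le) hy
  · exact absurd h1' (hpass h hSS.symm (h0'.symm.trans hy.symm) h2 h3)
  · exact absurd h1 (hpass h' hSS (h0.symm.trans hy) h2' h3')
  · have hpt : s.pt = s'.pt := by rw [← h0, hy, h0']
    have hb : s.back = s'.back := by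
      rcases h1 with h1 | h1 <;> rcases h1' with h1' | h1'
      · rw [h1.back, h1'.back]
      · have h2 := h1.orient
        rw [hSS, hpt, h1'.orient] at h2
        exact absurd h2 (by decide)
      · have h2 := h1.orient
        rw [hSS, hpt, h1'.orient] at h2
        exact absurd h2 (by decide)
      · rw [h1.back, h1'.back]
    cases s; cases s'
    simp only [State.mk.injEq]
    exact ⟨hidx, hSS, hpt, hb⟩

/-- What an update tells about the epoch that it ends. -/
lemma Regular.update_cases (hV : Regular σmin σmax L Λ V) {s s' : State n} {τ : ℝ}
    (hf : Face V i s.S x) (h : Update V s i τ x s') :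
    (s'.back = false ∧ s'.idx = (i : ℕ) + 1 ∧ s.S = s'.S.erase i) ∨
    (s'.back = true ∧ s'.idx + 1 = (i : ℕ) ∧ OnBoundary x i ∧
      ∃ p : Fin n, (p : ℕ) + 1 = (i : ℕ) ∧ s'.S = s.S.erase p) ∨
    (s'.back = false ∧ s'.idx = (i : ℕ) ∧ ∃ j < i, OnBoundary x j ∧
      (∀ l ∈ insert j s'.S, V x l = 0) ∧ s'.S ⊆ insert j s.S ∧ s.S ⊆ insert j s'.S ∧
      (j ∈ s'.S ↔ j ∉ s.S)) := by
  cases h with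
  | good_zero => exact Or.inl ⟨rfl, rfl, (Finset.erase_insert hf.notMem).symm⟩
  | good_boundary => exact Or.inl ⟨rfl, rfl, (Finset.erase_eq_of_notMem hf.notMem).symm⟩
  | bad_self p hp _ hb =>
    exact Or.inr (Or.inl ⟨rfl, hp, ((hV.badExit_iff hf).1 hb).2.symm.imp And.right And.right,
      p, hp, rfl⟩)
  | bad_other j _ _ hji hb =>
    obtain ⟨h1, h2⟩ := (hV.badExit_iff hf).1 hb
    have hj : j ∈ s.S := by simpa [hji] using h1
    refine Or.inr (Or.inr ⟨rfl, rfl, j, hf.lt j hj, h2.symm.imp And.right And.right, ?_, ?_, ?_, ?_⟩)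
    · simp only [Finset.insert_erase hj]; exact hf.zero
    · exact (Finset.erase_subset _ _).trans (Finset.subset_insert _ _)
    · simp only [Finset.insert_erase hj]; exact subset_rfl
    · simp [hj]
  | middling j _ _ hm =>
    obtain ⟨h1, h2, h3, -⟩ := (hV.middlingExit_iff hf).1 hm
    refine Or.inr (Or.inr ⟨rfl, rfl, j, h1, (hf.bsat j h1 h2).onBoundary, ?_, ?_, ?_, ?_⟩)
    · simp only [Finset.insert_idem]; exact hf.zero_insert h3
    · exact subset_rfl
    · exact (Finset.subset_insert _ _).trans (Finset.subset_insert _ _)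
    · simp [h2]

/-- The dynamics is reversible. -/
theorem Regular.step_injective (hV : Regular σmin σmax L Λ V) {s₁ s₂ s' : State n} {τ₁ τ₂ : ℝ}
    (hs₁ : Inv V s₁) (hs₂ : Inv V s₂) (h₁ : EpochStep V s₁ τ₁ s') (h₂ : EpochStep V s₂ τ₂ s') :
    s₁ = s₂ := by
  obtain ⟨i₁, z₁, e₁, u₁⟩ := hV.epoch_of_step hs₁ h₁
  obtain ⟨i₂, z₂, e₂, u₂⟩ := hV.epoch_of_step hs₂ h₂
  have hy : z₁ τ₁ = z₂ τ₂ := u₁.pt_eq.symm.trans u₂.pt_eq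
  have f₁ := e₁.face
  have f₂ := e₂.face
  have c₁ := hV.update_cases f₁ u₁
  have c₂ := hV.update_cases f₂ u₂
  have key : i₁ = i₂ ∧ s₁.S = s₂.S := by
    clear e₁ e₂ u₁ u₂ h₁ h₂ hs₁ hs₂
    rw [← hy] at f₂ c₂
    generalize z₁ τ₁ = y at *
    -- An advance from `i` and an exchange of `j` under `i + 1` cannot lead to the same state:
    -- coordinate `i + 1`, still at `0` in the advance, and `j` would both be on the boundary.
    have mixed : ∀ {i i' : Fin n} {S₁ S₂ : Finset (Fin n)}, Face V i S₁ y → Face V i' S₂ y →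
        (i' : ℕ) = i + 1 → (∃ j < i', OnBoundary y j ∧ (∀ l ∈ insert j s'.S, V y l = 0) ∧
          s'.S ⊆ insert j S₂ ∧ S₂ ⊆ insert j s'.S ∧ (j ∈ s'.S ↔ j ∉ S₂)) → False := by
      rintro i i' S₁ S₂ f₁ f₂ hi ⟨j, hj, hjb, hz, hsub, hsub', -⟩
      have hi0 : y i' = 0 := f₁.tail i' (Fin.lt_def.2 (by omega))
      have hi' : i' ∉ insert j s'.S := fun h' => by
        rcases Finset.mem_insert.1 h' with h' | h'
        · exact hj.ne' h'
        · rcases Finset.mem_insert.1 (hsub h') with h' | h'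
          · exact hj.ne' h'
          · exact f₂.notMem h'
      have := hV.corner y f₁.mem (insert j s'.S) i' hi' hz
        (fun l hl => f₂.onBoundary fun h' => hl (Finset.insert_subset_insert _ hsub' h'))
        j (by simp) i' (by simp) hjb (Or.inl hi0)
      exact hj.ne this
    rcases c₁ with ⟨b₁, k₁, g₁⟩ | ⟨b₁, k₁, g₁⟩ | ⟨b₁, k₁, g₁⟩ <;>
      rcases c₂ with ⟨b₂, k₂, g₂⟩ | ⟨b₂, k₂, g₂⟩ | ⟨b₂, k₂, g₂⟩ <;>
      first
      | (rw [b₁] at b₂; exact absurd b₂ (by decide))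
      | skip
    · have : i₁ = i₂ := Fin.ext (by omega)
      subst this
      exact ⟨rfl, g₁.trans g₂.symm⟩
    · exact (mixed f₁ f₂ (by omega) g₂).elim
    · have : i₁ = i₂ := Fin.ext (by omega)
      subst this
      refine ⟨rfl, ?_⟩
      obtain ⟨hb, p, hp, hS₁⟩ := g₁
      obtain ⟨-, p', hp', hS₂⟩ := g₂
      have : p = p' := Fin.ext (by omega)
      subst this
      have hpi : p < i₁ := Fin.lt_def.2 (by omega)
      -- The retreat forgets whether `p` was in `S`, but `V_p` remembers: as `y_i` is on the
      -- boundary, `V_p` vanishes only if `p` was in `S`.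
      have aux : ∀ {S₁ S₂ : Finset (Fin n)}, Face V i₁ S₁ y → Face V i₁ S₂ y → p ∈ S₁ → p ∈ S₂ :=
        fun f₁ f₂ h1 => by
          by_contra h2
          exact hV.corner_field f₂ (Finset.mem_insert_self _ _) hb hpi h2 (f₁.zero p h1)
      ext l
      by_cases hl : l = p
      · subst hl; exact ⟨aux f₁ f₂, aux f₂ f₁⟩
      · have := congrArg (l ∈ ·) (hS₁.symm.trans hS₂)
        simpa [hl] using this
    · exact (mixed f₂ f₁ (by omega) g₁).elim
    · have : i₁ = i₂ := Fin.ext (by omega)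
      subst this
      refine ⟨rfl, ?_⟩
      obtain ⟨j, hj, hjb, hz, hs, hs', hiff⟩ := g₁
      obtain ⟨j', hj', hjb', hz', ht, ht', hiff'⟩ := g₂
      have hi' : i₁ ∉ insert j' (insert j s'.S) := fun h' => by
        rcases Finset.mem_insert.1 h' with h' | h'
        · exact hj'.ne' h'
        · rcases Finset.mem_insert.1 h' with h' | h'
          · exact hj.ne' h'
          · rcases Finset.mem_insert.1 (hs h') with h' | h'
            · exact hj.ne' h'
            · exact f₁.notMem h'
      -- Assumption 2 identifies the exchanged coordinate; toggling it recovers the old set.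
      have : j' = j := hV.corner y f₁.mem (insert j' (insert j s'.S)) i₁ hi'
        (fun l hl => by
          rcases Finset.mem_insert.1 hl with rfl | hl
          · exact hz' l (by simp)
          · exact hz l hl)
        (fun l hl => f₁.onBoundary fun h' => hl (by
          rcases Finset.mem_insert.1 h' with rfl | h'
          · simp
          · have := hs' h'
            simp only [Finset.mem_insert] at this ⊢; tauto))
        j' (by simp) j (by simp) hjb' hjb
      subst this
      ext l
      by_cases hl : l = j'
      · subst hl
        tauto
      · have a : l ∈ s₁.S → l ∈ s'.S := fun h => by simpa [hl] using hs' h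
        have b : l ∈ s'.S → l ∈ s₁.S := fun h => by simpa [hl] using hs h
        have c : l ∈ s₂.S → l ∈ s'.S := fun h => by simpa [hl] using ht' h
        have d : l ∈ s'.S → l ∈ s₂.S := fun h => by simpa [hl] using ht h
        tauto
  obtain ⟨rfl, hSS⟩ := key
  exact hV.eq_of_exit_eq e₁ e₂ hSS hy

end States

section Count

/-! ### Counting -/

open MeasureTheory in
/-- Intervals that cover each point at most `N` times have total length at most `N`. -/
lemma sum_length_le {ι : Type*} (K : Finset ι) {a b : ι → ℝ} (hab : ∀ k ∈ K, a k ≤ b k)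
    (ha : ∀ k ∈ K, 0 ≤ a k) (hb : ∀ k ∈ K, b k ≤ 1) {N : ℕ}
    (hN : ∀ c : ℝ, ∀ K' ⊆ K, (∀ k ∈ K', a k < c ∧ c < b k) → K'.card ≤ N) :
    ∑ k ∈ K, (b k - a k) ≤ N := by
  classical
  have h1 : ∑ k ∈ K, volume (Ioo (a k) (b k)) ≤ N := by
    -- The sum of lengths is the integral of the number of intervals that contain `c`.
    calc ∑ k ∈ K, volume (Ioo (a k) (b k))
        = ∑ k ∈ K, ∫⁻ c, (Ioo (a k) (b k)).indicator 1 c :=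
          Finset.sum_congr rfl fun k _ => (lintegral_indicator_one measurableSet_Ioo).symm
      _ = ∫⁻ c, ∑ k ∈ K, (Ioo (a k) (b k)).indicator 1 c :=
          (lintegral_finsetSum _ fun k _ => measurable_one.indicator measurableSet_Ioo).symm
      _ ≤ ∫⁻ c, (Icc (0 : ℝ) 1).indicator (fun _ => (N : ENNReal)) c := by
          refine lintegral_mono fun c => ?_
          have h2 : ∑ k ∈ K, (Ioo (a k) (b k)).indicator (1 : ℝ → ENNReal) c =
              ((K.filter fun k => a k < c ∧ c < b k).card : ENNReal) := by
            rw [Finset.card_filter, Nat.cast_sum]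
            refine Finset.sum_congr rfl fun k _ => ?_
            simp only [indicator_apply, mem_Ioo, Pi.one_apply]
            split_ifs <;> simp
          dsimp only
          rw [h2]
          by_cases hc : c ∈ Icc (0 : ℝ) 1
          · rw [indicator_of_mem hc]
            exact_mod_cast hN c _ (Finset.filter_subset _ _) fun k hk => (Finset.mem_filter.1 hk).2
          · rw [indicator_of_notMem hc, Finset.filter_false_of_mem]
            · simp
            · intro k hk h
              exact hc ⟨(ha k hk).trans h.1.le, h.2.le.trans (hb k hk)⟩
      _ = N := by rw [lintegral_indicator_const measurableSet_Icc]; simp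
  simp only [Real.volume_Ioo] at h1
  rw [← ENNReal.ofReal_sum_of_nonneg fun k hk => sub_nonneg.2 (hab k hk),
    ENNReal.ofReal_le_iff_le_toReal (by simp)] at h1
  simpa using h1

/-- A compact set contains only boundedly many separated points. -/
lemma exists_card_le_of_separated {X : Type*} [PseudoMetricSpace X] {s : Set X} (hs : IsCompact s)
    {r : ℝ} (hr : 0 < r) :
    ∃ N : ℕ, ∀ {ι : Type} (K : Finset ι) (y : ι → X), (∀ k ∈ K, y k ∈ s) →
      (∀ k ∈ K, ∀ l ∈ K, k ≠ l → r ≤ dist (y k) (y l)) → K.card ≤ N := by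
  -- A ball of radius `r / 2` contains at most one of the points.
  obtain ⟨t, -, htf, hcov⟩ := hs.finite_cover_balls (half_pos hr)
  refine ⟨htf.toFinset.card, fun {ι} K y hy hsep => ?_⟩
  have h1 : ∀ k, ∃ p, k ∈ K → p ∈ t ∧ dist (y k) p < r / 2 := fun k => by
    by_cases hk : k ∈ K
    · obtain ⟨p, hp, hp'⟩ := mem_iUnion₂.1 (hcov (hy k hk))
      exact ⟨p, fun _ => ⟨hp, hp'⟩⟩
    · exact ⟨y k, fun h => absurd h hk⟩
  choose p hp using h1
  refine Finset.card_le_card_of_injOn p (fun k hk => by simpa using (hp k hk).1)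
    fun k hk l hl hkl => ?_
  by_contra hne
  have h2 := hsep k hk l hl hne
  have h3 := (hp k hk).2
  have h4 := (hp l hl).2
  rw [← hkl] at h4
  have := dist_triangle_right (y k) (y l) (p k)
  linarith

end Count

section Runs

variable {n : ℕ} {σmin σmax L Λ : ℝ} {V : Vec n → Vec n}

/-! ### Finitely many states -/

/-- Every such state starts at a vertex of some pair. If `V_j` with `j < i` is active, `j` is added
to `S`. If `V_i` is active, which happens only after a retreat, `i` is added and a later coordinate,
equal to `0`, replaces it. -/
lemma Regular.finite_states (hV : Regular σmin σmax L Λ V) :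
    {s : State n | ∃ i, Ready V s i ∨ Passing V s i ∨ Returning V s i}.Finite := by
  set W : Set (Vec n) := ⋃ (i : Fin n) (S : Finset (Fin n)) (_ : i ∉ S), vertices V i S with hW
  have hWf : W.Finite := finite_iUnion fun i => finite_iUnion fun S => finite_iUnion fun hi =>
    hV.finite_vertices hi
  have hmem : ∀ {i : Fin n} {S : Finset (Fin n)} {x : Vec n}, i ∉ S → x ∈ cube n →
      (∀ l ∈ S, V x l = 0) → (∀ l, l ∉ insert i S → OnBoundary x l) →
      (∃ k ∈ insert i S, OnBoundary x k) → x ∈ W := fun hi hx hS hb hk => by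
    simp only [hW, mem_iUnion]
    exact ⟨_, _, hi, hx, hS, hb, hk⟩
  have hface : ∀ {i : Fin n} {S : Finset (Fin n)} {x : Vec n}, Face V i S x →
      (∃ k ∈ insert i S, OnBoundary x k) → x ∈ W := fun h hk =>
    hmem h.notMem h.mem h.zero (fun _ => h.onBoundary) hk
  have hins : ∀ {i j : Fin n} {S : Finset (Fin n)} {x : Vec n}, Face V i S x → j < i → j ∉ S →
      V x j = 0 → x ∈ W := fun {i j S x} h hj hjS h0 =>
    hmem (i := i) (S := insert j S) (by simp [hj.ne', h.notMem]) h.mem (h.zero_insert h0)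
      (fun _ => h.onBoundary_insert) ⟨j, by simp, (h.bsat j hj hjS).onBoundary⟩
  have hsub : {s : State n | ∃ i, Ready V s i ∨ Passing V s i ∨ Returning V s i} ⊆
      (fun q : Fin n × Finset (Fin n) × Vec n × Bool => (⟨q.1, q.2.1, q.2.2.1, q.2.2.2⟩ : State n)) ''
        (univ ×ˢ (univ ×ˢ (W ×ˢ univ))) := by
    rintro s ⟨i, hs⟩
    have hidx : s.idx = (i : ℕ) := by
      rcases hs with h | h | h <;> exact h.idx
    refine ⟨(i, s.S, s.pt, s.back), ?_, ?_⟩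
    · simp only [mem_prod, mem_univ, true_and, and_true]
      rcases hs with h | h | h
      · obtain ⟨c, hc, h0⟩ := h.active
        cases c with
        | lo k => exact hface h.region.toFace ⟨k, hc, Or.inl h0⟩
        | hi k => exact hface h.region.toFace ⟨k, hc, Or.inr (sub_eq_zero.1 h0).symm⟩
        | pos j =>
          rcases hc with rfl | ⟨h1, h2, -⟩
          · obtain ⟨l, hl, -⟩ := h.tail (h.back_iff.2 (Or.inl h0))
            have hf := h.region.toFace
            refine hmem (i := l) (S := insert j s.S) ?_ hf.mem (hf.zero_insert h0)
              (fun k hk => hf.onBoundary fun h' => hk (Finset.mem_insert_of_mem h'))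
              ⟨l, by simp, Or.inl (hf.tail l hl)⟩
            simp only [Finset.mem_insert, not_or]
            exact ⟨hl.ne', fun h' => lt_asymm hl (hf.lt l h')⟩
          · exact hins h.region.toFace h1 h2 h0
        | neg j => exact hins h.region.toFace hc.1 hc.2.1 (neg_eq_zero.1 h0)
      · exact hface h.face ⟨i, by simp, Or.inl h.pt_eq⟩
      · exact hface h.face ⟨i, by simp, Or.inl h.pt_eq⟩
    · cases s
      simp only [State.mk.injEq, and_true]
      exact hidx.symm
  exact (((finite_univ.prod (finite_univ.prod (hWf.prod finite_univ)))).image _).subset hsub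

/-! ### The run of the dynamics -/

lemma zero_mem_cube : (0 : Vec n) ∈ cube n := fun j => by simp

lemma Regular.inv_start (hV : Regular σmin σmax L Λ V) : Inv V (start n) := by
  rcases Nat.eq_zero_or_pos n with h | h
  · left
    exact (isVISolution_iff zero_mem_cube).2 fun j => absurd j.2 (by omega)
  · have hf : Face V (⟨0, h⟩ : Fin n) ∅ (0 : Vec n) :=
      ⟨zero_mem_cube, by simp, by simp, fun j hj => absurd (Fin.lt_def.1 hj) (by simp),
        fun _ _ => rfl⟩
    exact hV.inv_of_fresh hf rfl (by simp [orient])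

/-- An advance gives a positive index, a retreat sets the flag, and an exchange needs a coordinate
below the first. -/
lemma Regular.not_step_start (hV : Regular σmin σmax L Λ V) {s : State n} {τ : ℝ} (hs : Inv V s) :
    ¬ EpochStep V s τ (start n) := by
  intro h
  obtain ⟨i, z, he, hu⟩ := hV.epoch_of_step hs h
  rcases hV.update_cases he.face hu with ⟨-, h, -⟩ | ⟨h, -⟩ | ⟨-, h, j, hj, -⟩
  · exact absurd h (by simp [start])
  · exact absurd h (by simp [start])
  · have h1 : (i : ℕ) = 0 := h.symm
    have := Fin.lt_def.1 hj
    omega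

/-- The states that the dynamics visits. -/
structure IsOrbit (V : Vec n → Vec n) (u : ℕ → State n) (τ : ℕ → ℝ) (m : ℕ) : Prop where
  zero : u 0 = start n
  step : ∀ k < m, EpochStep V (u k) (τ k) (u (k + 1))

variable {u : ℕ → State n} {τ : ℕ → ℝ} {m : ℕ}

lemma Regular.inv_orbit (hV : Regular σmin σmax L Λ V) (h : IsOrbit V u τ m) :
    ∀ k ≤ m, Inv V (u k) := by
  intro k hk
  induction k with
  | zero => rw [h.zero]; exact hV.inv_start
  | succ k ih => exact hV.inv_of_step (ih (by omega)) (h.step k (by omega))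

/-- Reversibility moves a repetition back to the start, which has no predecessor. -/
lemma Regular.orbit_ne (hV : Regular σmin σmax L Λ V) (h : IsOrbit V u τ m) :
    ∀ a b, a < b → b ≤ m → u a ≠ u b := by
  intro a
  induction a with
  | zero =>
    intro b hab hb heq
    obtain ⟨b, rfl⟩ : ∃ c, b = c + 1 := ⟨b - 1, by omega⟩
    have h1 := h.step b (by omega)
    rw [← heq, h.zero] at h1
    exact hV.not_step_start (hV.inv_orbit h b (by omega)) h1
  | succ a ih =>
    intro b hab hb heq
    obtain ⟨b, rfl⟩ : ∃ c, b = c + 1 := ⟨b - 1, by omega⟩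
    have h1 := h.step b (by omega)
    have h2 := h.step a (by omega)
    rw [heq] at h2
    exact ih b (by omega) (by omega) (hV.step_injective (hV.inv_orbit h a (by omega))
      (hV.inv_orbit h b (by omega)) h2 h1)

/-- The dynamics reaches a solution of the variational inequality. -/
lemma Regular.exists_orbit (hV : Regular σmin σmax L Λ V) :
    ∃ u τ m, IsOrbit V u τ m ∧ IsVISolution V (cube n) (u m).pt := by
  classical
  have hnext : ∀ s : State n, ∃ q : ℝ × State n, (∃ τ s', EpochStep V s τ s') →
      EpochStep V s q.1 q.2 := fun s => by
    by_cases h : ∃ τ s', EpochStep V s τ s'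
    · obtain ⟨τ, s', h⟩ := h
      exact ⟨(τ, s'), fun _ => h⟩
    · exact ⟨(0, s), fun h' => absurd h' h⟩
  choose q hq using hnext
  set u : ℕ → State n := fun k => (fun s => (q s).2)^[k] (start n) with hu
  have husucc : ∀ k, u (k + 1) = (q (u k)).2 := fun k => Function.iterate_succ_apply' _ _ _
  by_cases hsol : ∃ m, IsVISolution V (cube n) (u m).pt
  · refine ⟨u, fun k => (q (u k)).1, Nat.find hsol, ⟨rfl, ?_⟩, Nat.find_spec hsol⟩
    have key : ∀ k, k ≤ Nat.find hsol → IsOrbit V u (fun k => (q (u k)).1) k := by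
      intro k
      induction k with
      | zero => exact fun _ => ⟨rfl, fun _ h => absurd h (by omega)⟩
      | succ k ih =>
        intro hk
        have hok := ih (by omega)
        refine ⟨rfl, fun l hl => ?_⟩
        rcases Nat.lt_succ_iff_lt_or_eq.1 hl with hl | rfl
        · exact hok.step l hl
        · rw [husucc]
          exact hq _ (hV.exists_step (hV.inv_orbit hok l le_rfl) (Nat.find_min hsol (by omega)))
    exact (key _ le_rfl).step
  -- Without a solution the orbit would be an injective sequence in a finite set of states.
  · exfalso
    push Not at hsol
    have key : ∀ k, IsOrbit V u (fun k => (q (u k)).1) k := by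
      intro k
      induction k with
      | zero => exact ⟨rfl, fun _ h => absurd h (by omega)⟩
      | succ k ih =>
        refine ⟨rfl, fun l hl => ?_⟩
        rcases Nat.lt_succ_iff_lt_or_eq.1 hl with hl | rfl
        · exact ih.step l hl
        · rw [husucc]
          exact hq _ (hV.exists_step (hV.inv_orbit ih l le_rfl) (hsol l))
    have hinj : Function.Injective u := by
      intro a b hab
      by_contra hne
      rcases lt_or_gt_of_ne hne with h | h
      · exact hV.orbit_ne (key b) a b h le_rfl hab
      · exact hV.orbit_ne (key a) b a h le_rfl hab.symm
    refine infinite_range_of_injective hinj (hV.finite_states.subset ?_)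
    rintro _ ⟨k, rfl⟩
    exact (hV.inv_orbit (key k) k le_rfl).resolve_left (hsol k)

lemma Regular.step_nonneg (hV : Regular σmin σmax L Λ V) (h : IsOrbit V u τ m) {k : ℕ}
    (hk : k < m) : 0 ≤ τ k := by
  obtain ⟨i, z, he, -⟩ := hV.epoch_of_step (hV.inv_orbit h k hk.le) (h.step k hk)
  exact he.exec.2.2.1.1

lemma IsOrbit.run (h : IsOrbit V u τ m) (a k : ℕ) (hak : a + k ≤ m) :
    Run V (u a) k (∑ j ∈ Finset.range k, τ (a + j)) (u (a + k)) := by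
  induction k with
  | zero => simpa using Run.refl
  | succ k ih =>
    rw [Finset.sum_range_succ]
    exact (ih (by omega)).step (h.step (a + k) (by omega))

/-- Steps are unique, and no epoch is executed from a solution, so every run is an initial segment
of the orbit. -/
lemma Regular.run_eq (hV : Regular σmin σmax L Λ V) (h : IsOrbit V u τ m)
    (hm : IsVISolution V (cube n) (u m).pt) {m' : ℕ} {T' : ℝ} {s' : State n}
    (hr : Run V (start n) m' T' s') :
    m' ≤ m ∧ s' = u m' ∧ T' = ∑ j ∈ Finset.range m', τ j := by
  induction hr with
  | refl => exact ⟨Nat.zero_le _, h.zero.symm, by simp⟩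
  | @step k T τ' s s'' hr hs ih =>
    obtain ⟨hk, rfl, rfl⟩ := ih
    have hkm : k < m := by
      refine lt_of_le_of_ne hk fun hkm => ?_
      subst hkm
      obtain ⟨i, z, he, -⟩ := hs
      exact he.1 hm
    obtain ⟨h1, h2⟩ := hV.step_unique (hV.inv_orbit h k hk) hs (h.step k hkm)
    exact ⟨hkm, h2, by rw [Finset.sum_range_succ, h1]⟩

lemma Regular.stopsAt (hV : Regular σmin σmax L Λ V) (h : IsOrbit V u τ m)
    (hm : IsVISolution V (cube n) (u m).pt) :
    StopsAt V (∑ j ∈ Finset.range m, τ j) (u m).pt := by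
  have h0 := h.run 0 m (by omega)
  simp only [zero_add, h.zero] at h0
  refine ⟨m, u m, h0, rfl, hm, fun m' T' s' hr => ?_⟩
  obtain ⟨hle, rfl, rfl⟩ := hV.run_eq h hm hr
  refine ⟨⟨m - m', ∑ j ∈ Finset.range (m - m'), τ (m' + j), by omega, ?_, ?_⟩, fun i t z hz => ?_⟩
  · rw [← Finset.sum_range_add, Nat.add_sub_cancel' hle]
  · have := h.run m' (m - m') (by omega)
    rwa [Nat.add_sub_cancel' hle] at this
  · have hlt : m' < m := by
      refine lt_of_le_of_ne hle fun heq => ?_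
      subst heq
      exact hz.1 hm
    obtain ⟨j, z', he, -⟩ := hV.epoch_of_step (hV.inv_orbit h m' hle) (h.step m' hlt)
    obtain ⟨-, ht, -⟩ := hV.executes_le he hz
    calc _ ≤ ∑ j ∈ Finset.range (m' + 1), τ j := by rw [Finset.sum_range_succ]; linarith
      _ ≤ _ := Finset.sum_le_sum_of_subset_of_nonneg
          (fun j hj => Finset.mem_range.2 (by have := Finset.mem_range.1 hj; omega))
          fun j hj _ => hV.step_nonneg h (Finset.mem_range.1 hj)

/-! ### The time bound -/

/-- Either the points agree off `S` and are separated zeros of `V_S`, or some coordinate pinned to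
the boundary is `0` at one and `1` at the other. -/
lemma Regular.separated (hV : Regular σmin σmax L Λ V) {i : Fin n} {S : Finset (Fin n)}
    {x y : Vec n} (hx : Face V i S x) (hy : Face V i S y) (hi : x i = y i) (hne : x ≠ y) :
    min 1 (σmin / (|L| + 1)) ≤ dist x y := by
  rw [dist_comm, dist_eq_norm]
  by_cases h : ∀ l, l ∉ S → x l = y l
  · exact (min_le_right _ _).trans
      (hV.le_norm_sub_of_zeros hx.mem hy.mem hx.zero hy.zero h hne)
  · push Not at h
    obtain ⟨l, hl, hne⟩ := h
    have hli : l ∉ insert i S := by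
      simp only [Finset.mem_insert, not_or]
      exact ⟨fun h' => hne (h' ▸ hi), hl⟩
    refine (min_le_left _ _).trans (le_trans ?_ (PiLp.norm_apply_le (y - x) l))
    rw [PiLp.sub_apply, Real.norm_eq_abs]
    rcases hx.onBoundary hli with h1 | h1 <;> rcases hy.onBoundary hli with h2 | h2
    · exact absurd (h1.trans h2.symm) hne
    · rw [h1, h2]; norm_num
    · rw [h1, h2]; norm_num
    · exact absurd (h1.trans h2.symm) hne

/-- The total duration of the epochs of one kind is bounded. -/
lemma Regular.sum_fiber_le (hV : Regular σmin σmax L Λ V) {N : ℕ}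
    (hN : ∀ (K : Finset ℕ) (y : ℕ → Vec n), (∀ k ∈ K, y k ∈ cube n) →
      (∀ k ∈ K, ∀ l ∈ K, k ≠ l → min 1 (σmin / (|L| + 1)) ≤ dist (y k) (y l)) → K.card ≤ N)
    (h : IsOrbit V u τ m) (i : Fin n) (S : Finset (Fin n)) (K : Finset ℕ)
    (hK : ∀ k ∈ K, k < m ∧ 0 < τ k ∧ (u k).idx = (i : ℕ) ∧ (u k).S = S) :
    ∑ k ∈ K, τ k ≤ (1 + |Λ| / σmin) * N := by
  have hκ : 0 < 1 + |Λ| / σmin := by have := hV.pos; positivity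
  have hdata : ∀ k, ∃ z : ℝ → Vec n, k ∈ K → Ready V (u k) i ∧
      IsTrajectory V i (u k).S (u k).pt (τ k) z ∧
      ∀ t ∈ Icc 0 (τ k), Region V i (u k).S (z t) := by
    intro k
    by_cases hk : k ∈ K
    · obtain ⟨hkm, hk0, hki, -⟩ := hK k hk
      obtain ⟨j, z, he, -⟩ := hV.epoch_of_step (hV.inv_orbit h k hkm.le) (h.step k hkm)
      have hij : i = j := Fin.ext (hki.symm.trans he.exec.2.1)
      subst hij
      rcases he.kind with ⟨h1, -, h2⟩ | ⟨h1, -⟩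
      · exact ⟨z, fun _ => ⟨h1, he.exec.2.2.1, h2⟩⟩
      · exact absurd h1 hk0.ne'
    · exact ⟨fun _ => 0, fun h => absurd h hk⟩
  choose z hz using hdata
  set a : ℕ → ℝ := fun k => min (z k (τ k) i) (z k 0 i) with ha
  set b : ℕ → ℝ := fun k => max (z k (τ k) i) (z k 0 i) with hb
  have h0 : ∀ k ∈ K, (0 : ℝ) ∈ Icc 0 (τ k) := fun k hk => left_mem_Icc.2 (hK k hk).2.1.le
  have h1 : ∀ k ∈ K, τ k ∈ Icc 0 (τ k) := fun k hk => right_mem_Icc.2 (hK k hk).2.1.le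
  have hlen : ∀ k ∈ K, τ k ≤ (1 + |Λ| / σmin) * (b k - a k) := fun k hk => by
    obtain ⟨h2, h3, h4⟩ := hz k hk
    have h5 := hV.mul_le_abs_sub h2.region.notMem h3 h2.region.zero
    rw [inv_mul_le_iff₀ hκ] at h5
    rwa [hb, ha, max_sub_min_eq_abs']
  have hsum : ∑ k ∈ K, (b k - a k) ≤ N := by
    refine sum_length_le K (fun k _ => min_le_max)
      (fun k hk => le_min (((hz k hk).2.2 _ (h1 k hk)).mem i).1 (((hz k hk).2.2 _ (h0 k hk)).mem i).1)
      (fun k hk => max_le (((hz k hk).2.2 _ (h1 k hk)).mem i).2 (((hz k hk).2.2 _ (h0 k hk)).mem i).2)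
      fun c K' hK' hc => ?_
    -- By the intermediate value theorem every epoch whose interval contains `c` has a point at
    -- level `c`; these points are to be counted.
    have htime : ∀ k, ∃ t, k ∈ K' → t ∈ Icc 0 (τ k) ∧ z k t i = c := fun k => by
      by_cases hk : k ∈ K'
      · have hkK := hK' hk
        obtain ⟨h2, h3, -⟩ := hz k hkK
        have hcont : ContinuousOn (fun t => z k t i) (uIcc (τ k) 0) := by
          rw [uIcc_comm, uIcc_of_le (hK k hkK).2.1.le]
          exact fun t ht => (hasDerivWithinAt_apply
            (hV.hasDerivWithinAt_dir h2.region.notMem h3 h2.region.zero t ht) i).continuousWithinAt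
        obtain ⟨t, ht, htc⟩ := intermediate_value_uIcc hcont
          (⟨(hc k hk).1.le, (hc k hk).2.le⟩ : c ∈ uIcc (z k (τ k) i) (z k 0 i))
        rw [uIcc_comm, uIcc_of_le (hK k hkK).2.1.le] at ht
        exact ⟨t, fun _ => ⟨ht, htc⟩⟩
      · exact ⟨0, fun h => absurd h hk⟩
    choose t ht using htime
    have hreg : ∀ k ∈ K', Region V i S (z k (t k)) := fun k hk => by
      have := (hz k (hK' hk)).2.2 _ (ht k hk).1
      rwa [(hK k (hK' hk)).2.2.2] at this
    refine hN K' (fun k => z k (t k)) (fun k hk => (hreg k hk).mem) fun k hk l hl hkl => ?_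
    refine hV.separated (hreg k hk).toFace (hreg l hl).toFace
      ((ht k hk).2.trans (ht l hl).2.symm) fun heq => ?_
    have hk' := hK k (hK' hk)
    have hl' := hK l (hK' hl)
    obtain ⟨k1, k2, k3⟩ := hz k (hK' hk)
    obtain ⟨l1, l2, l3⟩ := hz l (hK' hl)
    -- If two of these points coincided, the epochs would start from the same state, but the orbit
    -- has no repetition.
    have := hV.eq_of_meet k1 l1 (hk'.2.2.2.trans hl'.2.2.2.symm) k2 l2 k3 l3
      (ht k hk).1 (ht l hl).1 heq
    rcases lt_or_gt_of_ne hkl with hlt | hlt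
    · exact hV.orbit_ne h k l hlt hl'.1.le this
    · exact hV.orbit_ne h l k hlt hk'.1.le this.symm
  calc ∑ k ∈ K, τ k ≤ ∑ k ∈ K, (1 + |Λ| / σmin) * (b k - a k) := Finset.sum_le_sum hlen
    _ = (1 + |Λ| / σmin) * ∑ k ∈ K, (b k - a k) := by rw [Finset.mul_sum]
    _ ≤ _ := mul_le_mul_of_nonneg_left hsum hκ.le

/-- The total duration of the epochs is bounded. -/
lemma Regular.sum_le (hV : Regular σmin σmax L Λ V) {N : ℕ}
    (hN : ∀ (K : Finset ℕ) (y : ℕ → Vec n), (∀ k ∈ K, y k ∈ cube n) →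
      (∀ k ∈ K, ∀ l ∈ K, k ≠ l → min 1 (σmin / (|L| + 1)) ≤ dist (y k) (y l)) → K.card ≤ N)
    (h : IsOrbit V u τ m) :
    ∑ j ∈ Finset.range m, τ j ≤
      Fintype.card (Fin n × Finset (Fin n)) * ((1 + |Λ| / σmin) * N) := by
  classical
  set K : Fin n × Finset (Fin n) → Finset ℕ := fun p =>
    (Finset.range m).filter fun k => 0 < τ k ∧ (u k).idx = (p.1 : ℕ) ∧ (u k).S = p.2 with hK
  have h1 : ∀ j ∈ Finset.range m, τ j ≤ ∑ p, if j ∈ K p then τ j else 0 := by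
    intro j hj
    have hjm := Finset.mem_range.1 hj
    have hτ := hV.step_nonneg h hjm
    have hnn : ∀ p ∈ Finset.univ, 0 ≤ if j ∈ K p then τ j else 0 := fun p _ => by
      split_ifs <;> simp [hτ]
    rcases hτ.eq_or_lt with h0 | h0
    · rw [← h0]; simp
    · obtain ⟨i, z, he, -⟩ := hV.epoch_of_step (hV.inv_orbit h j hjm.le) (h.step j hjm)
      have hmem : j ∈ K (i, (u j).S) :=
        Finset.mem_filter.2 ⟨hj, h0, he.exec.2.1, rfl⟩
      calc τ j = if j ∈ K (i, (u j).S) then τ j else 0 := (if_pos hmem).symm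
        _ ≤ _ := Finset.single_le_sum hnn (Finset.mem_univ _)
  calc ∑ j ∈ Finset.range m, τ j ≤ ∑ j ∈ Finset.range m, ∑ p, if j ∈ K p then τ j else 0 :=
        Finset.sum_le_sum h1
    _ = ∑ p, ∑ k ∈ K p, τ k := by
        rw [Finset.sum_comm]
        refine Finset.sum_congr rfl fun p _ => ?_
        rw [← Finset.sum_filter]
        refine Finset.sum_congr ?_ fun _ _ => rfl
        ext k
        simp only [hK, Finset.mem_filter]
        tauto
    _ ≤ ∑ _p : Fin n × Finset (Fin n), (1 + |Λ| / σmin) * N := Finset.sum_le_sum fun p _ =>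
        hV.sum_fiber_le hN h p.1 p.2 _ fun k hk => by
          obtain ⟨a, b, c, d⟩ := Finset.mem_filter.1 hk
          exact ⟨Finset.mem_range.1 a, b, c, d⟩
    _ = _ := by rw [Finset.sum_const, Finset.card_univ, nsmul_eq_mul]

/-! ### Local min-max equilibria -/

/-- Along the segment to `y` the derivative of `g` starts nonnegative, as `x` is a solution, and
falls at most at rate `Λ ‖y - x‖²`. Adding the quadratic term makes the derivative nonnegative
throughout, and the mean value theorem concludes. -/
lemma le_add_of_solution (hlip : LipschitzField Λ V) {x y : Vec n}
    (hx : IsVISolution V (cube n) x) (hy : y ∈ cube n) {g : Vec n → ℝ} {g' : Vec n → Vec n →L[ℝ] ℝ}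
    (hg : ∀ w ∈ cube n, HasFDerivWithinAt g (g' w) (cube n) w)
    (hgV : ∀ w ∈ cube n, g' w (y - x) = inner ℝ (V w) (x - y)) :
    g x ≤ g y + Λ * ‖y - x‖ ^ 2 / 2 := by
  set p : ℝ → Vec n := fun t => x + t • (y - x) with hp
  have hmem : ∀ t ∈ Icc (0 : ℝ) 1, p t ∈ cube n := fun t ht => by
    have := convex_cube hx.1 hy (sub_nonneg.2 ht.2) ht.1 (by ring)
    have h2 : p t = (1 - t) • x + t • y := by simp only [hp]; module
    rwa [h2]
  have hpd : ∀ t, HasDerivAt p (y - x) t := fun t => by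
    have := ((hasDerivAt_id t).smul_const (y - x)).const_add x
    rw [one_smul] at this
    exact this
  have hd : ∀ t ∈ Icc (0 : ℝ) 1, HasDerivWithinAt (fun t => g (p t) + Λ * ‖y - x‖ ^ 2 / 2 * t ^ 2)
      (inner ℝ (V (p t)) (x - y) + Λ * ‖y - x‖ ^ 2 / 2 * (2 * t)) (Icc 0 1) t := by
    intro t ht
    have h1 := (hg (p t) (hmem t ht)).comp_hasDerivWithinAt t (hpd t).hasDerivWithinAt hmem
    rw [hgV _ (hmem t ht)] at h1
    have h2 : HasDerivAt (fun t : ℝ => Λ * ‖y - x‖ ^ 2 / 2 * t ^ 2)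
        (Λ * ‖y - x‖ ^ 2 / 2 * (2 * t)) t := by
      simpa using (hasDerivAt_pow 2 t).const_mul (Λ * ‖y - x‖ ^ 2 / 2)
    exact h1.add h2.hasDerivWithinAt
  obtain ⟨c, hc, hceq⟩ := exists_hasDerivAt_eq_slope
    (fun t => g (p t) + Λ * ‖y - x‖ ^ 2 / 2 * t ^ 2) _ one_pos
    (fun t ht => (hd t ht).continuousWithinAt)
    (fun t ht => (hd t ⟨ht.1.le, ht.2.le⟩).hasDerivAt (Icc_mem_nhds ht.1 ht.2))
  have hc' : c ∈ Icc (0 : ℝ) 1 := ⟨hc.1.le, hc.2.le⟩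
  have h1 : inner ℝ (V x - V (p c)) (x - y) ≤ Λ * ‖y - x‖ ^ 2 * c := by
    refine (real_inner_le_norm _ _).trans ?_
    have h2 := hlip x hx.1 (p c) (hmem c hc')
    have h3 : ‖x - p c‖ = c * ‖y - x‖ := by
      simp only [hp, sub_add_cancel_left, norm_neg, norm_smul, Real.norm_of_nonneg hc.1.le]
    rw [h3] at h2
    rw [norm_sub_rev x y]
    calc _ ≤ Λ * (c * ‖y - x‖) * ‖y - x‖ := mul_le_mul_of_nonneg_right h2 (norm_nonneg _)
      _ = _ := by ring
  rw [inner_sub_left] at h1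
  have h2 := hx.2 y hy
  have h3 : p 1 = y := by simp [hp]
  have h4 : p 0 = x := by simp [hp]
  simp only [h3, h4] at hceq
  norm_num at hceq
  linarith

lemma apply_eq_sum (φ : Vec n →L[ℝ] ℝ) (d : Vec n) :
    φ d = ∑ k, d k * φ (EuclideanSpace.single k 1) := by
  conv_lhs => rw [sum_single d]
  simp [map_sum]

lemma isLocalMinMax_of_solution (hlip : LipschitzField Λ V) {x : Vec n}
    (hx : IsVISolution V (cube n) x) {f : Vec n → ℝ} {A : Finset (Fin n)}
    (hf : IsMinMaxField f A V) {ε δ : ℝ} (hε : 0 < ε) (hΛ : Λ * δ ^ 2 < 2 * ε) :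
    IsLocalMinMax f A ε δ x := by
  obtain ⟨hdiff, hA, hA'⟩ := hf
  have hsmall : ∀ y : Vec n, ‖y - x‖ ≤ δ → Λ * ‖y - x‖ ^ 2 / 2 < ε := fun y hy => by
    have h1 : ‖y - x‖ ^ 2 ≤ δ ^ 2 := pow_le_pow_left₀ (norm_nonneg _) hy 2
    -- The sign of `Λ` is not given; if it is negative, the left-hand side is at most `0`.
    rcases le_total 0 Λ with h | h
    · nlinarith
    · nlinarith [sq_nonneg ‖y - x‖]
  refine ⟨hx.1, fun y hy hyA hyδ => ?_, fun y hy hyA hyδ => ?_⟩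
  · have := le_add_of_solution hlip hx hy (g := f) (fun w hw => (hdiff w hw).hasFDerivWithinAt)
      fun w hw => by
        rw [apply_eq_sum, PiLp.inner_apply]
        refine Finset.sum_congr rfl fun k _ => ?_
        by_cases hk : k ∈ A
        · rw [hA w hw k hk]; simp; ring
        · simp [hyA k hk]
    linarith [hsmall y hyδ]
  · have := le_add_of_solution hlip hx hy (g := fun w => -f w)
      (fun w hw => (hdiff w hw).hasFDerivWithinAt.neg) fun w hw => by
        rw [apply_eq_sum, PiLp.inner_apply]
        refine Finset.sum_congr rfl fun k _ => ?_
        by_cases hk : k ∈ A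
        · simp [hyA k hk]
        · rw [hA' w hw k hk]; simp; ring
    linarith [hsmall y hyδ]

end Runs

end Stonr

/-! ### The main theorem -/

theorem theorem1 (n : ℕ) (σmin σmax L Λ : ℝ) (hσmin : 0 < σmin) (hσmax : σmin < σmax) :
    ∃ Tbar : ℝ, 0 < Tbar ∧
      ∀ V : Stonr.Vec n → Stonr.Vec n,
        Stonr.LipschitzField Λ V → Stonr.SmoothField L V →
        Stonr.Assumption1 σmin σmax V → Stonr.Assumption2 V → Stonr.Assumption3 V →
        ∃ (T : ℝ) (x : Stonr.Vec n), T ≤ Tbar ∧ Stonr.StopsAt V T x ∧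
          Stonr.IsVISolution V (Stonr.cube n) x ∧
          ∀ (f : Stonr.Vec n → ℝ) (A : Finset (Fin n)), Stonr.IsMinMaxField f A V →
            ∀ ε δ : ℝ, 0 < ε → 0 < δ → Λ * δ ^ 2 < 2 * ε →
              Stonr.IsLocalMinMax f A ε δ x := by
  have hr : 0 < min 1 (σmin / (|L| + 1)) := lt_min one_pos (by positivity)
  obtain ⟨N, hN⟩ := Stonr.exists_card_le_of_separated (Stonr.isCompact_cube (n := n)) hr
  -- The number of pairs `(i, S)` times the bound for one pair; the added `1` keeps the bound
  -- positive even for `n = 0`.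
  refine ⟨Fintype.card (Fin n × Finset (Fin n)) * ((1 + |Λ| / σmin) * N) + 1, by positivity,
    fun V hlip hsmooth h1 h2 h3 => ?_⟩
  have hV : Stonr.Regular σmin σmax L Λ V := ⟨hσmin, hlip, hsmooth, h1, h2, h3⟩
  obtain ⟨u, τ, m, hu, hm⟩ := hV.exists_orbit
  have hT := hV.sum_le (fun K y => hN K y) hu
  exact ⟨_, _, by linarith, hV.stopsAt hu hm, hm, fun f A hf ε δ hε _ hΛ =>
    Stonr.isLocalMinMax_of_solution hlip hm hf hε hΛ⟩
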